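/- Consider the one-dimensional pressureless gas equations $$\partial_t\rho+\partial_x(\rho v)=0,\qquad \partial_t(\rho v)+\partial_x(\rho v^2)=0,\qquad \rho(0,\cdot)=\bar\rho,\quad v(0,\cdot)=w .$$ Let $\bar\rho,w:\mathbb R\to\mathbb R$ be real analytic at a point $x_0$, with $\bar\rho(x_0)>0$ and, for some $t_0>0$, $$w'(x_0)=-\frac1{t_0},\qquad w''(x_0)=0,\qquad w'''(x_0)>0 .$$ Then there are $\delta>0$, $a<x_0<b$, functions $\rho,v$, and functions $y,m,\Upsilon$ such that, with $T=t_0+\delta$: 1. (Local solution.) On the region $D=\{(t,x): 0\le t\le T,\ a+t\,w(a)<x<b+t\,w(b)\}$, $(\rho,v)$ together with a point mass of size $m(t)$ located at $y(t)$, $t_0\le t\le T$, is a local solution with data $(\bar\rho,w)$ on $]a,b[$. That is: the curve $\{(t,y(t)): t_0\le t\le T\}$ lies in $D$; off this curve $\rho$ and $v$ are analytic on $D$ and $\rho>0$; $\rho(0,x)=\bar\rho(x)$ and $v(0,x)=w(x)$ for $x\in\,]a,b[$; $m(t_0)=0$ and $m(t)>0$ for $t_0<t\le T$; the functions $\rho,\rho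 v,\rho v^2$ are integrable on $D$; mass and momentum are conserved in the sense of distributions: for all $\varphi\in C^\infty_c(\mathbb R^2)$ supported in $\{t<T,\ a+t\,w(a)<x<b+t\,w(b)\}$, $$\iint_D \rho\,(\varphi_t+v\varphi_x)\,dx\,dt+\int_{t_0}^{T} m\,(\varphi_t+\dot y\,\varphi_x)(t,y(t))\,dt+\int_a^b\bar\rho(x)\varphi(0,x)\,dx=0,$$ $$\iint_D \rho v\,(\varphi_t+v\varphi_x)\,dx\,dt+\int_{t_0}^{T} m\dot y\,(\varphi_t+\dot y\,\varphi_x)(t,y(t))\,dt+\int_a^b\bar\rho(x)w(x)\varphi(0,x)\,dx=0;$$ and for $t_0<t\le T$ the one-sided limits $v^\pm=v(t,y(t)\pm)$ exist and satisfy $v^+\le\dot y(t)\le v^-$. 2. (Curve.) $y$ is analytic on $[t_0,t_0+\delta]$ and $y(t_0)=x_0+t_0w(x_0)$ (so $y(t_0)=t_0\omega_0$ with $\omega_0=w(0)$ when $x_0=0$). 3. (Mass.) $m(t)=\sqrt{t-t_0}\;\Upsilon(t)$ for $t_0\le t\le t_0+\delta$, where $\Upsilon$ is analytic on $[t_0,t_0+\delta]$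 and $\Upsilon(t_0)>0$. 4. (Stable manifold.) There are an open neighbourhood $U$ of $(t_0,x_0)$ and a function $F$ on $U$ such that the planar vector field $\mathbf f(t,x)=\bigl(1+t\,w'(x),\,F(t,x)\bigr)$ is analytic on $U$, and such that at every $(t,x)\in U$ with $1+tw'(x)<0$ there exist points $x_1<x<x_2$ in $]a,b[$ with $x_i+tw(x_i)=x+tw(x)$ and $1+tw'(x_i)>0$ $(i=1,2)$ for which $$F(t,x)=\frac{\int_{x_1}^{x_2}\bar\rho\,w\,d\xi}{\int_{x_1}^{x_2}\bar\rho\,d\xi}-w(x).$$ The point $(t_0,x_0)$ is a saddle equilibrium of $\mathbf f$: $\mathbf f(t_0,x_0)=0$, and $D\mathbf f(t_0,x_0)$ has one negative and one positive eigenvalue. The local stable manifold of $(t_0,x_0)$ in $U$ (the set of points whose forward trajectory under $\mathbf f$ stays in $U$ and converges to $(t_0,x_0)$) is the graph in $U$ of a function $t\mapsto X(t)$, analytic on the projection of $U$ to the $t$-axis; and for $t_0\le t\le t_0+\delta$ one has $(t,X(t))\in U$ and $y(t)=X(t)+t\,w(X(t))$. -/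

import Mathlib

open Set Filter MeasureTheory
open scoped Topology ContDiff

namespace PressurelessGas

/-- The part of space-time, for times in `I`, that lies strictly between the two characteristics
`t ↦ a + t w(a)` and `t ↦ b + t w(b)`. Points of space-time are written `p = (t, x)`. -/
def tube (w : ℝ → ℝ) (a b : ℝ) (I : Set ℝ) : Set (ℝ × ℝ) :=
  {p | p.1 ∈ I ∧ p.2 ∈ Ioo (a + p.1 * w a) (b + p.1 * w b)}

/-- The trajectory of a point mass, `{(t, y(t)) : t ∈ I}`. -/
def trajectory (y : ℝ → ℝ) (I : Set ℝ) : Set (ℝ × ℝ) :=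
  {p | p.1 ∈ I ∧ p.2 = y p.1}

/-- The balance law `∂ₜ μ + ∂ₓ (v μ) = 0` with initial value `g₀` at time `0`, in the sense of
distributions on the tube over `[0, T)`, where `μ` has the density `g` with respect to Lebesgue
measure, transported with velocity `v`, plus an atom of size `M(t)` at the point `y(t)`, moving
with velocity `y'(t)`, for `t ∈ [t₀, T)`.
Here `fderiv ℝ φ p (1, c)` is `∂ₜφ(p) + c ∂ₓφ(p)`. -/
def WeakBalance (w : ℝ → ℝ) (a b t₀ T : ℝ) (g v : ℝ × ℝ → ℝ) (M y : ℝ → ℝ) (g₀ : ℝ → ℝ) : Prop :=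
  ∀ φ : ℝ × ℝ → ℝ, ContDiff ℝ ∞ φ → HasCompactSupport φ → tsupport φ ⊆ tube w a b (Iio T) →
    (∫ p in tube w a b (Ioo 0 T), g p * fderiv ℝ φ p (1, v p))
      + (∫ t in t₀..T, M t * fderiv ℝ φ (t, y t) (1, deriv y t))
      + (∫ x in a..b, g₀ x * φ (0, x)) = 0

/-- `(ρ, v)`, together with one point mass of size `m(t)` located at `y(t)` for `t₀ < t ≤ T`, is a
local, piecewise analytic, admissible solution of the Cauchy problem for the pressureless gas
equations `∂ₜρ + ∂ₓ(ρ v) = 0`, `∂ₜ(ρ v) + ∂ₓ(ρ v²) = 0` with data `(ρ₀, w)` on `(a, b)`, on the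
time interval `[0, T]`. -/
structure IsLocalSolution (ρ₀ w : ℝ → ℝ) (a b t₀ T : ℝ) (ρ v : ℝ × ℝ → ℝ) (y m : ℝ → ℝ) :
    Prop where
  /-- the initial data are attained -/
  initial : ∀ x ∈ Ioo a b, ρ (0, x) = ρ₀ x ∧ v (0, x) = w x
  /-- the point mass stays in the domain of the solution -/
  mem_tube : ∀ t ∈ Icc t₀ T, (t, y t) ∈ tube w a b (Icc 0 T)
  /-- the solution is analytic, with positive density, off the trajectory of the point mass -/
  analytic_density : AnalyticOnNhd ℝ ρ (tube w a b (Icc 0 T) \ trajectory y (Icc t₀ T))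
  analytic_velocity : AnalyticOnNhd ℝ v (tube w a b (Icc 0 T) \ trajectory y (Icc t₀ T))
  density_pos : ∀ p ∈ tube w a b (Icc 0 T) \ trajectory y (Icc t₀ T), 0 < ρ p
  /-- there is no point mass up to time `t₀`, and a genuine one afterwards -/
  mass_zero : m t₀ = 0
  mass_pos : ∀ t ∈ Ioc t₀ T, 0 < m t
  /-- mass, momentum and momentum flux of the gas are integrable -/
  integrable_mass : IntegrableOn ρ (tube w a b (Ioo 0 T))
  integrable_momentum : IntegrableOn (fun p ↦ ρ p * v p) (tube w a b (Ioo 0 T))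
  integrable_flux : IntegrableOn (fun p ↦ ρ p * v p ^ 2) (tube w a b (Ioo 0 T))
  /-- conservation of mass -/
  mass_balance : WeakBalance w a b t₀ T ρ v m y ρ₀
  /-- conservation of momentum -/
  momentum_balance : WeakBalance w a b t₀ T (fun p ↦ ρ p * v p) v (fun t ↦ m t * deriv y t) y
    (fun x ↦ ρ₀ x * w x)
  /-- admissibility: `v⁺ ≤ y' ≤ v⁻`, so that particles impinge on the point mass from both sides -/
  admissible : ∀ t ∈ Ioc t₀ T, ∃ vm vp : ℝ,
    Tendsto (fun x ↦ v (t, x)) (𝓝[<] (y t)) (𝓝 vm) ∧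
    Tendsto (fun x ↦ v (t, x)) (𝓝[>] (y t)) (𝓝 vp) ∧
    vp ≤ deriv y t ∧ deriv y t ≤ vm

/-- The planar vector field `(t, x) ↦ (1 + t w'(x), F(t, x))`. -/
noncomputable def planarField (w : ℝ → ℝ) (F : ℝ × ℝ → ℝ) (p : ℝ × ℝ) : ℝ × ℝ :=
  (1 + p.1 * deriv w p.2, F p)

/-- At every point `(t, x)` of `U` with `1 + t w'(x) < 0` there are two more characteristics, from
points `x₁ < x < x₂` of `(a, b)` that have not yet blown up at time `t`, which reach the same
position at time `t` as the characteristic from `x`; and `F(t, x)` is the mean velocity of the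
particles that started between `x₁` and `x₂`, minus the velocity `w(x)`. -/
def IsVelocityDefect (ρ₀ w : ℝ → ℝ) (a b : ℝ) (U : Set (ℝ × ℝ)) (F : ℝ × ℝ → ℝ) : Prop :=
  ∀ t x : ℝ, (t, x) ∈ U → 1 + t * deriv w x < 0 →
    ∃ x₁ ∈ Ioo a b, ∃ x₂ ∈ Ioo a b, x₁ < x ∧ x < x₂ ∧
      0 < 1 + t * deriv w x₁ ∧ 0 < 1 + t * deriv w x₂ ∧
      x₁ + t * w x₁ = x + t * w x ∧ x₂ + t * w x₂ = x + t * w x ∧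
      F (t, x) = (∫ ξ in x₁..x₂, ρ₀ ξ * w ξ) / (∫ ξ in x₁..x₂, ρ₀ ξ) - w x

/-- `p₀` is a saddle equilibrium of the planar vector field `f`. -/
def IsSaddle (f : ℝ × ℝ → ℝ × ℝ) (p₀ : ℝ × ℝ) : Prop :=
  f p₀ = 0 ∧ ∃ lam mu : ℝ, lam < 0 ∧ 0 < mu ∧
    Module.End.HasEigenvalue (fderiv ℝ f p₀ : (ℝ × ℝ) →ₗ[ℝ] (ℝ × ℝ)) lam ∧
    Module.End.HasEigenvalue (fderiv ℝ f p₀ : (ℝ × ℝ) →ₗ[ℝ] (ℝ × ℝ)) mu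

/-- The local stable manifold of the equilibrium `p₀` of `f` in `U`: the starting points of the
forward trajectories of `f` that stay in `U` and converge to `p₀`. -/
def localStableManifold (f : ℝ × ℝ → ℝ × ℝ) (p₀ : ℝ × ℝ) (U : Set (ℝ × ℝ)) : Set (ℝ × ℝ) :=
  {p | ∃ γ : ℝ → ℝ × ℝ, γ 0 = p ∧
    IsIntegralCurveOn γ (fun _ ↦ f) (Ici 0) ∧ (∀ s, 0 ≤ s → γ s ∈ U) ∧
    Tendsto γ atTop (𝓝 p₀)}

end PressurelessGas

/-!
The gas moves along the characteristics `t ↦ x + t w(x)` until they hit the point mass, and the point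
mass moves with the mean velocity of the particles it has absorbed. Labelling the point mass by the
(already absorbed) characteristic `X(t)` on which it sits, `y = X + t w(X)`, turns this law of motion
into `X' (1 + t w'(X)) = F(t, X)`: the graph of `X` is an orbit of the planar field
`(1 + t w'(x), F(t, x))` that passes through its equilibrium `(t₀, x₀)`.

*Analyticity of `F`.* The outer two characteristics that meet the one from `x` at time `t` start at
`S ± √R`, and by the inverse function theorem `S` and `R` are analytic functions of `(t, x)`
(`exists_analyticAt_root_pair`). The equations to be inverted are even and odd parts of a divided
difference of `w`; that these are analytic in the *square* of the half distance is seen by applying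
the power series of `w` to a `3 × 3` matrix with eigenvalues `x` and `s ± √r`
(`exists_even_odd_dividedDifference`). A mean over `[S - √R, S + √R]` is analytic in `S` and `R`, so
that `F` extends analytically to a neighbourhood of `(t₀, x₀)`; there `∂ₓS = -1/2` and `∂ₓR = 0`, which
gives `∂ₓF = 3 / (2 t₀) > 0` (`exists_analyticAt_velocityDefect`). As `∂ₜ(1 + t w') = -1 / t₀` and
`∂ₓ(1 + t w') = 0`, the equilibrium is a saddle.

*The stable manifold.* The blow-up `x = x₀ + (t - t₀) z` turns the equation of the invariant curve into
a Briot–Bouquet equation `τ z' = h(τ, z)` whose linearization has the negative coefficient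
`-(1 + t₀ ∂ₓF)`. Inverting `θ d/dθ + 1 + t₀ ∂ₓF` makes it an integral equation, and the solutions on
`[0, e]`, rescaled to `[0, 1]`, are the zeros of an analytic map on `C([0, 1])` to which the inverse
function theorem applies (`exists_analyticAt_briotBouquet`). The field decays along this curve and
points away from it elsewhere, so that the curve is the whole local stable manifold
(`localStableManifold_eq_graph`).

*The solution.* Along the curve `R` has a simple zero at `t₀`, whence the factor `√(t - t₀)` in the
mass. In Lagrangian coordinates the balance laws reduce to the fact that a test function changes from
its initial value to zero along the path of each particle, which is first free and then follows the
point mass (`IsAbsorbing.weakBalance`). The velocity decreases, hence the mean velocity of the absorbed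
particles lies between the velocities of the outermost two, which is the admissibility condition.
-/

/-! ### Analytic inverses and divided differences -/

namespace PressurelessGas

/-- The analytic inverse function theorem, with the derivative of the inverse. -/
theorem exists_analyticAt_localInverse {E F : Type*} [NormedAddCommGroup E] [NormedSpace ℝ E]
    [CompleteSpace E] [NormedAddCommGroup F] [NormedSpace ℝ F] {f : E → F} {a : E}
    (hf : AnalyticAt ℝ f a) (f' : E ≃L[ℝ] F) (h : HasFDerivAt f (f' : E →L[ℝ] F) a) :
    ∃ g : F → E, AnalyticAt ℝ g (f a) ∧ g (f a) = a ∧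
      HasFDerivAt g (f'.symm : F →L[ℝ] E) (f a) ∧ (∀ᶠ x in 𝓝 a, g (f x) = x) ∧
      ∀ᶠ y in 𝓝 (f a), f (g y) = y := by
  have hs : HasStrictFDerivAt f (f' : E →L[ℝ] F) a := by
    have := hf.hasStrictFDerivAt
    rwa [h.fderiv] at this
  refine ⟨hs.localInverse f f' a, ?_, hs.localInverse_apply_image,
    hs.to_localInverse.hasFDerivAt, hs.eventually_left_inverse,
    hs.eventually_right_inverse⟩
  have := (hs.toOpenPartialHomeomorph f).analyticAt_symm' (i := f')
    hs.mem_toOpenPartialHomeomorph_source hf h.fderiv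
  exact this

/-- A power series applied to an operator acts on an eigenvector through its value at the
eigenvalue. -/
theorem ofScalarsSum_apply_of_eigenvector {V : Type*} [NormedAddCommGroup V] [NormedSpace ℝ V]
    [CompleteSpace V] [Nontrivial V] {f : ℝ → ℝ} {p : FormalMultilinearSeries ℝ ℝ ℝ} {x₀ : ℝ}
    {R : ENNReal} (hp : HasFPowerSeriesOnBall f p x₀ R) (L : V →L[ℝ] V)
    (hL : L ∈ Metric.eball (0 : V →L[ℝ] V)
      (FormalMultilinearSeries.ofScalars (V →L[ℝ] V) p.coeff).radius)
    {v : V} {l : ℝ} (hv : L v = l • v) (hl : l ∈ Metric.eball (0 : ℝ) R) :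
    FormalMultilinearSeries.ofScalarsSum p.coeff L v = f (x₀ + l) • v := by
  have h1 := (FormalMultilinearSeries.ofScalars (V →L[ℝ] V) p.coeff).hasSum hL
  have h2 := (ContinuousLinearMap.apply ℝ V v).hasSum h1
  have h3 := (hp.hasSum hl).smul_const v
  refine h2.unique ?_
  convert! h3 using 1
  funext n
  have hpow : (L ^ n) v = l ^ n • v := by
    induction n with
    | zero => simp
    | succ k ih => rw [pow_succ', mul_apply_eq_comp, ih, map_smul, hv, smul_smul, pow_succ]
  simp [FormalMultilinearSeries.ofScalars_apply_eq, hpow, smul_smul, mul_comm]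

theorem radius_ofScalars_pos {V : Type*} [NormedAddCommGroup V] [NormedSpace ℝ V]
    [CompleteSpace V] [Nontrivial V] {f : ℝ → ℝ} {p : FormalMultilinearSeries ℝ ℝ ℝ} {x₀ : ℝ}
    (hp : HasFPowerSeriesAt f p x₀) :
    0 < (FormalMultilinearSeries.ofScalars (V →L[ℝ] V) p.coeff).radius := by
  refine lt_of_lt_of_le hp.radius_pos (FormalMultilinearSeries.radius_le_of_le fun n ↦ ?_)
  rw [FormalMultilinearSeries.ofScalars_norm, ← FormalMultilinearSeries.norm_apply_eq_norm_coef]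

/-- For `q = (x, s, r)`, a block triangular operator with eigenvalues `x` and `s ± √r`, which depends
analytically on `q` although `√r` does not. Its eigenvector for `ξ = s ± √r` is
`(1, (ξ - x) / k, (ξ - x) (ξ - s) / k ^ 2)`. The scaling parameter `k` makes the operator small at
`q = 0`, so that power series can be applied to it. -/
noncomputable def blockOp (k : ℝ) (q : ℝ × ℝ × ℝ) : (ℝ × ℝ × ℝ) →L[ℝ] ℝ × ℝ × ℝ :=
  let e₀ := ContinuousLinearMap.fst ℝ ℝ (ℝ × ℝ)
  let e₁ := (ContinuousLinearMap.fst ℝ ℝ ℝ).comp (ContinuousLinearMap.snd ℝ ℝ (ℝ × ℝ))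
  let e₂ := (ContinuousLinearMap.snd ℝ ℝ ℝ).comp (ContinuousLinearMap.snd ℝ ℝ (ℝ × ℝ))
  k • e₁.prod (e₂.prod 0) + q.1 • e₀.prod (0 : (ℝ × ℝ × ℝ) →L[ℝ] ℝ × ℝ)
    + q.2.1 • (0 : (ℝ × ℝ × ℝ) →L[ℝ] ℝ).prod (e₁.prod e₂)
    + (q.2.2 / k) • (0 : (ℝ × ℝ × ℝ) →L[ℝ] ℝ).prod ((0 : (ℝ × ℝ × ℝ) →L[ℝ] ℝ).prod e₁)

theorem blockOp_apply (k : ℝ) (q v : ℝ × ℝ × ℝ) :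
    blockOp k q v = (k * v.2.1 + q.1 * v.1, k * v.2.2 + q.2.1 * v.2.1,
      q.2.1 * v.2.2 + q.2.2 / k * v.2.1) := by
  ext <;> simp [blockOp]

theorem analyticAt_blockOp (k : ℝ) (q : ℝ × ℝ × ℝ) : AnalyticAt ℝ (blockOp k) q := by
  unfold blockOp
  have h1 : AnalyticAt ℝ (fun q : ℝ × ℝ × ℝ ↦ q.1) q := analyticAt_fst
  have h2 : AnalyticAt ℝ (fun q : ℝ × ℝ × ℝ ↦ q.2) q := analyticAt_snd
  have h21 : AnalyticAt ℝ (fun q : ℝ × ℝ × ℝ ↦ q.2.1) q := analyticAt_fst.comp h2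
  have h22 : AnalyticAt ℝ (fun q : ℝ × ℝ × ℝ ↦ q.2.2) q := analyticAt_snd.comp h2
  exact ((analyticAt_const.add (h1.smul analyticAt_const)).add (h21.smul analyticAt_const)).add
    ((h22.div_const).smul analyticAt_const)

theorem norm_blockOp_zero_le {k : ℝ} (hk : 0 ≤ k) : ‖blockOp k 0‖ ≤ k := by
  refine ContinuousLinearMap.opNorm_le_bound _ hk fun v ↦ ?_
  have h1 : ‖v.2‖ ≤ ‖v‖ := norm_snd_le v
  have h2 : ‖v.2.1‖ ≤ ‖v‖ := (norm_fst_le v.2).trans h1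
  have h3 : ‖v.2.2‖ ≤ ‖v‖ := (norm_snd_le v.2).trans h1
  rw [blockOp_apply]
  simp only [Prod.fst_zero, Prod.snd_zero, zero_mul, add_zero, zero_div]
  simp only [Prod.norm_def, norm_mul, Real.norm_of_nonneg hk, norm_zero] at *
  have := mul_nonneg hk (norm_nonneg v)
  simp only [Prod.norm_def] at this
  refine max_le ?_ (max_le ?_ this) <;> gcongr

/-- Division of `f ξ - f x` by `ξ - x`, with the quotient split into even and odd part with
respect to `η = ξ - s`, jointly analytic in `x`, `s` and `η ^ 2`. Both parts are matrix entries of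
`f` applied to the operator `blockOp`. -/
theorem exists_even_odd_dividedDifference {f : ℝ → ℝ} {x₀ : ℝ} (hf : AnalyticAt ℝ f x₀) :
    ∃ A B : ℝ × ℝ × ℝ → ℝ, AnalyticAt ℝ A (x₀, x₀, 0) ∧ AnalyticAt ℝ B (x₀, x₀, 0) ∧
      ∀ᶠ q : ℝ × ℝ × ℝ in 𝓝 (x₀, x₀, 0), f (q.2.1 + q.2.2) - f q.1 =
        (q.2.1 + q.2.2 - q.1) *
          (A (q.1, q.2.1, q.2.2 ^ 2) + q.2.2 * B (q.1, q.2.1, q.2.2 ^ 2)) := by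
  obtain ⟨p, R, hp⟩ := hf
  have hrad := radius_ofScalars_pos (V := ℝ × ℝ × ℝ) hp.hasFPowerSeriesAt
  set P := FormalMultilinearSeries.ofScalars ((ℝ × ℝ × ℝ) →L[ℝ] ℝ × ℝ × ℝ) p.coeff with hP
  obtain ⟨k, hk, hkP⟩ : ∃ k : ℝ, 0 < k ∧ ENNReal.ofReal k < P.radius := by
    obtain ⟨k, hk0, hk⟩ := ENNReal.lt_iff_exists_nnreal_btwn.1 hrad
    refine ⟨k, by simpa using hk0, by simpa using hk⟩
  -- the operator, re-centred at `x₀`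
  set M : ℝ × ℝ × ℝ → ((ℝ × ℝ × ℝ) →L[ℝ] ℝ × ℝ × ℝ) := fun q ↦ blockOp k (q - (x₀, x₀, 0)) with hM
  have hMan : ∀ q, AnalyticAt ℝ M q := fun q ↦
    (analyticAt_blockOp k _).comp (analyticAt_id.sub analyticAt_const)
  have hM0 : M (x₀, x₀, 0) ∈ Metric.eball 0 P.radius := by
    simp only [hM, sub_self, Metric.mem_eball, edist_zero_right]
    refine lt_of_le_of_lt ?_ hkP
    rw [← ofReal_norm]
    exact ENNReal.ofReal_le_ofReal (norm_blockOp_zero_le hk.le)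
  have hSan : AnalyticAt ℝ (fun q ↦ FormalMultilinearSeries.ofScalarsSum p.coeff (M q))
      (x₀, x₀, 0) :=
    ((P.hasFPowerSeriesOnBall hrad).analyticAt_of_mem hM0).comp (hMan _)
  have hSv : ∀ v, AnalyticAt ℝ
      (fun q ↦ FormalMultilinearSeries.ofScalarsSum p.coeff (M q) v) (x₀, x₀, 0) := fun v ↦
    ((ContinuousLinearMap.apply ℝ (ℝ × ℝ × ℝ) v).analyticAt _).comp hSan
  refine ⟨fun q ↦ (FormalMultilinearSeries.ofScalarsSum p.coeff (M q) (0, 1, 0)).1 / k,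
    fun q ↦ (FormalMultilinearSeries.ofScalarsSum p.coeff (M q) (0, 0, 1)).1 / k ^ 2,
    (analyticAt_fst.comp (hSv _)).div_const, (analyticAt_fst.comp (hSv _)).div_const, ?_⟩
  have ev1 : ∀ᶠ q : ℝ × ℝ × ℝ in 𝓝 (x₀, x₀, 0),
      M (q.1, q.2.1, q.2.2 ^ 2) ∈ Metric.eball 0 P.radius := by
    have hc : ContinuousAt (fun q : ℝ × ℝ × ℝ ↦ M (q.1, q.2.1, q.2.2 ^ 2)) (x₀, x₀, 0) := by
      refine ContinuousAt.comp (hMan _).continuousAt ?_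
      fun_prop
    refine hc (Metric.isOpen_eball.mem_nhds ?_)
    simpa using hM0
  have ev2 : ∀ᶠ q : ℝ × ℝ × ℝ in 𝓝 (x₀, x₀, 0), q.2.1 + q.2.2 - x₀ ∈ Metric.eball (0 : ℝ) R := by
    have hc : ContinuousAt (fun q : ℝ × ℝ × ℝ ↦ q.2.1 + q.2.2 - x₀) (x₀, x₀, 0) := by fun_prop
    refine hc (Metric.isOpen_eball.mem_nhds ?_)
    simpa using hp.r_pos
  have ev3 : ∀ᶠ q : ℝ × ℝ × ℝ in 𝓝 (x₀, x₀, 0), q.1 - x₀ ∈ Metric.eball (0 : ℝ) R := by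
    have hc : ContinuousAt (fun q : ℝ × ℝ × ℝ ↦ q.1 - x₀) (x₀, x₀, 0) := by fun_prop
    refine hc (Metric.isOpen_eball.mem_nhds ?_)
    simpa using hp.r_pos
  filter_upwards [ev1, ev2, ev3] with q h1 h2 h3
  obtain ⟨x, s, e⟩ := q
  dsimp only at *
  set S := FormalMultilinearSeries.ofScalarsSum p.coeff (M (x, s, e ^ 2)) with hS
  have hv1 := ofScalarsSum_apply_of_eigenvector hp (M (x, s, e ^ 2)) h1
    (v := (1, 0, 0)) (l := x - x₀) (by simp [hM, blockOp_apply]) h3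
  have hv2 := ofScalarsSum_apply_of_eigenvector hp (M (x, s, e ^ 2)) h1
    (v := (1, (s + e - x) / k, (s + e - x) * e / k ^ 2)) (l := s + e - x₀)
    (by
      simp only [hM, blockOp_apply, Prod.smul_mk, smul_eq_mul, Prod.mk.injEq, Prod.fst_sub,
        Prod.snd_sub, sub_zero]
      refine ⟨?_, ?_, ?_⟩ <;> field_simp <;> ring) h2
  rw [← hS] at hv1 hv2
  have hdec : ((1, (s + e - x) / k, (s + e - x) * e / k ^ 2) : ℝ × ℝ × ℝ) =
      (1, 0, 0) + ((s + e - x) / k) • (0, 1, 0) + ((s + e - x) * e / k ^ 2) • (0, 0, 1) := by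
    ext <;> simp
  rw [hdec, map_add, map_add, map_smul, map_smul, hv1, ← hdec] at hv2
  have := congrArg Prod.fst hv2
  simp only [Prod.fst_add, Prod.smul_fst, smul_eq_mul, mul_one, add_sub_cancel] at this
  rw [← this]
  field_simp
  ring

end PressurelessGas

/-! ### Superposition operators and integrals with parameters -/

namespace PressurelessGas

section Superposition

variable {K : Type*} [TopologicalSpace K] [CompactSpace K]
  {E F : Type*} [NormedAddCommGroup E] [NormedSpace ℝ E] [NormedAddCommGroup F] [NormedSpace ℝ F]

/-- A multilinear map applied pointwise to continuous functions. -/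
noncomputable def pointwiseMultilinear {n : ℕ} (p : ContinuousMultilinearMap ℝ (fun _ : Fin n ↦ E) F) :
    ContinuousMultilinearMap ℝ (fun _ : Fin n ↦ C(K, E)) C(K, F) :=
  MultilinearMap.mkContinuous
    { toFun := fun m ↦ ⟨fun k ↦ p fun i ↦ m i k,
        p.cont.comp (continuous_pi fun i ↦ (m i).continuous)⟩
      map_update_add' := fun m i x y ↦ by
        ext k
        have h : ∀ z : C(K, E), (fun j ↦ (Function.update m i z) j k) =
            Function.update (fun j ↦ m j k) i (z k) := fun z ↦ by
          funext j
          by_cases hj : j = i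
          · subst hj; simp
          · simp [hj]
        simp [h]
      map_update_smul' := fun m i c x ↦ by
        ext k
        have h : ∀ z : C(K, E), (fun j ↦ (Function.update m i z) j k) =
            Function.update (fun j ↦ m j k) i (z k) := fun z ↦ by
          funext j
          by_cases hj : j = i
          · subst hj; simp
          · simp [hj]
        simp [h] } ‖p‖ fun m ↦ by
      refine (ContinuousMap.norm_le _ (by positivity)).2 fun k ↦ ?_
      refine (p.le_opNorm _).trans ?_
      gcongr with i
      exact (m i).norm_coe_le_norm k

theorem norm_pointwiseMultilinear_le {n : ℕ}
    (p : ContinuousMultilinearMap ℝ (fun _ : Fin n ↦ E) F) :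
    ‖(pointwiseMultilinear p : ContinuousMultilinearMap ℝ (fun _ : Fin n ↦ C(K, E)) C(K, F))‖
      ≤ ‖p‖ :=
  MultilinearMap.mkContinuous_norm_le _ (norm_nonneg _) _

/-- The superposition operator `ζ ↦ g ∘ ζ` on continuous functions over a compact space is
analytic at the constant function `e₀` if `g` is analytic at `e₀`. -/
theorem exists_analyticAt_superposition [CompleteSpace F] {g : E → F} {e₀ : E}
    (hg : AnalyticAt ℝ g e₀) :
    ∃ N : C(K, E) → C(K, F), AnalyticAt ℝ N (ContinuousMap.const K e₀) ∧
      ∀ᶠ ζ in 𝓝 (ContinuousMap.const K e₀), ∀ k, N ζ k = g (ζ k) := by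
  obtain ⟨p, R, hp⟩ := hg
  set P : FormalMultilinearSeries ℝ C(K, E) C(K, F) := fun n ↦ pointwiseMultilinear (p n) with hP
  have hle : p.radius ≤ P.radius :=
    FormalMultilinearSeries.radius_le_of_le fun n ↦ norm_pointwiseMultilinear_le _
  have hrad : 0 < P.radius := (hp.r_pos.trans_le hp.r_le).trans_le hle
  have hPb := P.hasFPowerSeriesOnBall hrad
  refine ⟨fun ζ ↦ P.sum (ζ - ContinuousMap.const K e₀), ?_, ?_⟩
  · have h0 : AnalyticAt ℝ P.sum (ContinuousMap.const K e₀ - ContinuousMap.const K e₀) := by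
      rw [sub_self]
      exact hPb.analyticAt
    exact AnalyticAt.comp (g := P.sum) (f := fun ζ ↦ ζ - ContinuousMap.const K e₀) h0
      (analyticAt_id.sub analyticAt_const)
  · filter_upwards [Metric.eball_mem_nhds (ContinuousMap.const K e₀) hp.r_pos] with ζ hζ k
    have hζ' : ζ - ContinuousMap.const K e₀ ∈ Metric.eball (0 : C(K, E)) R := by
      simpa [Metric.mem_eball, edist_eq_enorm_sub] using hζ
    have h1 := P.hasSum (Metric.eball_subset_eball (hp.r_le.trans hle) hζ')
    have h2 := (ContinuousMap.evalCLM ℝ k).hasSum h1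
    have hk : ζ k - e₀ ∈ Metric.eball (0 : E) R := by
      rw [Metric.mem_eball, edist_zero_right] at hζ' ⊢
      refine lt_of_le_of_lt ?_ hζ'
      rw [← ofReal_norm, ← ofReal_norm]
      exact ENNReal.ofReal_le_ofReal ((ζ - ContinuousMap.const K e₀).norm_coe_le_norm k)
    have h3 := hp.hasSum hk
    rw [add_sub_cancel] at h3
    exact h2.unique h3

/-- The integral is a continuous linear functional of the superposition of `g` with the path
`θ ↦ θ • v`, hence analytic in `v`. -/
theorem analyticAt_integral_comp_smul [CompleteSpace F] {g : E → F} (hg : AnalyticAt ℝ g 0) :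
    AnalyticAt ℝ (fun v ↦ ∫ θ in (0:ℝ)..1, g (θ • v)) 0 := by
  obtain ⟨N, hN, hNg⟩ := exists_analyticAt_superposition (K := Icc (0:ℝ) 1) hg
  let D : E →L[ℝ] C(Icc (0:ℝ) 1, E) := LinearMap.mkContinuous
    { toFun := fun v ↦ ⟨fun θ ↦ (θ : ℝ) • v, by fun_prop⟩
      map_add' := fun u v ↦ by ext; simp
      map_smul' := fun c v ↦ by
        ext θ
        exact smul_comm (θ : ℝ) c v } 1 fun v ↦ by
        refine (ContinuousMap.norm_le _ (by positivity)).2 fun θ ↦ ?_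
        simp only [LinearMap.coe_mk, AddHom.coe_mk, ContinuousMap.coe_mk, norm_smul]
        gcongr
        rw [Real.norm_of_nonneg θ.2.1]
        exact θ.2.2
  have hD : ∀ v θ, D v θ = (θ : ℝ) • v := fun _ _ ↦ rfl
  let J : C(Icc (0:ℝ) 1, F) →L[ℝ] F := LinearMap.mkContinuous
    { toFun := fun f ↦ ∫ θ in (0:ℝ)..1, IccExtend zero_le_one f θ
      map_add' := fun f h ↦ by
        rw [← intervalIntegral.integral_add (f.continuous.Icc_extend'.intervalIntegrable _ _)
          (h.continuous.Icc_extend'.intervalIntegrable _ _)]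
        rfl
      map_smul' := fun c f ↦ by
        rw [RingHom.id_apply, ← intervalIntegral.integral_smul]
        rfl } 1 fun f ↦ by
        have := intervalIntegral.norm_integral_le_of_norm_le_const (a := (0:ℝ)) (b := 1)
          (f := IccExtend zero_le_one f) (C := ‖f‖) fun θ _ ↦ f.norm_coe_le_norm _
        simpa using this
  have hJ : ∀ f, J f = ∫ θ in (0:ℝ)..1, IccExtend zero_le_one f θ := fun _ ↦ rfl
  have hD0 : D 0 = ContinuousMap.const _ 0 := by ext θ; simp
  have han : AnalyticAt ℝ (fun v ↦ J (N (D v))) 0 := by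
    refine (J.analyticAt _).comp ?_
    refine AnalyticAt.comp (g := N) (f := D) ?_ (D.analyticAt _)
    rw [hD0]; exact hN
  refine han.congr ?_
  have hc : ContinuousAt D 0 := D.continuous.continuousAt
  have : ∀ᶠ v in 𝓝 (0 : E), ∀ k, N (D v) k = g (D v k) := hc.eventually (by rw [hD0]; exact hNg)
  filter_upwards [this] with v hv
  rw [hJ]
  refine intervalIntegral.integral_congr fun θ hθ ↦ ?_
  rw [uIcc_of_le zero_le_one] at hθ
  rw [IccExtend_of_mem _ _ hθ, hv, hD]

/-- Hadamard's lemma for analytic functions. -/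
theorem exists_analyticAt_eq_clm_apply [CompleteSpace F] {g : E → F} (hg : AnalyticAt ℝ g 0)
    (hg0 : g 0 = 0) :
    ∃ ℓ : E → E →L[ℝ] F, AnalyticAt ℝ ℓ 0 ∧ ℓ 0 = fderiv ℝ g 0 ∧ ∀ᶠ v in 𝓝 0, g v = ℓ v v := by
  refine ⟨_, analyticAt_integral_comp_smul hg.fderiv, by simp, ?_⟩
  obtain ⟨ε, hε, hball⟩ := Metric.eventually_nhds_iff_ball.1 hg.eventually_analyticAt
  filter_upwards [Metric.ball_mem_nhds 0 hε] with v hv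
  have hmem : ∀ θ ∈ Icc (0:ℝ) 1, θ • v ∈ Metric.ball (0 : E) ε := fun θ hθ ↦ by
    rw [mem_ball_zero_iff] at hv ⊢
    rw [norm_smul, Real.norm_of_nonneg hθ.1]
    exact lt_of_le_of_lt (mul_le_of_le_one_left (norm_nonneg _) hθ.2) hv
  have hcont : ContinuousOn (fun θ : ℝ ↦ fderiv ℝ g (θ • v)) (uIcc 0 1) := by
    rw [uIcc_of_le zero_le_one]
    intro θ hθ
    refine ContinuousAt.continuousWithinAt ?_
    exact ContinuousAt.comp (g := fderiv ℝ g) (hball _ (hmem θ hθ)).fderiv.continuousAt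
      (by fun_prop)
  have hint := hcont.intervalIntegrable (μ := volume)
  rw [ContinuousLinearMap.intervalIntegral_apply hint]
  have hder : ∀ θ ∈ uIcc (0:ℝ) 1,
      HasDerivAt (fun θ : ℝ ↦ g (θ • v)) (fderiv ℝ g (θ • v) v) θ := fun θ hθ ↦ by
    rw [uIcc_of_le zero_le_one] at hθ
    have h1 := (hball _ (hmem θ hθ)).differentiableAt.hasFDerivAt
    have h2 : HasDerivAt (fun θ : ℝ ↦ θ • v) v θ := by
      simpa using (hasDerivAt_id θ).smul_const v
    exact h1.comp_hasDerivAt θ h2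
  have := intervalIntegral.integral_eq_sub_of_hasDerivAt hder
    ((hcont.clm_apply continuousOn_const).intervalIntegrable)
  rw [this]
  simp [hg0]

/-- Antiderivatives of analytic functions are analytic. -/
theorem analyticAt_integral {q : ℝ → ℝ} {x₀ : ℝ} (hq : AnalyticAt ℝ q x₀) :
    AnalyticAt ℝ (fun x ↦ ∫ ξ in x₀..x, q ξ) x₀ := by
  have h1 : AnalyticAt ℝ (fun u ↦ q (x₀ + u)) 0 := by
    refine AnalyticAt.comp (g := q) (f := fun u ↦ x₀ + u) ?_ (analyticAt_const.add analyticAt_id)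
    simpa using hq
  have h2 := analyticAt_integral_comp_smul h1
  have h3 : AnalyticAt ℝ (fun x ↦ (x - x₀) * ∫ θ in (0:ℝ)..1, q (x₀ + θ • (x - x₀))) x₀ := by
    refine (analyticAt_id.sub analyticAt_const).mul ?_
    refine AnalyticAt.comp (g := fun v ↦ ∫ θ in (0:ℝ)..1, q (x₀ + θ • v)) (f := fun x ↦ x - x₀) ?_
      (analyticAt_id.sub analyticAt_const)
    simpa using h2
  convert! h3 using 2 with x
  have := intervalIntegral.smul_integral_comp_mul_add (a := 0) (b := 1) q (x - x₀) x₀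
  simp only [mul_zero, zero_add, mul_one, sub_add_cancel, smul_eq_mul] at this
  rw [← this]
  congr 2 with θ
  congr 1
  simp only [smul_eq_mul]
  ring

end Superposition

end PressurelessGas

/-! ### The velocity near its steepest point -/

namespace PressurelessGas

theorem exists_eq_cubic {w : ℝ → ℝ} {x₀ : ℝ} (hw : AnalyticAt ℝ w x₀)
    (hw2 : iteratedDeriv 2 w x₀ = 0) :
    ∃ g : ℝ → ℝ, AnalyticAt ℝ g x₀ ∧ g x₀ = iteratedDeriv 3 w x₀ / 6 ∧
      ∀ x, w x = w x₀ + deriv w x₀ * (x - x₀) + (x - x₀) ^ 3 * g x := by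
  have hp := hw.hasFPowerSeriesAt
  set p := FormalMultilinearSeries.ofScalars ℝ (fun n ↦ iteratedDeriv n w x₀ / (n.factorial : ℝ))
    with hpdef
  have key : ∀ n, ((Function.swap dslope x₀)^[n] w) x₀ = iteratedDeriv n w x₀ / n.factorial := by
    intro n
    have := (hp.has_fpower_series_iterate_dslope_fslope n).coeff_zero 1
    rw [← FormalMultilinearSeries.coeff, FormalMultilinearSeries.coeff_iterate_fslope, zero_add,
      hpdef, FormalMultilinearSeries.coeff_ofScalars] at this
    exact this.symm
  have step : ∀ n x, ((Function.swap dslope x₀)^[n] w) x =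
      iteratedDeriv n w x₀ / n.factorial + (x - x₀) * ((Function.swap dslope x₀)^[n + 1] w) x := by
    intro n x
    have := sub_smul_dslope ((Function.swap dslope x₀)^[n] w) x₀ x
    rw [key n, smul_eq_mul] at this
    rw [Function.iterate_succ_apply']
    simp only [Function.swap] at this ⊢
    linarith
  refine ⟨(Function.swap dslope x₀)^[3] w,
    (hp.has_fpower_series_iterate_dslope_fslope 3).analyticAt, ?_, fun x ↦ ?_⟩
  · rw [key 3]; norm_num [Nat.factorial]
  · have h0 := step 0 x
    have h1 := step 1 x
    have h2 := step 2 x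
    simp only [Function.iterate_zero, id_eq, iteratedDeriv_zero, Nat.factorial_zero, Nat.cast_one,
      div_one, zero_add, iteratedDeriv_one, Nat.factorial_one] at h0 h1
    rw [hw2, zero_div, zero_add] at h2
    rw [h0, h1, h2]
    ring

theorem exists_deriv_eq_quadratic {w g : ℝ → ℝ} {x₀ a : ℝ} (hg : AnalyticAt ℝ g x₀)
    (hwg : ∀ x, w x = w x₀ + a * (x - x₀) + (x - x₀) ^ 3 * g x) :
    ∃ k : ℝ → ℝ, AnalyticAt ℝ k x₀ ∧ k x₀ = 3 * g x₀ ∧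
      ∀ᶠ x in 𝓝 x₀, deriv w x = a + (x - x₀) ^ 2 * k x := by
  refine ⟨fun x ↦ 3 * g x + (x - x₀) * deriv g x, ?_, by simp, ?_⟩
  · exact (analyticAt_const.mul hg).add ((analyticAt_id.sub analyticAt_const).mul hg.deriv)
  · filter_upwards [hg.eventually_analyticAt] with x hx
    have h1 : HasDerivAt (fun x ↦ w x₀ + a * (x - x₀) + (x - x₀) ^ 3 * g x)
        (a * 1 + (3 * (x - x₀) ^ 2 * 1 * g x + (x - x₀) ^ 3 * deriv g x)) x := by
      have hs : HasDerivAt (fun x ↦ x - x₀) 1 x := (hasDerivAt_id x).sub_const _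
      have := ((hs.const_mul a).const_add (w x₀)).add
        ((hs.pow 3).mul hx.differentiableAt.hasDerivAt)
      exact this
    have h2 : w = fun x ↦ w x₀ + a * (x - x₀) + (x - x₀) ^ 3 * g x := funext hwg
    rw [h2, h1.deriv]
    ring

theorem exists_deriv_strictAnti_strictMono {w k : ℝ → ℝ} {x₀ a : ℝ} (hk : AnalyticAt ℝ k x₀)
    (hk0 : 0 < k x₀) (hwk : ∀ᶠ x in 𝓝 x₀, deriv w x = a + (x - x₀) ^ 2 * k x) :
    ∃ h > 0, StrictAntiOn (deriv w) (Icc (x₀ - h) x₀) ∧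
      StrictMonoOn (deriv w) (Icc x₀ (x₀ + h)) := by
  have hd : ∀ᶠ x in 𝓝 x₀, HasDerivAt (deriv w) ((x - x₀) * (2 * k x + (x - x₀) * deriv k x)) x := by
    filter_upwards [hk.eventually_analyticAt, hwk.eventually_nhds] with x hx hwx
    have hs : HasDerivAt (fun x ↦ x - x₀) 1 x := (hasDerivAt_id x).sub_const _
    have := ((hs.pow 2).mul hx.differentiableAt.hasDerivAt).const_add a
    refine HasDerivAt.congr_of_eventuallyEq ?_ hwx
    convert! this using 1
    simp
    ring
  have hpos : ∀ᶠ x in 𝓝 x₀, 0 < 2 * k x + (x - x₀) * deriv k x := by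
    have hc : ContinuousAt (fun x ↦ 2 * k x + (x - x₀) * deriv k x) x₀ :=
      (continuousAt_const.mul hk.continuousAt).add
        ((continuousAt_id.sub continuousAt_const).mul hk.deriv.continuousAt)
    refine hc.eventually_mem (Ioi_mem_nhds ?_)
    simpa using hk0
  obtain ⟨ε, hε, hball⟩ := Metric.eventually_nhds_iff_ball.1 (hd.and hpos)
  have hmem : ∀ x ∈ Icc (x₀ - ε / 2) (x₀ + ε / 2), x ∈ Metric.ball x₀ ε := fun x hx ↦ by
    rw [Real.ball_eq_Ioo]
    constructor <;> linarith [hx.1, hx.2]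
  refine ⟨ε / 2, by positivity, ?_, ?_⟩
  · refine strictAntiOn_of_deriv_neg (convex_Icc _ _) (fun x hx ↦ ?_) fun x hx ↦ ?_
    · exact (hball x (hmem x ⟨hx.1, by linarith [hx.2]⟩)).1.continuousAt.continuousWithinAt
    · rw [interior_Icc] at hx
      have := hball x (hmem x ⟨hx.1.le, by linarith [hx.2]⟩)
      rw [this.1.deriv]
      exact mul_neg_of_neg_of_pos (by linarith [hx.2]) this.2
  · refine strictMonoOn_of_deriv_pos (convex_Icc _ _) (fun x hx ↦ ?_) fun x hx ↦ ?_
    · exact (hball x (hmem x ⟨by linarith [hx.1], hx.2⟩)).1.continuousAt.continuousWithinAt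
    · rw [interior_Icc] at hx
      have := hball x (hmem x ⟨by linarith [hx.1], hx.2.le⟩)
      rw [this.1.deriv]
      exact mul_pos (by linarith [hx.1]) this.2

theorem exists_root_right_of_deriv_neg {f : ℝ → ℝ} {x b d : ℝ} (hxb : x < b)
    (hf : ContinuousOn f (Icc x b)) (hd : HasDerivAt f d x) (hd0 : d < 0) (hx : f x = 0)
    (hb : 0 < f b) : ∃ y ∈ Ioo x b, f y = 0 := by
  have h1 : ∀ᶠ y in 𝓝[>] x, slope f x y < 0 :=
    ((hasDerivAt_iff_tendsto_slope.1 hd).mono_left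
      (nhdsWithin_mono x fun y (hy : x < y) ↦ hy.ne')).eventually (Iio_mem_nhds hd0)
  obtain ⟨z, hz, hzI⟩ := (h1.and (Ioo_mem_nhdsGT hxb)).exists
  have hfz : f z < 0 := by
    rw [slope_def_field, hx, sub_zero] at hz
    by_contra hcon
    exact absurd hz (not_lt.2 (div_nonneg (not_lt.1 hcon) (by linarith [hzI.1])))
  obtain ⟨y, hy, hy0⟩ := intermediate_value_Ioo hzI.2.le
    (hf.mono (Icc_subset_Icc_left hzI.1.le)) (show (0:ℝ) ∈ Ioo (f z) (f b) from ⟨hfz, hb⟩)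
  exact ⟨y, ⟨hzI.1.trans hy.1, hy.2⟩, hy0⟩

theorem exists_root_left_of_deriv_neg {f : ℝ → ℝ} {x b d : ℝ} (hxb : b < x)
    (hf : ContinuousOn f (Icc b x)) (hd : HasDerivAt f d x) (hd0 : d < 0) (hx : f x = 0)
    (hb : f b < 0) : ∃ y ∈ Ioo b x, f y = 0 := by
  have hd' : HasDerivAt (fun z ↦ -f (-z)) d (-x) := by
    have h1 : HasDerivAt f d (-(-x)) := by rwa [neg_neg]
    have := (HasDerivAt.comp (-x) h1 (hasDerivAt_neg (-x))).neg
    rw [mul_neg_one, neg_neg] at this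
    exact this
  obtain ⟨y, hy, hy0⟩ := exists_root_right_of_deriv_neg (f := fun z ↦ -f (-z)) (x := -x) (b := -b)
    (by linarith) (by
      refine (hf.comp continuousOn_neg fun z hz ↦ ?_).neg
      exact ⟨by linarith [hz.2], by linarith [hz.1]⟩) hd' hd0 (by simpa using hx) (by simpa using hb)
  exact ⟨-y, ⟨by linarith [hy.2], by linarith [hy.1]⟩, by simpa using hy0⟩

end PressurelessGas

/-! ### The characteristics that meet a given one -/

namespace PressurelessGas

/-- The divided difference of `(ξ - x₀) ^ 3 * g ξ`, in even and odd part, with its first order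
expansion at the triple root. -/
theorem exists_even_odd_cubic {g : ℝ → ℝ} {x₀ : ℝ} (hg : AnalyticAt ℝ g x₀) :
    ∃ A B : ℝ × ℝ × ℝ → ℝ, ∃ α : ℝ, AnalyticAt ℝ A (x₀, x₀, 0) ∧ AnalyticAt ℝ B (x₀, x₀, 0) ∧
      A (x₀, x₀, 0) = 0 ∧ B (x₀, x₀, 0) = 0 ∧
      (∀ v, fderiv ℝ A (x₀, x₀, 0) v = g x₀ * v.2.2) ∧
      (∀ v, fderiv ℝ B (x₀, x₀, 0) v = g x₀ * (2 * v.2.1 + v.1) + α * v.2.2) ∧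
      ∀ᶠ q : ℝ × ℝ × ℝ in 𝓝 (x₀, x₀, 0),
        (q.2.1 + q.2.2 - x₀) ^ 3 * g (q.2.1 + q.2.2) - (q.1 - x₀) ^ 3 * g q.1 =
        (q.2.1 + q.2.2 - q.1) *
          (A (q.1, q.2.1, q.2.2 ^ 2) + q.2.2 * B (q.1, q.2.1, q.2.2 ^ 2)) := by
  obtain ⟨A, B, hA, hB, hAB⟩ := exists_even_odd_dividedDifference hg
  set q₀ : ℝ × ℝ × ℝ := (x₀, x₀, 0) with hq₀
  -- multiplication of the function by `ξ - x₀` acts as `(A, B) ↦ (σ A + r B + f x, A + σ B)`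
  let X : ℝ × ℝ × ℝ → ℝ := fun q ↦ q.1 - x₀
  let Y : ℝ × ℝ × ℝ → ℝ := fun q ↦ q.2.1 - x₀
  let Z : ℝ × ℝ × ℝ → ℝ := fun q ↦ q.2.2
  let G : ℝ × ℝ × ℝ → ℝ := fun q ↦ g q.1
  have hX : AnalyticAt ℝ X q₀ := analyticAt_fst.sub analyticAt_const
  have hY : AnalyticAt ℝ Y q₀ := (analyticAt_fst.comp analyticAt_snd).sub analyticAt_const
  have hZ : AnalyticAt ℝ Z q₀ := analyticAt_snd.comp analyticAt_snd
  have hG : AnalyticAt ℝ G q₀ := AnalyticAt.comp (g := g) (f := Prod.fst) hg analyticAt_fst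
  let A₁ := Y * A + Z * B + G
  let B₁ := A + Y * B
  let A₂ := Y * A₁ + Z * B₁ + X * G
  let B₂ := A₁ + Y * B₁
  let A₃ := Y * A₂ + Z * B₂ + X * (X * G)
  let B₃ := A₂ + Y * B₂
  have hA₁ : AnalyticAt ℝ A₁ q₀ := ((hY.mul hA).add (hZ.mul hB)).add hG
  have hB₁ : AnalyticAt ℝ B₁ q₀ := hA.add (hY.mul hB)
  have hA₂ : AnalyticAt ℝ A₂ q₀ := ((hY.mul hA₁).add (hZ.mul hB₁)).add (hX.mul hG)
  have hB₂ : AnalyticAt ℝ B₂ q₀ := hA₁.add (hY.mul hB₁)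
  have hA₃ : AnalyticAt ℝ A₃ q₀ := ((hY.mul hA₂).add (hZ.mul hB₂)).add (hX.mul (hX.mul hG))
  have hB₃ : AnalyticAt ℝ B₃ q₀ := hA₂.add (hY.mul hB₂)
  have X0 : X q₀ = 0 := sub_self _
  have Y0 : Y q₀ = 0 := sub_self _
  have Z0 : Z q₀ = 0 := rfl
  have G0 : G q₀ = g x₀ := rfl
  have A10 : A₁ q₀ = g x₀ := by simp [A₁, Y0, Z0, G0]
  have A20 : A₂ q₀ = 0 := by simp [A₂, Y0, Z0, X0]
  have A30 : A₃ q₀ = 0 := by simp [A₃, Y0, Z0, X0]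
  have B20 : B₂ q₀ = g x₀ := by simp [B₂, Y0, A10]
  have B30 : B₃ q₀ = 0 := by simp [B₃, Y0, A20]
  have dX : HasFDerivAt X (ContinuousLinearMap.fst ℝ ℝ (ℝ × ℝ)) q₀ := hasFDerivAt_fst.sub_const _
  have dY : HasFDerivAt Y ((ContinuousLinearMap.fst ℝ ℝ ℝ).comp
    (ContinuousLinearMap.snd ℝ ℝ (ℝ × ℝ))) q₀ := (hasFDerivAt_fst.comp _ hasFDerivAt_snd).sub_const _
  have dZ : HasFDerivAt Z ((ContinuousLinearMap.snd ℝ ℝ ℝ).comp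
    (ContinuousLinearMap.snd ℝ ℝ (ℝ × ℝ))) q₀ := hasFDerivAt_snd.comp _ hasFDerivAt_snd
  have dG := hG.differentiableAt.hasFDerivAt
  have dA₁ := hA₁.differentiableAt.hasFDerivAt
  have dB₁ := hB₁.differentiableAt.hasFDerivAt
  have dA₂ := ((dY.mul dA₁).add (dZ.mul dB₁)).add (dX.mul dG)
  have dB₂ := hB₂.differentiableAt.hasFDerivAt
  have dA₃ := ((dY.mul hA₂.differentiableAt.hasFDerivAt).add (dZ.mul dB₂)).add
    (dX.mul (hX.mul hG).differentiableAt.hasFDerivAt)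
  have dB₃ := dA₂.add (dY.mul dB₂)
  refine ⟨A₃, B₃, B₁ q₀, hA₃, hB₃, A30, B30, fun v ↦ ?_, fun v ↦ ?_, ?_⟩
  · rw [show fderiv ℝ A₃ q₀ = _ from dA₃.fderiv]
    simp [X0, Y0, Z0, A20, B20]
  · rw [show fderiv ℝ B₃ q₀ = _ from dB₃.fderiv]
    simp [X0, Y0, Z0, G0, A10, B20]
    ring
  · filter_upwards [hAB] with q hq
    obtain ⟨x, s, e⟩ := q
    simp only [A₃, B₃, A₂, B₂, A₁, B₁, X, Y, Z, G, Pi.add_apply, Pi.mul_apply] at hq ⊢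
    linear_combination (s + e - x₀) ^ 3 * hq

variable {w g : ℝ → ℝ} {x₀ t₀ : ℝ}

/-- The positions `S ± √R` of the other two characteristics that meet the characteristic from `x`
at time `t`: their half sum `S` and the square `R` of their half difference are analytic functions
of `(t, x)`, also where the two characteristics coalesce and become complex. -/
theorem exists_analyticAt_root_pair (hg : AnalyticAt ℝ g x₀) (hg0 : 0 < g x₀) (ht₀ : 0 < t₀)
    (hwg : ∀ x, w x = w x₀ + -1 / t₀ * (x - x₀) + (x - x₀) ^ 3 * g x) :
    ∃ S R : ℝ × ℝ → ℝ, AnalyticAt ℝ S (t₀, x₀) ∧ AnalyticAt ℝ R (t₀, x₀) ∧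
      S (t₀, x₀) = x₀ ∧ R (t₀, x₀) = 0 ∧ fderiv ℝ S (t₀, x₀) (0, 1) = -1 / 2 ∧
      fderiv ℝ R (t₀, x₀) (0, 1) = 0 ∧ 0 < fderiv ℝ R (t₀, x₀) (1, 0) ∧
      ∀ᶠ q : (ℝ × ℝ) × ℝ × ℝ in 𝓝 ((t₀, x₀), x₀, 0), q.2.2 ≠ 0 →
        q.2.1 + q.2.2 ≠ q.1.2 → q.2.1 - q.2.2 ≠ q.1.2 →
        q.2.1 + q.2.2 + q.1.1 * w (q.2.1 + q.2.2) = q.1.2 + q.1.1 * w q.1.2 →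
        q.2.1 - q.2.2 + q.1.1 * w (q.2.1 - q.2.2) = q.1.2 + q.1.1 * w q.1.2 →
        S q.1 = q.2.1 ∧ R q.1 = q.2.2 ^ 2 := by
  obtain ⟨A, B, α, hA, hB, hA0, hB0, dA, dB, hAB⟩ := exists_even_odd_cubic hg
  set c := g x₀ with hc
  have ht0 := ht₀.ne'
  have hc0 := hg0.ne'
  -- `1 + t w[x, s ± η] = 0` amounts to `t = -1 / (-1 / t₀ + A)` and `B = 0`
  let Θ : ℝ × ℝ × ℝ → ℝ × ℝ × ℝ := fun q ↦ (-(-1 / t₀ + A q)⁻¹, q.1, B q)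
  have hne : -1 / t₀ + A (x₀, x₀, 0) ≠ 0 := by
    rw [hA0, add_zero]
    exact div_ne_zero (by norm_num) ht0
  have hΘ : AnalyticAt ℝ Θ (x₀, x₀, 0) :=
    ((analyticAt_const.add hA).inv hne).neg.prod (analyticAt_fst.prod hB)
  have hΘ0 : Θ (x₀, x₀, 0) = (t₀, x₀, 0) := by
    simp only [Θ, hA0, hB0, add_zero, Prod.mk.injEq, and_true]
    field_simp
  let L : (ℝ × ℝ × ℝ) ≃ₗ[ℝ] ℝ × ℝ × ℝ :=
    { toFun := fun v ↦ (t₀ ^ 2 * c * v.2.2, v.1, c * (2 * v.2.1 + v.1) + α * v.2.2)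
      map_add' := fun u v ↦ by ext <;> simp <;> ring
      map_smul' := fun a v ↦ by ext <;> simp <;> ring
      invFun := fun v ↦ (v.2.1, (v.2.2 - c * v.2.1 - α * (v.1 / (t₀ ^ 2 * c))) / (2 * c),
        v.1 / (t₀ ^ 2 * c))
      left_inv := fun v ↦ by ext <;> simp <;> field_simp <;> ring
      right_inv := fun v ↦ by ext <;> simp <;> field_simp <;> ring }
  have dΘ : HasFDerivAt Θ (L.toContinuousLinearEquiv : (ℝ × ℝ × ℝ) →L[ℝ] ℝ × ℝ × ℝ)
      (x₀, x₀, 0) := by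
    have h0 := hA.differentiableAt.hasFDerivAt.const_add (-1 / t₀)
    have h1 := (HasDerivAt.comp_hasFDerivAt (f := fun q ↦ -1 / t₀ + A q) (x₀, x₀, 0)
      (hasDerivAt_inv hne) h0).neg
    have h2 := h1.prodMk (hasFDerivAt_fst.prodMk hB.differentiableAt.hasFDerivAt)
    refine HasFDerivAt.congr_fderiv (f' := _) h2 ?_
    refine ContinuousLinearMap.ext fun v ↦ ?_
    change _ = (t₀ ^ 2 * c * v.2.2, v.1, c * (2 * v.2.1 + v.1) + α * v.2.2)
    ext
    · simp [dA, hA0]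
      field_simp
    · simp
    · simp [dB]
  obtain ⟨H, hH, hH0, dH, hHl, hHr⟩ := exists_analyticAt_localInverse hΘ _ dΘ
  rw [hΘ0] at hH hH0 dH hHr
  let ι : ℝ × ℝ → ℝ × ℝ × ℝ := fun p ↦ (p.1, p.2, 0)
  have hι : AnalyticAt ℝ ι (t₀, x₀) := analyticAt_fst.prod (analyticAt_snd.prod analyticAt_const)
  have hHι : AnalyticAt ℝ (fun p ↦ H (ι p)) (t₀, x₀) := AnalyticAt.comp (g := H) (f := ι) hH hι
  have dι : HasFDerivAt ι ((ContinuousLinearMap.fst ℝ ℝ ℝ).prod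
      ((ContinuousLinearMap.snd ℝ ℝ ℝ).prod (0 : (ℝ × ℝ) →L[ℝ] ℝ))) (t₀, x₀) :=
    hasFDerivAt_fst.prodMk (hasFDerivAt_snd.prodMk (hasFDerivAt_const _ _))
  have dHι := HasFDerivAt.comp (g := H) (f := ι) (t₀, x₀) dH dι
  have dS := hasFDerivAt_fst.comp (t₀, x₀) (hasFDerivAt_snd.comp (t₀, x₀) dHι)
  have dR := hasFDerivAt_snd.comp (t₀, x₀) (hasFDerivAt_snd.comp (t₀, x₀) dHι)
  have hLs : ∀ v, L.toContinuousLinearEquiv.symm v =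
    (v.2.1, (v.2.2 - c * v.2.1 - α * (v.1 / (t₀ ^ 2 * c))) / (2 * c), v.1 / (t₀ ^ 2 * c)) :=
    fun _ ↦ rfl
  refine ⟨fun p ↦ (H (ι p)).2.1, fun p ↦ (H (ι p)).2.2,
    analyticAt_fst.comp (analyticAt_snd.comp hHι), analyticAt_snd.comp (analyticAt_snd.comp hHι),
    by simp [ι, hH0], by simp [ι, hH0], ?_, ?_, ?_, ?_⟩
  · erw [dS.fderiv]
    simp [hLs]
    field_simp
  · erw [dR.fderiv]
    simp [hLs]
  · erw [dR.fderiv]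
    simp [hLs]
    positivity
  · have e1 : ∀ᶠ q : (ℝ × ℝ) × ℝ × ℝ in 𝓝 ((t₀, x₀), x₀, 0),
        H (Θ (q.1.2, q.2.1, q.2.2 ^ 2)) = (q.1.2, q.2.1, q.2.2 ^ 2) := by
      have : ContinuousAt (fun q : (ℝ × ℝ) × ℝ × ℝ ↦ (q.1.2, q.2.1, q.2.2 ^ 2))
        ((t₀, x₀), x₀, 0) := by fun_prop
      refine this.eventually (p := fun z ↦ H (Θ z) = z) ?_
      simpa using hHl
    have e2 : ∀ᶠ q : (ℝ × ℝ) × ℝ × ℝ in 𝓝 ((t₀, x₀), x₀, 0),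
        (q.2.1 + q.2.2 - x₀) ^ 3 * g (q.2.1 + q.2.2) - (q.1.2 - x₀) ^ 3 * g q.1.2 =
        (q.2.1 + q.2.2 - q.1.2) *
          (A (q.1.2, q.2.1, q.2.2 ^ 2) + q.2.2 * B (q.1.2, q.2.1, q.2.2 ^ 2)) := by
      have : ContinuousAt (fun q : (ℝ × ℝ) × ℝ × ℝ ↦ (q.1.2, q.2.1, q.2.2))
        ((t₀, x₀), x₀, 0) := by fun_prop
      exact this.eventually hAB
    have e3 : ∀ᶠ q : (ℝ × ℝ) × ℝ × ℝ in 𝓝 ((t₀, x₀), x₀, 0),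
        (q.2.1 - q.2.2 - x₀) ^ 3 * g (q.2.1 - q.2.2) - (q.1.2 - x₀) ^ 3 * g q.1.2 =
        (q.2.1 - q.2.2 - q.1.2) *
          (A (q.1.2, q.2.1, q.2.2 ^ 2) - q.2.2 * B (q.1.2, q.2.1, q.2.2 ^ 2)) := by
      have : ContinuousAt (fun q : (ℝ × ℝ) × ℝ × ℝ ↦ (q.1.2, q.2.1, -q.2.2))
        ((t₀, x₀), x₀, 0) := by fun_prop
      have := this.eventually (p := fun q : ℝ × ℝ × ℝ ↦
        (q.2.1 + q.2.2 - x₀) ^ 3 * g (q.2.1 + q.2.2) - (q.1 - x₀) ^ 3 * g q.1 =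
        (q.2.1 + q.2.2 - q.1) *
          (A (q.1, q.2.1, q.2.2 ^ 2) + q.2.2 * B (q.1, q.2.1, q.2.2 ^ 2))) (by simpa using hAB)
      filter_upwards [this] with q hq
      simpa [sub_eq_add_neg] using hq
    filter_upwards [e1, e2, e3] with q h1 h2 h3 hη hne1 hne2 hr1 hr2
    obtain ⟨⟨t, x⟩, s, η⟩ := q
    simp only at *
    set a := A (x, s, η ^ 2) with ha
    set b := B (x, s, η ^ 2) with hb
    have k1 : 1 + t * (-1 / t₀ + a + η * b) = 0 := by
      apply mul_left_cancel₀ (sub_ne_zero.2 hne1)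
      rw [hwg (s + η), hwg x] at hr1
      linear_combination hr1 - t * h2
    have k2 : 1 + t * (-1 / t₀ + a - η * b) = 0 := by
      apply mul_left_cancel₀ (sub_ne_zero.2 hne2)
      rw [hwg (s - η), hwg x] at hr2
      linear_combination hr2 - t * h3
    have ht : t ≠ 0 := by
      rintro rfl
      simp at k1
    have hb0 : b = 0 := by
      have : (2 * t * η) * b = 0 := by linear_combination k1 - k2
      exact (mul_eq_zero.1 this).resolve_left (by positivity)
    have ht' : t * (-1 / t₀ + a) = -1 := by linear_combination (k1 + k2) / 2
    have ht2 : -(-1 / t₀ + a)⁻¹ = t := by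
      rw [inv_eq_of_mul_eq_one_left (a := -t) (by linear_combination -ht'), neg_neg]
    have hΘq : Θ (x, s, η ^ 2) = (t, x, 0) := by
      simp only [Θ, ← ha, ← hb, hb0, ht2]
    rw [hΘq] at h1
    simp [ι, h1]

end PressurelessGas

namespace PressurelessGas

variable {w g : ℝ → ℝ} {x₀ t₀ : ℝ}

/-- Wherever characteristics have crossed, `S ± √R` are the outer two characteristics: these exist by
the intermediate value theorem, and then `hSR` identifies their half sum and half difference. -/
theorem eventually_root_pair (hw : AnalyticAt ℝ w x₀) (hg : AnalyticAt ℝ g x₀) (hg0 : 0 < g x₀)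
    (ht₀ : 0 < t₀) (hwg : ∀ x, w x = w x₀ + -1 / t₀ * (x - x₀) + (x - x₀) ^ 3 * g x)
    {S R : ℝ × ℝ → ℝ}
    (hSR : ∀ᶠ q : (ℝ × ℝ) × ℝ × ℝ in 𝓝 ((t₀, x₀), x₀, 0), q.2.2 ≠ 0 →
        q.2.1 + q.2.2 ≠ q.1.2 → q.2.1 - q.2.2 ≠ q.1.2 →
        q.2.1 + q.2.2 + q.1.1 * w (q.2.1 + q.2.2) = q.1.2 + q.1.1 * w q.1.2 →
        q.2.1 - q.2.2 + q.1.1 * w (q.2.1 - q.2.2) = q.1.2 + q.1.1 * w q.1.2 →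
        S q.1 = q.2.1 ∧ R q.1 = q.2.2 ^ 2) :
    ∀ᶠ p : ℝ × ℝ in 𝓝 (t₀, x₀), 1 + p.1 * deriv w p.2 < 0 → 0 < R p ∧
      S p - √(R p) < p.2 ∧ p.2 < S p + √(R p) ∧
      S p - √(R p) + p.1 * w (S p - √(R p)) = p.2 + p.1 * w p.2 ∧
      S p + √(R p) + p.1 * w (S p + √(R p)) = p.2 + p.1 * w p.2 := by
  obtain ⟨ε, hε, hball⟩ := Metric.eventually_nhds_iff_ball.1 hSR
  have hloc : ∀ᶠ x in 𝓝 x₀, AnalyticAt ℝ w x ∧ 0 < g x :=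
    hw.eventually_analyticAt.and (hg.continuousAt.eventually (Ioi_mem_nhds hg0))
  obtain ⟨ε', hε', hloc⟩ := Metric.eventually_nhds_iff_ball.1 hloc
  obtain ⟨h, hh, hhε, hhε'⟩ : ∃ h : ℝ, 0 < h ∧ h < ε ∧ h < ε' :=
    ⟨min ε ε' / 2, by positivity, by linarith [min_le_left ε ε', lt_min hε hε'],
      by linarith [min_le_right ε ε', lt_min hε hε']⟩
  have hmem : ∀ ξ ∈ Icc (x₀ - h) (x₀ + h), AnalyticAt ℝ w ξ ∧ 0 < g ξ := fun ξ hξ ↦ by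
    refine hloc ξ ?_
    rw [Real.ball_eq_Ioo]
    constructor <;> linarith [hξ.1, hξ.2]
  have hwc : ContinuousOn w (Icc (x₀ - h) (x₀ + h)) := fun ξ hξ ↦
    (hmem ξ hξ).1.continuousAt.continuousWithinAt
  have hΦc : ContinuousAt (fun p : ℝ × ℝ ↦ p.2 + p.1 * w p.2) (t₀, x₀) := by
    have : ContinuousAt (fun p : ℝ × ℝ ↦ w p.2) (t₀, x₀) :=
      ContinuousAt.comp (g := w) (f := Prod.snd) hw.continuousAt continuousAt_snd
    fun_prop
  have hr : ∀ᶠ p : ℝ × ℝ in 𝓝 (t₀, x₀),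
      0 < (x₀ + h) + p.1 * w (x₀ + h) - (p.2 + p.1 * w p.2) := by
    have : ContinuousAt (fun p : ℝ × ℝ ↦ (x₀ + h) + p.1 * w (x₀ + h) - (p.2 + p.1 * w p.2))
      (t₀, x₀) := ContinuousAt.sub (by fun_prop) hΦc
    refine this.eventually (Ioi_mem_nhds ?_)
    have := (hmem (x₀ + h) ⟨by linarith, le_rfl⟩).2
    simp only
    rw [hwg (x₀ + h)]
    have h1 : x₀ + h + t₀ * (w x₀ + -1 / t₀ * (x₀ + h - x₀) + (x₀ + h - x₀) ^ 3 * g (x₀ + h)) -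
        (x₀ + t₀ * w x₀) = t₀ * (h ^ 3 * g (x₀ + h)) := by
      field_simp
      ring
    rw [h1]
    positivity
  have hl : ∀ᶠ p : ℝ × ℝ in 𝓝 (t₀, x₀),
      (x₀ - h) + p.1 * w (x₀ - h) - (p.2 + p.1 * w p.2) < 0 := by
    have : ContinuousAt (fun p : ℝ × ℝ ↦ (x₀ - h) + p.1 * w (x₀ - h) - (p.2 + p.1 * w p.2))
      (t₀, x₀) := ContinuousAt.sub (by fun_prop) hΦc
    refine this.eventually (Iio_mem_nhds ?_)
    have := (hmem (x₀ - h) ⟨le_rfl, by linarith⟩).2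
    simp only
    rw [hwg (x₀ - h)]
    have h1 : x₀ - h + t₀ * (w x₀ + -1 / t₀ * (x₀ - h - x₀) + (x₀ - h - x₀) ^ 3 * g (x₀ - h)) -
        (x₀ + t₀ * w x₀) = -(t₀ * (h ^ 3 * g (x₀ - h))) := by
      field_simp
      ring
    rw [h1, neg_lt_zero]
    positivity
  filter_upwards [hr, hl, Metric.ball_mem_nhds _ (lt_min hε hh)] with p hpr hpl hp hneg
  obtain ⟨t, x⟩ := p
  rw [← ball_prod_same, mem_prod, Real.ball_eq_Ioo, Real.ball_eq_Ioo] at hp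
  simp only at *
  obtain ⟨⟨ht1, ht2⟩, hx1, hx2⟩ := hp
  have hm1 := min_le_left ε h
  have hm2 := min_le_right ε h
  have hxI : x ∈ Icc (x₀ - h) (x₀ + h) := ⟨by linarith, by linarith⟩
  have hcont : ContinuousOn (fun ξ ↦ ξ + t * w ξ - (x + t * w x)) (Icc (x₀ - h) (x₀ + h)) := by
    fun_prop
  have hder : HasDerivAt (fun ξ ↦ ξ + t * w ξ - (x + t * w x)) (1 + t * deriv w x) x :=
    ((hasDerivAt_id x).add ((hmem x hxI).1.differentiableAt.hasDerivAt.const_mul t)).sub_const _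
  obtain ⟨x₂, hx₂, hr2⟩ := exists_root_right_of_deriv_neg (by linarith : x < x₀ + h)
    (hcont.mono (Icc_subset_Icc_left hxI.1)) hder hneg (sub_self _) hpr
  obtain ⟨x₁, hx₁, hr1⟩ := exists_root_left_of_deriv_neg (by linarith : x₀ - h < x)
    (hcont.mono (Icc_subset_Icc_right hxI.2)) hder hneg (sub_self _) hpl
  have hplus : (x₁ + x₂) / 2 + (x₂ - x₁) / 2 = x₂ := by ring
  have hminus : (x₁ + x₂) / 2 - (x₂ - x₁) / 2 = x₁ := by ring
  have hq := hball ((t, x), (x₁ + x₂) / 2, (x₂ - x₁) / 2) (by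
    rw [← ball_prod_same, ← ball_prod_same, ← ball_prod_same, mem_prod, mem_prod, mem_prod]
    simp only [Real.ball_eq_Ioo, mem_Ioo]
    refine ⟨⟨⟨?_, ?_⟩, ?_, ?_⟩, ⟨?_, ?_⟩, ?_, ?_⟩ <;> linarith [hx₁.1, hx₁.2, hx₂.1, hx₂.2])
  simp only [hplus, hminus] at hq
  obtain ⟨hS, hR⟩ := hq (by linarith [hx₁.2, hx₂.1]) hx₂.1.ne' hx₁.2.ne (by linarith) (by linarith)
  have hpos : 0 < (x₂ - x₁) / 2 := by linarith [hx₁.2, hx₂.1]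
  rw [hS, hR, Real.sqrt_sq hpos.le, hplus, hminus]
  exact ⟨by positivity, hx₁.2, hx₂.1, by linarith, by linarith⟩

/-- The mean of `q` over `[s - η, s + η]` is an analytic function of `s` and `η ^ 2`. -/
theorem exists_analyticAt_mean {q : ℝ → ℝ} {x₀ : ℝ} (hq : AnalyticAt ℝ q x₀) :
    ∃ Q : ℝ × ℝ → ℝ, AnalyticAt ℝ Q (x₀, 0) ∧ (∀ᶠ s in 𝓝 x₀, Q (s, 0) = q s) ∧
      ∀ᶠ z : ℝ × ℝ in 𝓝 (x₀, 0),
        ∫ ξ in (z.1 - z.2)..(z.1 + z.2), q ξ = 2 * z.2 * Q (z.1, z.2 ^ 2) := by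
  set P : ℝ → ℝ := fun x ↦ ∫ ξ in x₀..x, q ξ with hP
  obtain ⟨A, B, hA, hB, hAB⟩ := exists_even_odd_dividedDifference (analyticAt_integral hq)
  let ι : ℝ × ℝ → ℝ × ℝ × ℝ := fun z ↦ (z.1, z.1, z.2)
  have hι : AnalyticAt ℝ ι (x₀, 0) := analyticAt_fst.prod (analyticAt_fst.prod analyticAt_snd)
  have hQ : AnalyticAt ℝ (fun z ↦ A (ι z)) (x₀, 0) := AnalyticAt.comp (g := A) (f := ι) hA hι
  obtain ⟨ε, hε, hqball⟩ := Metric.eventually_nhds_iff_ball.1 hq.eventually_analyticAt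
  have hint : ∀ u ∈ Metric.ball x₀ ε, ∀ v ∈ Metric.ball x₀ ε,
      IntervalIntegrable q volume u v := fun u hu v hv ↦ by
    refine ContinuousOn.intervalIntegrable fun ξ hξ ↦ ?_
    have : ξ ∈ Metric.ball x₀ ε :=
      (convex_ball x₀ ε).ordConnected.uIcc_subset hu hv hξ
    exact (hqball ξ this).continuousAt.continuousWithinAt
  have hx₀ : x₀ ∈ Metric.ball x₀ ε := Metric.mem_ball_self hε
  have hpair : ∀ᶠ z : ℝ × ℝ in 𝓝 (x₀, 0), P (z.1 + z.2) - P (z.1 - z.2) =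
      2 * z.2 * A (ι (z.1, z.2 ^ 2)) := by
    have c1 : ContinuousAt (fun z : ℝ × ℝ ↦ (z.1, z.1, z.2)) (x₀, 0) := by fun_prop
    have c2 : ContinuousAt (fun z : ℝ × ℝ ↦ (z.1, z.1, -z.2)) (x₀, 0) := by fun_prop
    have e1 := c1.eventually hAB
    have e2 := c2.eventually (p := fun q : ℝ × ℝ × ℝ ↦ P (q.2.1 + q.2.2) - P q.1 =
        (q.2.1 + q.2.2 - q.1) *
          (A (q.1, q.2.1, q.2.2 ^ 2) + q.2.2 * B (q.1, q.2.1, q.2.2 ^ 2))) (by simpa using hAB)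
    filter_upwards [e1, e2] with z h1 h2
    simp only [neg_sq, ← sub_eq_add_neg] at h1 h2
    simp only [ι]
    linear_combination h1 - h2
  have hmean : ∀ᶠ z : ℝ × ℝ in 𝓝 (x₀, 0),
        ∫ ξ in (z.1 - z.2)..(z.1 + z.2), q ξ = 2 * z.2 * A (ι (z.1, z.2 ^ 2)) := by
    have c1 : ContinuousAt (fun z : ℝ × ℝ ↦ z.1 + z.2) (x₀, 0) := by fun_prop
    have c2 : ContinuousAt (fun z : ℝ × ℝ ↦ z.1 - z.2) (x₀, 0) := by fun_prop
    have m1 := c1.eventually_mem (s := Metric.ball x₀ ε) (Metric.isOpen_ball.mem_nhds (by simpa))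
    have m2 := c2.eventually_mem (s := Metric.ball x₀ ε) (Metric.isOpen_ball.mem_nhds (by simpa))
    filter_upwards [hpair, m1, m2] with z hz h1 h2
    rw [← hz, hP, intervalIntegral.integral_interval_sub_left (hint _ hx₀ _ h1) (hint _ hx₀ _ h2)]
  refine ⟨_, hQ, ?_, hmean⟩
  -- at coinciding end points the mean is the derivative of the antiderivative
  have hs : ∀ᶠ s in 𝓝 x₀, ContinuousAt (fun z ↦ A (ι z)) (s, 0) ∧
      (∀ᶠ z : ℝ × ℝ in 𝓝 (s, 0), ∫ ξ in (z.1 - z.2)..(z.1 + z.2), q ξ =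
        2 * z.2 * A (ι (z.1, z.2 ^ 2))) := by
    have c : ContinuousAt (fun s : ℝ ↦ (s, (0:ℝ))) x₀ := by fun_prop
    exact c.eventually ((hQ.eventually_analyticAt.mono fun _ h ↦ h.continuousAt).and
      hmean.eventually_nhds)
  filter_upwards [hs, Metric.ball_mem_nhds x₀ hε] with s ⟨hsA, hsm⟩ hsε
  have hPs : ∀ x ∈ Metric.ball x₀ ε, HasDerivAt P (q x) x := fun x hx ↦
    intervalIntegral.integral_hasDerivAt_right (hint _ hx₀ _ hx)
      (ContinuousOn.stronglyMeasurableAtFilter Metric.isOpen_ball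
        (fun y hy ↦ (hqball y hy).continuousAt.continuousWithinAt) x hx) (hqball x hx).continuousAt
  have d1 : HasDerivAt (fun η : ℝ ↦ P (s + η) - P (s - η)) (2 * q s) 0 := by
    have a1 : HasDerivAt (fun η : ℝ ↦ s + η) 1 0 := (hasDerivAt_id 0).const_add s
    have a2 : HasDerivAt (fun η : ℝ ↦ s - η) (-1) 0 := (hasDerivAt_id 0).const_sub s
    have b1 : HasDerivAt P (q s) (s + 0) := by simpa using hPs s hsε
    have b2 : HasDerivAt P (q s) (s - 0) := by simpa using hPs s hsε
    have := (b1.comp 0 a1).sub (b2.comp 0 a2)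
    convert! this using 1
    ring
  have d2 : HasDerivAt (fun η : ℝ ↦ 2 * η * A (ι (s, η ^ 2))) (2 * A (ι (s, 0))) 0 := by
    have hc : ContinuousAt (fun η : ℝ ↦ 2 * A (ι (s, η ^ 2))) 0 := by
      refine continuousAt_const.mul ?_
      refine ContinuousAt.comp (g := fun z ↦ A (ι z)) (f := fun η : ℝ ↦ (s, η ^ 2)) ?_ (by fun_prop)
      simpa using hsA
    rw [hasDerivAt_iff_tendsto_slope]
    have := hc.tendsto.mono_left (nhdsWithin_le_nhds (s := {0}ᶜ))
    simp only [ne_eq, OfNat.ofNat_ne_zero, not_false_eq_true, zero_pow] at this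
    refine this.congr' ?_
    filter_upwards [self_mem_nhdsWithin] with η hη
    have : η ≠ 0 := hη
    rw [slope_def_field]
    field_simp
    ring
  have heq : (fun η : ℝ ↦ P (s + η) - P (s - η)) =ᶠ[𝓝 0] fun η : ℝ ↦ 2 * η * A (ι (s, η ^ 2)) := by
    have c : ContinuousAt (fun η : ℝ ↦ (s, η)) 0 := by fun_prop
    have m1 : ∀ᶠ η : ℝ in 𝓝 0, s + η ∈ Metric.ball x₀ ε := by
      have : ContinuousAt (fun η : ℝ ↦ s + η) 0 := by fun_prop
      exact this.eventually_mem (Metric.isOpen_ball.mem_nhds (by simpa using hsε))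
    have m2 : ∀ᶠ η : ℝ in 𝓝 0, s - η ∈ Metric.ball x₀ ε := by
      have : ContinuousAt (fun η : ℝ ↦ s - η) 0 := by fun_prop
      exact this.eventually_mem (Metric.isOpen_ball.mem_nhds (by simpa using hsε))
    filter_upwards [c.eventually hsm, m1, m2] with η h h1 h2
    rw [← h, hP, intervalIntegral.integral_interval_sub_left (hint _ hx₀ _ h1) (hint _ hx₀ _ h2)]
  have := (d1.congr_of_eventuallyEq heq.symm).unique d2
  linarith

end PressurelessGas

/-! ### Briot–Bouquet equations -/

namespace PressurelessGas

/-- The operator `(L f)(θ) = ∫₀¹ σ ^ (l - 1) f(σ θ) dσ`, a right inverse of `θ d/dθ + l`. -/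
theorem exists_eulerInverse {l : ℝ} (hl : 1 ≤ l) :
    ∃ L : C(Icc (0:ℝ) 1, ℝ) →L[ℝ] C(Icc (0:ℝ) 1, ℝ), ∀ f θ,
      L f θ = ∫ σ in (0:ℝ)..1, σ ^ (l - 1) * IccExtend zero_le_one f (σ * θ) := by
  have hrpow : Continuous fun σ : ℝ ↦ σ ^ (l - 1) := Real.continuous_rpow_const (by linarith)
  have hcont : ∀ (f : C(Icc (0:ℝ) 1, ℝ)) (θ : ℝ),
      Continuous fun σ : ℝ ↦ σ ^ (l - 1) * IccExtend zero_le_one f (σ * θ) := fun f θ ↦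
    hrpow.mul (f.continuous.Icc_extend'.comp (by fun_prop))
  let T : C(Icc (0:ℝ) 1, ℝ) → C(Icc (0:ℝ) 1, ℝ) := fun f ↦
    ⟨fun θ ↦ ∫ σ in (0:ℝ)..1, σ ^ (l - 1) * IccExtend zero_le_one f (σ * θ), by
      refine intervalIntegral.continuous_parametric_intervalIntegral_of_continuous' ?_ 0 1
      exact (hrpow.comp continuous_snd).mul (f.continuous.Icc_extend'.comp (by fun_prop))⟩
  have hT : ∀ f θ, T f θ = ∫ σ in (0:ℝ)..1, σ ^ (l - 1) * IccExtend zero_le_one f (σ * θ) :=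
    fun _ _ ↦ rfl
  refine ⟨LinearMap.mkContinuous
    { toFun := T
      map_add' := fun f h ↦ by
        ext θ
        rw [ContinuousMap.add_apply, hT, hT, hT, ← intervalIntegral.integral_add
          ((hcont f θ).intervalIntegrable _ _) ((hcont h θ).intervalIntegrable _ _)]
        refine intervalIntegral.integral_congr fun σ _ ↦ ?_
        simp only [IccExtend_apply, ContinuousMap.add_apply]
        ring
      map_smul' := fun c f ↦ by
        ext θ
        rw [RingHom.id_apply, ContinuousMap.smul_apply, hT, hT, ← intervalIntegral.integral_smul]
        refine intervalIntegral.integral_congr fun σ _ ↦ ?_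
        simp only [IccExtend_apply, ContinuousMap.smul_apply, smul_eq_mul]
        ring } 1 fun f ↦ ?_, hT⟩
  refine (ContinuousMap.norm_le _ (by positivity)).2 fun θ ↦ ?_
  have := intervalIntegral.norm_integral_le_of_norm_le_const (a := (0:ℝ)) (b := 1)
    (f := fun σ ↦ σ ^ (l - 1) * IccExtend zero_le_one f (σ * θ)) (C := ‖f‖) fun σ hσ ↦ by
      rw [uIoc_of_le zero_le_one] at hσ
      rw [norm_mul]
      refine (mul_le_of_le_one_left (norm_nonneg _) ?_).trans (f.norm_coe_le_norm _)
      rw [Real.norm_of_nonneg (Real.rpow_nonneg hσ.1.le _)]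
      exact Real.rpow_le_one hσ.1.le hσ.2 (by linarith)
  rw [one_mul]
  change ‖T f θ‖ ≤ _
  rw [hT]
  simpa using this

/-- The integral form of a Briot–Bouquet equation has an analytic solution. The solutions on
`[0, ε]`, rescaled to `[0, 1]`, are a zero of an analytic map on `C([0, 1])` depending analytically
on `ε`; by uniqueness they are rescalings of one function. -/
theorem exists_analyticAt_integral_equation {g : ℝ × ℝ → ℝ} {z₀ l : ℝ} (hl : 1 ≤ l)
    (hg : AnalyticAt ℝ g (0, z₀)) (hg0 : g (0, z₀) = 0) (hg1 : fderiv ℝ g (0, z₀) (0, 1) = 0) :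
    ∃ z : ℝ → ℝ, AnalyticAt ℝ z 0 ∧ z 0 = z₀ ∧
      ∀ᶠ e in 𝓝 (0:ℝ), z e = z₀ + ∫ σ in (0:ℝ)..1, σ ^ (l - 1) * g (e * σ, z (e * σ)) := by
  obtain ⟨L, hL⟩ := exists_eulerInverse hl
  obtain ⟨N, hN, hNg⟩ := exists_analyticAt_superposition (K := Icc (0:ℝ) 1) hg
  let D : (ℝ × C(Icc (0:ℝ) 1, ℝ)) →L[ℝ] C(Icc (0:ℝ) 1, ℝ × ℝ) := LinearMap.mkContinuous
    { toFun := fun v ↦ ⟨fun θ ↦ (v.1 * θ, v.2 θ), by fun_prop⟩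
      map_add' := fun u v ↦ by ext θ <;> simp [add_mul]
      map_smul' := fun c v ↦ by ext θ <;> simp [mul_assoc] } 1 fun v ↦ by
        refine (ContinuousMap.norm_le _ (by positivity)).2 fun θ ↦ ?_
        rw [one_mul]
        refine max_le ?_ ((v.2.norm_coe_le_norm θ).trans (norm_snd_le v))
        refine le_trans ?_ (norm_fst_le v)
        change ‖v.1 * (θ : ℝ)‖ ≤ ‖v.1‖
        rw [norm_mul]
        refine mul_le_of_le_one_right (norm_nonneg _) ?_
        rw [Real.norm_of_nonneg θ.2.1]
        exact θ.2.2
  have hD : ∀ v θ, D v θ = (v.1 * θ, v.2 θ) := fun _ _ ↦ rfl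
  set ζ₀ : C(Icc (0:ℝ) 1, ℝ) := ContinuousMap.const _ z₀ with hζ₀
  have hD0 : D (0, ζ₀) = ContinuousMap.const _ (0, z₀) := by
    ext θ <;> simp [hD, hζ₀]
  have hN0 : N (ContinuousMap.const _ (0, z₀)) = 0 := by
    ext θ
    rw [hNg.self_of_nhds]
    exact hg0
  have hND : AnalyticAt ℝ (fun v ↦ N (D v)) (0, ζ₀) :=
    AnalyticAt.comp (g := N) (f := D) (by rw [hD0]; exact hN) (D.analyticAt _)
  let Θ : ℝ × C(Icc (0:ℝ) 1, ℝ) → ℝ × C(Icc (0:ℝ) 1, ℝ) := fun v ↦ (v.1, v.2 - ζ₀ - L (N (D v)))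
  have hΘ : AnalyticAt ℝ Θ (0, ζ₀) := analyticAt_fst.prod
    ((analyticAt_snd.sub analyticAt_const).sub ((L.analyticAt _).comp hND))
  have hΘ0 : Θ (0, ζ₀) = (0, 0) := by simp [Θ, hD0, hN0]
  -- the superposition operator has no derivative in the direction of the unknown function
  have dN : HasFDerivAt N (fderiv ℝ N (D (0, ζ₀))) (D (0, ζ₀)) := by
    rw [hD0]; exact hN.differentiableAt.hasFDerivAt
  set N' := fderiv ℝ N (D (0, ζ₀)) with hN'
  have hN'apply : ∀ v θ, N' v θ = fderiv ℝ g (0, z₀) (v θ) := fun v θ ↦ by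
    rw [hD0] at dN
    let ev₁ : C(Icc (0:ℝ) 1, ℝ) →L[ℝ] ℝ := ContinuousMap.evalCLM ℝ θ
    let ev₂ : C(Icc (0:ℝ) 1, ℝ × ℝ) →L[ℝ] ℝ × ℝ := ContinuousMap.evalCLM ℝ θ
    have h1 : HasFDerivAt (fun ζ ↦ N ζ θ) (ev₁.comp N') (ContinuousMap.const _ (0, z₀)) :=
      HasFDerivAt.comp (g := ev₁) (f := N) _ ev₁.hasFDerivAt dN
    have h2 : HasFDerivAt (fun ζ : C(Icc (0:ℝ) 1, ℝ × ℝ) ↦ g (ζ θ))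
        ((fderiv ℝ g (0, z₀)).comp ev₂) (ContinuousMap.const _ (0, z₀)) :=
      HasFDerivAt.comp (g := g) (f := ev₂) _ hg.differentiableAt.hasFDerivAt ev₂.hasFDerivAt
    have h3 := h1.unique (h2.congr_of_eventuallyEq (hNg.mono fun ζ h ↦ h θ))
    exact congrArg (fun T ↦ T v) h3
  set c : C(Icc (0:ℝ) 1, ℝ) := L (N' (D (1, 0))) with hc
  have hN'D : ∀ v : ℝ × C(Icc (0:ℝ) 1, ℝ), N' (D v) = v.1 • N' (D (1, 0)) := fun v ↦ by
    ext θ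
    have e1 : D v θ = v.1 • D (1, 0) θ + v.2 θ • ((0, 1) : ℝ × ℝ) := by
      ext <;> simp [hD]
    rw [hN'apply, e1, map_add, map_smul, map_smul, hg1, smul_zero, add_zero,
      ContinuousMap.smul_apply, hN'apply]
  let Ξ : (ℝ × C(Icc (0:ℝ) 1, ℝ)) ≃L[ℝ] ℝ × C(Icc (0:ℝ) 1, ℝ) :=
    ContinuousLinearEquiv.skewProd (ContinuousLinearEquiv.refl ℝ ℝ)
      (ContinuousLinearEquiv.refl ℝ _) (ContinuousLinearMap.toSpanSingleton ℝ (-c))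
  have dΘ : HasFDerivAt Θ (Ξ : (ℝ × C(Icc (0:ℝ) 1, ℝ)) →L[ℝ] ℝ × C(Icc (0:ℝ) 1, ℝ))
      (0, ζ₀) := by
    have h1 := HasFDerivAt.comp (g := N) (f := D) (0, ζ₀) dN D.hasFDerivAt
    have h2 := HasFDerivAt.comp (g := L) (f := N ∘ D) (0, ζ₀) L.hasFDerivAt h1
    have h3 := (hasFDerivAt_snd (𝕜 := ℝ) (p := ((0:ℝ), ζ₀))).sub_const ζ₀
    have h4 := (hasFDerivAt_fst (𝕜 := ℝ) (p := ((0:ℝ), ζ₀))).prodMk (h3.sub h2)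
    refine HasFDerivAt.congr_fderiv (f' := _) h4 ?_
    refine ContinuousLinearMap.ext fun v ↦ ?_
    change (v.1, v.2 - L (N' (D v))) = (v.1, v.2 + v.1 • (-c))
    rw [hN'D, map_smul, smul_neg, ← sub_eq_add_neg]
  obtain ⟨H, hH, hH0, -, hHl, hHr⟩ := exists_analyticAt_localInverse hΘ _ dΘ
  rw [hΘ0] at hH hH0 hHr
  have hHi : AnalyticAt ℝ (fun e : ℝ ↦ H (e, 0)) 0 :=
    AnalyticAt.comp (g := H) (f := fun e : ℝ ↦ (e, (0 : C(Icc (0:ℝ) 1, ℝ)))) hH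
      (analyticAt_id.prod analyticAt_const)
  let one : Icc (0:ℝ) 1 := ⟨1, by simp⟩
  let z : ℝ → ℝ := fun e ↦ (H (e, 0)).2 one
  let ev : C(Icc (0:ℝ) 1, ℝ) →L[ℝ] ℝ := ContinuousMap.evalCLM ℝ one
  have hz : AnalyticAt ℝ z 0 := AnalyticAt.comp (g := ev) (f := fun e ↦ (H (e, 0)).2)
    (ev.analyticAt _) (analyticAt_snd.comp hHi)
  refine ⟨z, hz, by simp [z, hH0, hζ₀], ?_⟩
  have hcD : ContinuousAt D (0, ζ₀) := D.continuous.continuousAt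
  have hpt : ∀ᶠ v in 𝓝 ((0:ℝ), ζ₀), ∀ k, N (D v) k = g (D v k) :=
    hcD.eventually (by rw [hD0]; exact hNg)
  obtain ⟨r, hr, hball⟩ := Metric.eventually_nhds_iff_ball.1 (hHl.and hpt)
  have hcH : ∀ᶠ e in 𝓝 (0:ℝ), H (e, 0) ∈ Metric.ball ((0:ℝ), ζ₀) r :=
    hHi.continuousAt.eventually_mem (Metric.isOpen_ball.mem_nhds (by
      simp only [hH0]
      exact Metric.mem_ball_self hr))
  have hΘH : ∀ᶠ e in 𝓝 (0:ℝ), Θ (H (e, 0)) = (e, 0) := by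
    have : ContinuousAt (fun e : ℝ ↦ (e, (0 : C(Icc (0:ℝ) 1, ℝ)))) 0 := by fun_prop
    exact this.eventually hHr
  filter_upwards [hcH, hΘH] with e he1 he2
  set ζ := (H (e, 0)).2 with hζ
  have hHe : H (e, 0) = (e, ζ) := by
    have h1 : (H (e, 0)).1 = e := congrArg Prod.fst he2
    exact Prod.ext h1 rfl
  rw [hHe] at he1 he2
  have hζeq : ∀ θ, ζ θ = z₀ + ∫ σ in (0:ℝ)..1, σ ^ (l - 1) *
      IccExtend zero_le_one (N (D (e, ζ))) (σ * θ) := fun θ ↦ by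
    have h1 : ζ - ζ₀ - L (N (D (e, ζ))) = 0 := congrArg Prod.snd he2
    have h2 := congrArg (fun f : C(Icc (0:ℝ) 1, ℝ) ↦ f θ) h1
    simp only [ContinuousMap.sub_apply, hL, hζ₀, ContinuousMap.const_apply,
      ContinuousMap.zero_apply] at h2
    linarith
  -- rescaling a solution gives the solution on a shorter interval
  have hdil : ∀ s : Icc (0:ℝ) 1, z (e * s) = ζ s := fun s ↦ by
    let κ : C(Icc (0:ℝ) 1, Icc (0:ℝ) 1) := ⟨fun θ ↦ ⟨s * θ, mul_nonneg s.2.1 θ.2.1,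
      mul_le_one₀ s.2.2 θ.2.1 θ.2.2⟩, by fun_prop⟩
    have hκ : ∀ θ, ((κ θ : Icc (0:ℝ) 1) : ℝ) = s * θ := fun _ ↦ rfl
    have hmem : (e * s, ζ.comp κ) ∈ Metric.ball ((0:ℝ), ζ₀) r := by
      rw [mem_ball_iff_norm, Prod.mk_sub_mk, Prod.norm_mk, max_lt_iff] at he1 ⊢
      refine ⟨lt_of_le_of_lt ?_ he1.1, lt_of_le_of_lt ?_ he1.2⟩
      · rw [sub_zero, sub_zero, norm_mul, Real.norm_of_nonneg s.2.1]
        exact mul_le_of_le_one_right (norm_nonneg _) s.2.2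
      · exact (ContinuousMap.norm_le _ (norm_nonneg _)).2 fun θ ↦
          (ζ - ζ₀).norm_coe_le_norm (κ θ)
    have hθ : Θ (e * s, ζ.comp κ) = (e * s, 0) := by
      ext1
      · rfl
      · ext θ
        change ζ (κ θ) - z₀ - L (N (D (e * s, ζ.comp κ))) θ = 0
        rw [hζeq, hL, sub_sub, sub_eq_zero]
        congr 1
        refine intervalIntegral.integral_congr fun σ hσ ↦ ?_
        rw [uIcc_of_le zero_le_one] at hσ
        have hm : σ * θ ∈ Icc (0:ℝ) 1 :=
          ⟨mul_nonneg hσ.1 θ.2.1, mul_le_one₀ hσ.2 θ.2.1 θ.2.2⟩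
        have hm' : σ * (κ θ : ℝ) ∈ Icc (0:ℝ) 1 :=
          ⟨mul_nonneg hσ.1 (κ θ).2.1, mul_le_one₀ hσ.2 (κ θ).2.1 (κ θ).2.2⟩
        simp only [IccExtend_of_mem _ _ hm, IccExtend_of_mem _ _ hm']
        rw [(hball _ he1).2, (hball _ hmem).2]
        have hκ2 : κ ⟨σ * θ, hm⟩ = ⟨σ * κ θ, hm'⟩ := by
          ext; simp only [hκ]; ring
        simp only [hD, ContinuousMap.comp_apply, hκ2, hκ]
        rw [show e * (s : ℝ) * (σ * θ) = e * (σ * (s * θ)) by ring]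
    have h1 := (hball _ hmem).1
    rw [hθ] at h1
    have h2 : κ one = s := by ext; simp [hκ, one]
    simp only [z, h1, ContinuousMap.comp_apply, h2]
  have h1 := hdil one
  simp only [one, mul_one] at h1
  rw [h1, hζeq]
  congr 1
  refine intervalIntegral.integral_congr fun σ hσ ↦ ?_
  rw [uIcc_of_le zero_le_one] at hσ
  simp only [mul_one]
  rw [IccExtend_of_mem _ _ hσ, (hball _ he1).2, hD, hdil ⟨σ, hσ⟩]

/-- A Briot–Bouquet equation `τ z' = h(τ, z)` without resonance has an analytic solution. -/
theorem exists_analyticAt_briotBouquet {h : ℝ × ℝ → ℝ} {z₀ l : ℝ} (hl : 1 ≤ l)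
    (hh : AnalyticAt ℝ h (0, z₀)) (hh0 : h (0, z₀) = 0) (hh1 : fderiv ℝ h (0, z₀) (0, 1) = -l) :
    ∃ z : ℝ → ℝ, AnalyticAt ℝ z 0 ∧ z 0 = z₀ ∧ ∀ᶠ τ in 𝓝 (0:ℝ), τ * deriv z τ = h (τ, z τ) := by
  set g : ℝ × ℝ → ℝ := fun p ↦ h p + l * (p.2 - z₀) with hg
  have hgan : AnalyticAt ℝ g (0, z₀) :=
    hh.add (analyticAt_const.mul (analyticAt_snd.sub analyticAt_const))
  have hg1 : fderiv ℝ g (0, z₀) (0, 1) = 0 := by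
    have h2 := ((hasFDerivAt_snd (𝕜 := ℝ) (p := ((0:ℝ), z₀))).sub_const z₀).const_mul l
    rw [show fderiv ℝ g (0, z₀) = _ from (hh.differentiableAt.hasFDerivAt.add h2).fderiv]
    simp [hh1]
  obtain ⟨z, hz, hz0, hzeq⟩ := exists_analyticAt_integral_equation hl hgan (by simp [hg, hh0]) hg1
  refine ⟨z, hz, hz0, ?_⟩
  have hpair : AnalyticAt ℝ (fun τ ↦ (τ, z τ)) 0 := analyticAt_id.prod hz
  have hq : AnalyticAt ℝ (fun τ ↦ g (τ, z τ)) 0 :=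
    AnalyticAt.comp (g := g) (f := fun τ ↦ (τ, z τ)) (by simpa [hz0] using hgan) hpair
  have hE : AnalyticAt ℝ (fun τ ↦ τ * deriv z τ - h (τ, z τ)) 0 := by
    refine (analyticAt_id.mul hz.deriv).sub ?_
    exact AnalyticAt.comp (g := h) (f := fun τ ↦ (τ, z τ)) (by simpa [hz0] using hh) hpair
  obtain ⟨r, hr, hball⟩ := Metric.eventually_nhds_iff_ball.1
    (hzeq.and (hq.eventually_analyticAt.and hz.eventually_analyticAt))
  have key : ∀ τ ∈ Ioo 0 r, τ * deriv z τ - h (τ, z τ) = 0 := by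
    have hb : ∀ τ ∈ Ioo (-r) r, τ ∈ Metric.ball (0:ℝ) r := fun τ hτ ↦ by
      simpa [Real.ball_eq_Ioo] using hτ
    have hqc : ContinuousOn (fun τ ↦ τ ^ (l - 1) * g (τ, z τ)) (Ioo (-r) r) := fun τ hτ ↦
      ((Real.continuous_rpow_const (by linarith)).continuousAt.mul
        (hball τ (hb τ hτ)).2.1.continuousAt).continuousWithinAt
    have hrep : ∀ τ ∈ Ioo 0 r, τ ^ l * (z τ - z₀) = ∫ u in (0:ℝ)..τ, u ^ (l - 1) * g (u, z u) := by
      intro τ hτ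
      have h1 := intervalIntegral.smul_integral_comp_mul_left (a := 0) (b := 1)
        (fun u ↦ u ^ (l - 1) * g (u, z u)) τ
      rw [mul_zero, mul_one, smul_eq_mul] at h1
      have h2 : ∫ σ in (0:ℝ)..1, (τ * σ) ^ (l - 1) * g (τ * σ, z (τ * σ)) =
          τ ^ (l - 1) * ∫ σ in (0:ℝ)..1, σ ^ (l - 1) * g (τ * σ, z (τ * σ)) := by
        rw [← intervalIntegral.integral_const_mul]
        refine intervalIntegral.integral_congr fun σ hσ ↦ ?_
        rw [uIcc_of_le zero_le_one] at hσ
        rw [Real.mul_rpow hτ.1.le hσ.1]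
        ring
      have h3 := (hball τ (hb τ ⟨by linarith [hτ.1], hτ.2⟩)).1
      rw [← h1, h2, h3, add_sub_cancel_left, ← mul_assoc]
      congr 1
      nth_rewrite 2 [← Real.rpow_one τ]
      rw [← Real.rpow_add hτ.1]
      ring_nf
    intro τ hτ
    have hτ' : τ ∈ Ioo (-r) r := ⟨by linarith [hτ.1], hτ.2⟩
    have d1 : HasDerivAt (fun τ ↦ τ ^ l * (z τ - z₀))
        (l * τ ^ (l - 1) * (z τ - z₀) + τ ^ l * deriv z τ) τ :=
      (Real.hasDerivAt_rpow_const (Or.inl hτ.1.ne')).mul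
        ((hball τ (hb τ hτ')).2.2.differentiableAt.hasDerivAt.sub_const z₀)
    have d2 : HasDerivAt (fun τ ↦ ∫ u in (0:ℝ)..τ, u ^ (l - 1) * g (u, z u))
        (τ ^ (l - 1) * g (τ, z τ)) τ := by
      refine intervalIntegral.integral_hasDerivAt_right ?_ ?_ ?_
      · refine ContinuousOn.intervalIntegrable (hqc.mono ?_)
        rw [uIcc_of_le hτ.1.le]
        exact Icc_subset_Ioo (by linarith) hτ.2
      · exact hqc.stronglyMeasurableAtFilter isOpen_Ioo τ hτ'
      · exact hqc.continuousAt (isOpen_Ioo.mem_nhds hτ')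
    have heq := d1.unique (d2.congr_of_eventuallyEq (by
      filter_upwards [isOpen_Ioo.mem_nhds hτ] with u hu using hrep u hu))
    have hpow : τ ^ l = τ ^ (l - 1) * τ := by
      nth_rewrite 3 [← Real.rpow_one τ]
      rw [← Real.rpow_add hτ.1]
      ring_nf
    have hne : τ ^ (l - 1) ≠ 0 := (Real.rpow_pos_of_pos hτ.1 _).ne'
    apply mul_left_cancel₀ hne
    rw [hpow] at heq
    simp only [hg] at heq
    linear_combination heq
  have hfreq : ∃ᶠ τ in 𝓝[≠] (0:ℝ), τ * deriv z τ - h (τ, z τ) = 0 := by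
    have : ∀ᶠ τ in 𝓝[>] (0:ℝ), τ * deriv z τ - h (τ, z τ) = 0 := by
      filter_upwards [Ioo_mem_nhdsGT hr] with τ hτ using key τ hτ
    exact this.frequently.filter_mono (nhdsWithin_mono 0 fun y (hy : 0 < y) ↦ hy.ne')
  filter_upwards [hE.frequently_zero_iff_eventually_zero.1 hfreq] with τ hτ
  linarith

end PressurelessGas

/-! ### The stable manifold of the saddle -/

namespace PressurelessGas

/-- The analytic invariant curve tangent to the stable direction of the saddle. In the blow-up
`x = x₀ + (t - t₀) z` its equation is of Briot–Bouquet type. -/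
theorem exists_analyticAt_invariant_curve {w k : ℝ → ℝ} {F : ℝ × ℝ → ℝ} {x₀ t₀ : ℝ} (ht₀ : 0 < t₀)
    (hk : AnalyticAt ℝ k x₀)
    (hwk : ∀ᶠ x in 𝓝 x₀, deriv w x = -1 / t₀ + (x - x₀) ^ 2 * k x)
    (hF : AnalyticAt ℝ F (t₀, x₀)) (hF0 : F (t₀, x₀) = 0)
    (hF1 : 0 ≤ fderiv ℝ F (t₀, x₀) (0, 1)) :
    ∃ X c : ℝ → ℝ, AnalyticAt ℝ X t₀ ∧ X t₀ = x₀ ∧ AnalyticAt ℝ c t₀ ∧ 0 < c t₀ ∧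
      (∀ᶠ t in 𝓝 t₀, 1 + t * deriv w (X t) = -(t - t₀) * c t) ∧
      ∀ᶠ t in 𝓝 t₀, deriv X t * (1 + t * deriv w (X t)) = F (t, X t) := by
  have ht0 := ht₀.ne'
  set m := fderiv ℝ F (t₀, x₀) (0, 1) with hm
  set n := fderiv ℝ F (t₀, x₀) (1, 0) with hn
  have hG : AnalyticAt ℝ (fun v ↦ F ((t₀, x₀) + v)) 0 := by
    refine AnalyticAt.comp (g := F) (f := fun v ↦ (t₀, x₀) + v) ?_
      (analyticAt_const.add analyticAt_id)
    simpa using hF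
  obtain ⟨ℓ, hℓ, hℓ0, hFℓ⟩ := exists_analyticAt_eq_clm_apply hG (by simpa using hF0)
  have hℓ0' : ℓ 0 = fderiv ℝ F (t₀, x₀) := by
    rw [hℓ0, fderiv_comp_add_left, add_zero]
  -- the blow-up of the two components of the vector field
  let ι : ℝ × ℝ → ℝ × ℝ := fun q ↦ (q.1, q.1 * q.2)
  let a : ℝ × ℝ → ℝ := fun q ↦ -1 / t₀ + (t₀ + q.1) * q.1 * q.2 ^ 2 * k (x₀ + q.1 * q.2)
  let b : ℝ × ℝ → ℝ := fun q ↦ ℓ (ι q) (1, 0) + q.2 * ℓ (ι q) (0, 1)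
  let h : ℝ × ℝ → ℝ := fun q ↦ b q / a q - q.2
  set z₀ : ℝ := -(t₀ * n) / (1 + t₀ * m) with hz₀
  have hden : 0 < 1 + t₀ * m := by positivity
  have hι : AnalyticAt ℝ ι (0, z₀) := analyticAt_fst.prod (analyticAt_fst.mul analyticAt_snd)
  have hι0 : ι (0, z₀) = 0 := by simp [ι]
  have hℓι : ∀ v, AnalyticAt ℝ (fun q ↦ ℓ (ι q) v) (0, z₀) := fun v ↦
    ((ContinuousLinearMap.apply ℝ ℝ v).analyticAt _).comp
      (AnalyticAt.comp (g := ℓ) (f := ι) (by rwa [hι0]) hι)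
  have hb : AnalyticAt ℝ b (0, z₀) := (hℓι _).add (analyticAt_snd.mul (hℓι _))
  have ha : AnalyticAt ℝ a (0, z₀) := by
    refine analyticAt_const.add (AnalyticAt.mul (((analyticAt_const.add analyticAt_fst).mul
      analyticAt_fst).mul (analyticAt_snd.pow 2)) ?_)
    exact AnalyticAt.comp (g := k) (f := fun q : ℝ × ℝ ↦ x₀ + q.1 * q.2) (by simpa using hk)
      (analyticAt_const.add (analyticAt_fst.mul analyticAt_snd))
  have ha0 : ∀ z, a (0, z) = -1 / t₀ := fun z ↦ by simp [a]
  have hb0 : ∀ z, b (0, z) = n + z * m := fun z ↦ by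
    have : ι (0, z) = 0 := by simp [ι]
    simp only [b, this, hℓ0', hm, hn]
  have hane : a (0, z₀) ≠ 0 := by
    rw [ha0]
    exact div_ne_zero (by norm_num) ht0
  have hh : AnalyticAt ℝ h (0, z₀) := (hb.div ha hane).sub analyticAt_snd
  have hh0z : ∀ z, h (0, z) = -(t₀ * n) - (1 + t₀ * m) * z := fun z ↦ by
    simp only [h, ha0, hb0]
    field_simp
    ring
  have hh0 : h (0, z₀) = 0 := by
    rw [hh0z, hz₀]
    field_simp
    ring
  have hh1 : fderiv ℝ h (0, z₀) (0, 1) = -(1 + t₀ * m) := by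
    have d1 : HasDerivAt (fun z : ℝ ↦ ((0:ℝ), z)) (0, 1) z₀ :=
      (hasDerivAt_const _ _).prodMk (hasDerivAt_id _)
    have d2 := HasFDerivAt.comp_hasDerivAt (l := h) z₀ hh.differentiableAt.hasFDerivAt d1
    have d3 : HasDerivAt (h ∘ fun z : ℝ ↦ ((0:ℝ), z)) (-(1 + t₀ * m)) z₀ := by
      have e : (h ∘ fun z : ℝ ↦ ((0:ℝ), z)) = fun z ↦ -(t₀ * n) - (1 + t₀ * m) * z := funext hh0z
      rw [e]
      simpa using ((hasDerivAt_id z₀).const_mul (1 + t₀ * m)).const_sub (-(t₀ * n))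
    exact d2.unique d3
  have hl : 1 ≤ 1 + t₀ * m := by
    have := mul_nonneg ht₀.le hF1
    linarith
  obtain ⟨z, hz, hz0, hzeq⟩ := exists_analyticAt_briotBouquet hl hh hh0 hh1
  have hsub : AnalyticAt ℝ (fun t ↦ t - t₀) t₀ := analyticAt_id.sub analyticAt_const
  have hzs : AnalyticAt ℝ (fun t ↦ z (t - t₀)) t₀ :=
    AnalyticAt.comp (g := z) (f := fun t ↦ t - t₀) (by simpa using hz) hsub
  have hq : AnalyticAt ℝ (fun t ↦ (t - t₀, z (t - t₀))) t₀ := hsub.prod hzs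
  have hX : AnalyticAt ℝ (fun t ↦ x₀ + (t - t₀) * z (t - t₀)) t₀ :=
    analyticAt_const.add (hsub.mul hzs)
  have hc : AnalyticAt ℝ (fun t ↦ -a (t - t₀, z (t - t₀))) t₀ :=
    (AnalyticAt.comp (g := a) (f := fun t ↦ (t - t₀, z (t - t₀))) (by simpa [hz0] using ha) hq).neg
  have hc0 : 0 < -a (t₀ - t₀, z (t₀ - t₀)) := by
    rw [sub_self, ha0, neg_div, neg_neg]
    positivity
  have hf1 : ∀ᶠ t in 𝓝 t₀, 1 + t * deriv w (x₀ + (t - t₀) * z (t - t₀)) =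
      -(t - t₀) * -a (t - t₀, z (t - t₀)) := by
    have : Tendsto (fun t ↦ x₀ + (t - t₀) * z (t - t₀)) (𝓝 t₀) (𝓝 x₀) := by
      simpa using hX.continuousAt.tendsto
    filter_upwards [this.eventually hwk] with t ht
    rw [ht]
    simp only [a, add_sub_cancel, add_sub_cancel_left]
    field_simp
    ring
  refine ⟨_, _, hX, by simp, hc, hc0, hf1, ?_⟩
  have htd : Tendsto (fun t ↦ t - t₀) (𝓝 t₀) (𝓝 0) := by simpa using hsub.continuousAt.tendsto
  have hFt : ∀ᶠ t in 𝓝 t₀, F ((t₀, x₀) + ι (t - t₀, z (t - t₀))) =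
      ℓ (ι (t - t₀, z (t - t₀))) (ι (t - t₀, z (t - t₀))) := by
    have c1 : ContinuousAt (fun t ↦ ι (t - t₀, z (t - t₀))) t₀ :=
      ContinuousAt.comp (g := ι) (f := fun t ↦ (t - t₀, z (t - t₀)))
        (by simpa [hz0] using hι.continuousAt) hq.continuousAt
    refine c1.eventually (p := fun v ↦ F ((t₀, x₀) + v) = ℓ v v) ?_
    have e : ι (t₀ - t₀, z (t₀ - t₀)) = 0 := by simp [ι]
    simp only [e]
    exact hFℓ
  have hne : ∀ᶠ t in 𝓝 t₀, 0 < -a (t - t₀, z (t - t₀)) :=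
    hc.continuousAt.eventually (Ioi_mem_nhds hc0)
  filter_upwards [hf1, hFt, hne, htd.eventually hzeq, htd.eventually hz.eventually_analyticAt]
    with t h1 h2 h3 h4 h5
  have dX : HasDerivAt (fun t ↦ x₀ + (t - t₀) * z (t - t₀))
      (1 * z (t - t₀) + (t - t₀) * deriv z (t - t₀)) t := by
    have d1 : HasDerivAt (fun t ↦ t - t₀) 1 t := (hasDerivAt_id t).sub_const _
    have d2 : HasDerivAt (fun t ↦ z (t - t₀)) (deriv z (t - t₀)) t := by
      have := HasDerivAt.comp (h₂ := z) t h5.differentiableAt.hasDerivAt d1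
      simpa [Function.comp_def] using this
    exact (d1.mul d2).const_add x₀
  rw [dX.deriv, h4, h1]
  have h6 : ι (t - t₀, z (t - t₀)) = (t - t₀) • (((1, 0) : ℝ × ℝ) + z (t - t₀) • (0, 1)) := by
    ext <;> simp [ι]
  have h7 : (t₀, x₀) + ι (t - t₀, z (t - t₀)) = (t, x₀ + (t - t₀) * z (t - t₀)) := by
    ext <;> simp [ι]
  have h8 : ∀ L : (ℝ × ℝ) →L[ℝ] ℝ, L (ι (t - t₀, z (t - t₀))) =
      (t - t₀) * (L (1, 0) + z (t - t₀) * L (0, 1)) := fun L ↦ by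
    rw [h6, map_smul, map_add, map_smul, smul_eq_mul, smul_eq_mul]
  rw [h7, h8] at h2
  rw [h2]
  have h9 : a (t - t₀, z (t - t₀)) ≠ 0 := by linarith
  simp only [h]
  rw [show ℓ (ι (t - t₀, z (t - t₀))) (1, 0) + z (t - t₀) * ℓ (ι (t - t₀, z (t - t₀))) (0, 1) =
    b (t - t₀, z (t - t₀)) from rfl]
  field_simp
  ring

/-- The autonomous equation `q' = C(q)` is solved by the inverse of an antiderivative of `1 / C`. -/
theorem exists_solution_of_pos {C : ℝ → ℝ} {κ M : ℝ} (hC : Continuous C) (hκ : 0 < κ)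
    (hκC : ∀ q, κ ≤ C q) (hCM : ∀ q, C q ≤ M) :
    ∃ q : ℝ → ℝ, q 0 = 0 ∧ (∀ s, HasDerivAt q (C (q s)) s) ∧ ∀ s, 0 ≤ s → κ * s ≤ q s := by
  have hpos : ∀ q, 0 < C q := fun q ↦ hκ.trans_le (hκC q)
  have hM : 0 < M := (hpos 0).trans_le (hCM 0)
  have hinv : Continuous fun q ↦ (C q)⁻¹ := hC.inv₀ fun q ↦ (hpos q).ne'
  set Θ : ℝ → ℝ := fun q ↦ ∫ u in (0:ℝ)..q, (C u)⁻¹ with hΘ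
  have dΘ : ∀ q, HasDerivAt Θ (C q)⁻¹ q := fun q ↦
    intervalIntegral.integral_hasDerivAt_right (hinv.intervalIntegrable _ _)
      (hinv.stronglyMeasurableAtFilter _ _) hinv.continuousAt
  have hΘ0 : Θ 0 = 0 := by simp [hΘ]
  have hmono : StrictMono Θ := strictMono_of_deriv_pos fun q ↦ by
    rw [(dΘ q).deriv]; exact inv_pos.2 (hpos q)
  have hcont : Continuous Θ := continuous_iff_continuousAt.2 fun q ↦ (dΘ q).continuousAt
  have hlin : Monotone fun q ↦ Θ q - M⁻¹ * q := by
    have hd : ∀ q, HasDerivAt (fun q ↦ Θ q - M⁻¹ * q) ((C q)⁻¹ - M⁻¹ * 1) q := fun q ↦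
      (dΘ q).sub ((hasDerivAt_id q).const_mul _)
    refine monotone_of_deriv_nonneg (fun q ↦ (hd q).differentiableAt) fun q ↦ ?_
    rw [(hd q).deriv, mul_one, sub_nonneg]
    exact inv_anti₀ (hpos q) (hCM q)
  have hMinv : 0 < M⁻¹ := inv_pos.2 hM
  have hsurj : Function.Surjective Θ := by
    refine hcont.surjective ?_ ?_
    · refine tendsto_atTop_mono' _ ?_ (tendsto_id.const_mul_atTop hMinv)
      filter_upwards [eventually_ge_atTop 0] with q hq
      have := hlin hq
      simp only [hΘ0, mul_zero, sub_zero, id] at this ⊢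
      linarith
    · refine tendsto_atBot_mono' _ ?_ (tendsto_id.const_mul_atBot hMinv)
      filter_upwards [eventually_le_atBot 0] with q hq
      have := hlin hq
      simp only [hΘ0, mul_zero, sub_zero, id] at this ⊢
      linarith
  let e := hmono.orderIsoOfSurjective Θ hsurj
  have he : ∀ q, e q = Θ q := fun _ ↦ rfl
  have hd : ∀ s, HasDerivAt e.symm (C (e.symm s)) s := fun s ↦ by
    have := HasDerivAt.of_local_left_inverse (f := Θ) (g := e.symm) (a := s)
      e.symm.continuous.continuousAt (dΘ (e.symm s)) (inv_ne_zero (hpos _).ne')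
      (Eventually.of_forall fun y ↦ e.apply_symm_apply y)
    simpa using this
  have h0 : e.symm 0 = 0 := by
    rw [e.symm_apply_eq, he, hΘ0]
  refine ⟨e.symm, h0, hd, fun s hs ↦ ?_⟩
  have hm : Monotone fun s ↦ e.symm s - κ * s := by
    have hd' : ∀ s, HasDerivAt (fun s ↦ e.symm s - κ * s) (C (e.symm s) - κ * 1) s := fun s ↦
      (hd s).sub ((hasDerivAt_id s).const_mul _)
    refine monotone_of_deriv_nonneg (fun s ↦ (hd' s).differentiableAt) fun s ↦ ?_
    rw [(hd' s).deriv, mul_one, sub_nonneg]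
    exact hκC _
  have := hm hs
  simp only [h0, mul_zero, sub_zero] at this
  linarith

/-- The equation `t' = -(t - t₀) c(t)` with `c > 0` has global forward solutions, which decay to
`t₀`. -/
theorem exists_decaying_solution {c : ℝ → ℝ} {t₀ δ t₁ : ℝ} (hc : ContinuousOn c (Ioo (t₀ - δ) (t₀ + δ)))
    (hc0 : ∀ t ∈ Ioo (t₀ - δ) (t₀ + δ), 0 < c t) (ht₁ : t₁ ∈ Ioo (t₀ - δ) (t₀ + δ)) :
    ∃ γ : ℝ → ℝ, γ 0 = t₁ ∧ (∀ s, 0 ≤ s → HasDerivAt γ (-(γ s - t₀) * c (γ s)) s) ∧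
      (∀ s, 0 ≤ s → γ s ∈ Ioo (t₀ - δ) (t₀ + δ)) ∧ Tendsto γ atTop (𝓝 t₀) := by
  set d := t₁ - t₀ with hd
  have hmem : ∀ θ ∈ Icc (0:ℝ) 1, t₀ + d * θ ∈ Ioo (t₀ - δ) (t₀ + δ) := fun θ hθ ↦ by
    have : |d * θ| < δ := by
      rw [abs_mul, abs_of_nonneg hθ.1]
      refine lt_of_le_of_lt (mul_le_of_le_one_right (abs_nonneg _) hθ.2) ?_
      rw [abs_lt]
      constructor <;> linarith [ht₁.1, ht₁.2]
    rw [abs_lt] at this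
    constructor <;> linarith [this.1, this.2]
  have hcθ : ContinuousOn (fun θ ↦ c (t₀ + d * θ)) (Icc 0 1) :=
    hc.comp (by fun_prop) hmem
  have hexp : ∀ q : ℝ, Real.exp (-max q 0) ∈ Icc (0:ℝ) 1 := fun q ↦
    ⟨(Real.exp_pos _).le, Real.exp_le_one_iff.2 (by simp)⟩
  obtain ⟨θ₁, hθ₁, hmin⟩ := isCompact_Icc.exists_isMinOn (nonempty_Icc.2 zero_le_one) hcθ
  obtain ⟨θ₂, hθ₂, hmax⟩ := isCompact_Icc.exists_isMaxOn (nonempty_Icc.2 zero_le_one) hcθ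
  have hκ : 0 < c (t₀ + d * θ₁) := hc0 _ (hmem _ hθ₁)
  obtain ⟨q, hq0, hq, hqs⟩ := exists_solution_of_pos
    (C := fun q ↦ c (t₀ + d * Real.exp (-max q 0))) (κ := c (t₀ + d * θ₁))
    (M := c (t₀ + d * θ₂))
    (hcθ.comp_continuous (by fun_prop) hexp) hκ (fun q ↦ hmin (hexp q)) (fun q ↦ hmax (hexp q))
  have hq_nonneg : ∀ s, 0 ≤ s → 0 ≤ q s := fun s hs ↦ (mul_nonneg hκ.le hs).trans (hqs s hs)
  refine ⟨fun s ↦ t₀ + d * Real.exp (-q s), by simp [hq0, hd], fun s hs ↦ ?_, fun s hs ↦ ?_, ?_⟩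
  · have h1 := (((hq s).neg.exp).const_mul d).const_add t₀
    convert! h1 using 1
    simp only [max_eq_left (hq_nonneg s hs), Pi.neg_apply]
    ring
  · refine hmem _ ?_
    have := hexp (q s)
    rwa [max_eq_left (hq_nonneg s hs)] at this
  · have h1 : Tendsto q atTop atTop := by
      refine tendsto_atTop_mono' _ ?_ (tendsto_id.const_mul_atTop hκ)
      filter_upwards [eventually_ge_atTop 0] with s hs using hqs s hs
    have h2 := ((Real.tendsto_exp_neg_atTop_nhds_zero.comp h1).const_mul d).const_add t₀
    simpa [Function.comp_def] using h2

/-- An invariant curve along which trajectories tend to the equilibrium, and from which all other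
trajectories move away, is the local stable manifold. -/
theorem localStableManifold_eq_graph {w X c : ℝ → ℝ} {F : ℝ × ℝ → ℝ} {x₀ t₀ δ ε : ℝ} (hδ : 0 < δ)
    (hε : 0 < ε) (hX : ∀ t ∈ Ioo (t₀ - δ) (t₀ + δ), DifferentiableAt ℝ X t) (hX0 : X t₀ = x₀)
    (hc : ContinuousOn c (Ioo (t₀ - δ) (t₀ + δ))) (hc0 : ∀ t ∈ Ioo (t₀ - δ) (t₀ + δ), 0 < c t)
    (hXc : ∀ t ∈ Ioo (t₀ - δ) (t₀ + δ), 1 + t * deriv w (X t) = -(t - t₀) * c t)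
    (hXF : ∀ t ∈ Ioo (t₀ - δ) (t₀ + δ), deriv X t * (1 + t * deriv w (X t)) = F (t, X t))
    (hrep : ∀ t ∈ Ioo (t₀ - δ) (t₀ + δ), ∀ x, |x - X t| < ε →
      0 ≤ (x - X t) * (F (t, x) - deriv X t * (1 + t * deriv w x))) :
    localStableManifold (planarField w F) (t₀, x₀)
        {p | p.1 ∈ Ioo (t₀ - δ) (t₀ + δ) ∧ |p.2 - X p.1| < ε}
      = {p | p ∈ {p : ℝ × ℝ | p.1 ∈ Ioo (t₀ - δ) (t₀ + δ) ∧ |p.2 - X p.1| < ε} ∧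
          p.2 = X p.1} := by
  have ht₀ : t₀ ∈ Ioo (t₀ - δ) (t₀ + δ) := ⟨by linarith, by linarith⟩
  ext p
  constructor
  · rintro ⟨γ, hγ0, hγ, hγU, hγlim⟩
    have hpU := hγU 0 le_rfl
    rw [hγ0] at hpU
    refine ⟨hpU, ?_⟩
    -- the squared distance to the curve does not decrease along a trajectory
    have h1 : ∀ s, 0 ≤ s → HasDerivWithinAt (fun s ↦ (γ s).1)
        (1 + (γ s).1 * deriv w (γ s).2) (Ici 0) s := fun s hs ↦
      (hasFDerivAt_fst (𝕜 := ℝ) (E := ℝ) (F := ℝ) (p := γ s)).comp_hasDerivWithinAt s (hγ s hs)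
    have h2 : ∀ s, 0 ≤ s → HasDerivWithinAt (fun s ↦ (γ s).2) (F (γ s)) (Ici 0) s := fun s hs ↦
      (hasFDerivAt_snd (𝕜 := ℝ) (E := ℝ) (F := ℝ) (p := γ s)).comp_hasDerivWithinAt s (hγ s hs)
    have h3 : ∀ s, 0 ≤ s → HasDerivWithinAt (fun s ↦ ((γ s).2 - X (γ s).1) ^ 2)
        (2 * ((γ s).2 - X (γ s).1) *
          (F (γ s) - deriv X (γ s).1 * (1 + (γ s).1 * deriv w (γ s).2))) (Ici 0) s := fun s hs ↦ by
      have d := (hX _ (hγU s hs).1).hasDerivAt.comp_hasDerivWithinAt s (h1 s hs)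
      have := ((h2 s hs).sub d).pow 2
      convert! this using 1
      simp
    have hmono : MonotoneOn (fun s ↦ ((γ s).2 - X (γ s).1) ^ 2) (Ici 0) := by
      refine monotoneOn_of_deriv_nonneg (convex_Ici 0)
        (fun s hs ↦ (h3 s hs).continuousWithinAt) (fun s hs ↦ ?_) fun s hs ↦ ?_
      · rw [interior_Ici] at hs ⊢
        exact ((h3 s hs.le).mono Ioi_subset_Ici_self).differentiableWithinAt
      · rw [interior_Ici] at hs
        rw [((h3 s hs.le).hasDerivAt (Ici_mem_nhds hs)).deriv, mul_assoc]
        exact mul_nonneg zero_le_two (hrep _ (hγU s hs.le).1 _ (hγU s hs.le).2)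
    have hlim : Tendsto (fun s ↦ ((γ s).2 - X (γ s).1) ^ 2) atTop (𝓝 0) := by
      have l1 : Tendsto (fun s ↦ (γ s).1) atTop (𝓝 t₀) :=
        (continuous_fst.tendsto _).comp hγlim
      have l2 : Tendsto (fun s ↦ (γ s).2) atTop (𝓝 x₀) :=
        (continuous_snd.tendsto _).comp hγlim
      have l3 : Tendsto (fun s ↦ X (γ s).1) atTop (𝓝 x₀) := by
        rw [← hX0]
        exact (hX t₀ ht₀).continuousAt.tendsto.comp l1
      simpa using (l2.sub l3).pow 2
    have hle : ((γ 0).2 - X (γ 0).1) ^ 2 ≤ 0 := by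
      refine ge_of_tendsto hlim ?_
      filter_upwards [eventually_ge_atTop 0] with s hs
      exact hmono (mem_Ici.2 le_rfl) hs hs
    rw [hγ0] at hle
    have := pow_eq_zero_iff (two_ne_zero) |>.1 (le_antisymm hle (sq_nonneg _))
    linarith
  · rintro ⟨hpU, hp⟩
    obtain ⟨τ, hτ0, hτ, hτI, hτlim⟩ := exists_decaying_solution hc hc0 hpU.1
    refine ⟨fun s ↦ (τ s, X (τ s)), ?_, ?_, ?_, ?_⟩
    · ext
      · exact hτ0
      · simp only [hτ0, hp]
    · intro s hs
      have d1 := hτ s hs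
      have d2 := HasDerivAt.comp (h₂ := X) s (hX _ (hτI s hs)).hasDerivAt d1
      refine (HasDerivAt.prodMk ?_ ?_).hasDerivWithinAt
      · rw [← hXc _ (hτI s hs)] at d1
        exact d1
      · rw [← hXc _ (hτI s hs), hXF _ (hτI s hs)] at d2
        exact d2
    · intro s hs
      exact ⟨hτI s hs, by simpa using hε⟩
    · have h1 : Tendsto (fun s ↦ X (τ s)) atTop (𝓝 x₀) := by
        rw [← hX0]
        exact (hX t₀ ht₀).continuousAt.tendsto.comp hτlim
      exact hτlim.prodMk_nhds h1

end PressurelessGas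

/-! ### Lagrangian coordinates for an absorbing point mass -/

namespace PressurelessGas

/-- The geometry of characteristics absorbed by a point mass. The velocity `w` decreases on
`[a, b]`, most steeply at `x₀`, where the characteristics focus at time `t₀`. At times
`t₀ ≤ t < T'` the characteristics that start in `[xl t, xr t]` have been absorbed, and the two
outermost of them are just reaching the point mass at `y t`. -/
structure IsAbsorbing (w : ℝ → ℝ) (a b x₀ t₀ T' : ℝ) (xl xr y : ℝ → ℝ) : Prop where
  lt_left : a < x₀
  lt_right : x₀ < b
  t₀_pos : 0 < t₀
  analytic : AnalyticOnNhd ℝ w (Icc a b)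
  focus : 1 + t₀ * deriv w x₀ = 0
  deriv_neg : ∀ x ∈ Icc a b, deriv w x < 0
  anti : StrictAntiOn (deriv w) (Icc a x₀)
  mono : StrictMonoOn (deriv w) (Icc x₀ b)
  xl_start : xl t₀ = x₀
  xr_start : xr t₀ = x₀
  xl_cont : ContinuousOn xl (Ico t₀ T')
  xr_cont : ContinuousOn xr (Ico t₀ T')
  xl_gt : ∀ t ∈ Ico t₀ T', a < xl t
  xr_lt : ∀ t ∈ Ico t₀ T', xr t < b
  xl_slope : ∀ t ∈ Ioo t₀ T', 0 < 1 + t * deriv w (xl t)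
  xr_slope : ∀ t ∈ Ioo t₀ T', 0 < 1 + t * deriv w (xr t)
  xl_meet : ∀ t ∈ Ico t₀ T', xl t + t * w (xl t) = y t
  xr_meet : ∀ t ∈ Ico t₀ T', xr t + t * w (xr t) = y t
  xl_anti : StrictAntiOn xl (Ico t₀ T')
  xr_mono : StrictMonoOn xr (Ico t₀ T')

/-- The map from Lagrangian coordinates (time, starting point) to Eulerian coordinates (time,
position) of free particles. -/
def flow (w : ℝ → ℝ) (q : ℝ × ℝ) : ℝ × ℝ := (q.1, q.2 + q.1 * w q.2)

/-- The Lagrangian coordinates, at times before `T'`, of particles that are not yet absorbed. -/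
def freeRegion (a b t₀ T' : ℝ) (xl xr : ℝ → ℝ) : Set (ℝ × ℝ) :=
  {q | q.1 < T' ∧ q.2 ∈ Ioo a b ∧ (q.1 < t₀ ∨ q.2 < xl q.1 ∨ xr q.1 < q.2)}

/-- The derivative of `flow w` at `q`. -/
noncomputable def flowDeriv (w : ℝ → ℝ) (q : ℝ × ℝ) : (ℝ × ℝ) →L[ℝ] ℝ × ℝ :=
  (ContinuousLinearMap.fst ℝ ℝ ℝ).prod
    (w q.2 • ContinuousLinearMap.fst ℝ ℝ ℝ +
      (1 + q.1 * deriv w q.2) • ContinuousLinearMap.snd ℝ ℝ ℝ)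

theorem hasFDerivAt_flow {w : ℝ → ℝ} {q : ℝ × ℝ} (hw : DifferentiableAt ℝ w q.2) :
    HasFDerivAt (flow w) (flowDeriv w q) q := by
  have h1 := hw.hasDerivAt.comp_hasFDerivAt q (hasFDerivAt_snd (𝕜 := ℝ) (p := q))
  have h2 := (hasFDerivAt_fst (𝕜 := ℝ) (p := q)).prodMk ((hasFDerivAt_snd (𝕜 := ℝ) (p := q)).add
    ((hasFDerivAt_fst (𝕜 := ℝ) (p := q)).mul h1))
  refine HasFDerivAt.congr_fderiv (f' := _) h2 ?_
  refine ContinuousLinearMap.ext fun v ↦ ?_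
  ext
  · simp [flowDeriv]
  · simp [flowDeriv]
    ring

theorem det_flowDeriv (w : ℝ → ℝ) (q : ℝ × ℝ) : (flowDeriv w q).det = 1 + q.1 * deriv w q.2 := by
  rw [ContinuousLinearMap.det, ← LinearMap.det_toMatrix (Module.Basis.finTwoProd ℝ),
    Matrix.det_fin_two]
  simp [LinearMap.toMatrix_apply, flowDeriv]

namespace IsAbsorbing

variable {w : ℝ → ℝ} {a b x₀ t₀ T' : ℝ} {xl xr y : ℝ → ℝ}

theorem xl_le (h : IsAbsorbing w a b x₀ t₀ T' xl xr y) {t : ℝ} (ht : t ∈ Ico t₀ T') : xl t ≤ x₀ := by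
  rw [← h.xl_start]
  exact h.xl_anti.antitoneOn ⟨le_rfl, ht.1.trans_lt ht.2⟩ ht ht.1

theorem le_xr (h : IsAbsorbing w a b x₀ t₀ T' xl xr y) {t : ℝ} (ht : t ∈ Ico t₀ T') : x₀ ≤ xr t := by
  rw [← h.xr_start]
  exact h.xr_mono.monotoneOn ⟨le_rfl, ht.1.trans_lt ht.2⟩ ht ht.1

theorem deriv_gt (h : IsAbsorbing w a b x₀ t₀ T' xl xr y) {x : ℝ} (hx : x ∈ Icc a b)
    (hne : x ≠ x₀) : deriv w x₀ < deriv w x := by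
  rcases lt_or_gt_of_ne hne with h1 | h1
  · exact h.anti ⟨hx.1, h1.le⟩ ⟨h.lt_left.le, le_rfl⟩ h1
  · exact h.mono ⟨le_rfl, h.lt_right.le⟩ ⟨h1.le, hx.2⟩ h1

theorem slope_pos (h : IsAbsorbing w a b x₀ t₀ T' xl xr y) {q : ℝ × ℝ}
    (hq : q ∈ freeRegion a b t₀ T' xl xr) : 0 < 1 + q.1 * deriv w q.2 := by
  obtain ⟨t, x⟩ := q
  obtain ⟨htT, hx, hfree⟩ := hq
  simp only at *
  have hxI : x ∈ Icc a b := Ioo_subset_Icc_self hx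
  have hge : deriv w x₀ ≤ deriv w x := by
    rcases eq_or_ne x x₀ with rfl | hne
    · exact le_rfl
    · exact (h.deriv_gt hxI hne).le
  rcases lt_or_ge t t₀ with h1 | h1
  · rcases le_or_gt t 0 with h2 | h2
    · have := mul_nonneg_of_nonpos_of_nonpos h2 (h.deriv_neg x hxI).le
      linarith
    · have h3 : t₀ * deriv w x₀ < t * deriv w x₀ :=
        mul_lt_mul_of_neg_right h1 (h.deriv_neg _ ⟨h.lt_left.le, h.lt_right.le⟩)
      have h4 := mul_le_mul_of_nonneg_left hge h2.le
      linarith [h.focus]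
  · have ht : t ∈ Ico t₀ T' := ⟨h1, htT⟩
    have htpos : 0 < t := h.t₀_pos.trans_le h1
    have key : ∀ z, deriv w z < deriv w x → 0 ≤ 1 + t * deriv w z → 0 < 1 + t * deriv w x :=
      fun z hz hz0 ↦ by
        have := mul_lt_mul_of_pos_left hz htpos
        linarith
    rcases hfree with h2 | h2 | h2
    · exact absurd h2 (not_lt.2 h1)
    · refine key (xl t) (h.anti ⟨hx.1.le, h2.le.trans (h.xl_le ht)⟩
        ⟨(h.xl_gt t ht).le, h.xl_le ht⟩ h2) ?_
      rcases h1.eq_or_lt with rfl | h3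
      · rw [h.xl_start, h.focus]
      · exact (h.xl_slope t ⟨h3, htT⟩).le
    · refine key (xr t) (h.mono ⟨h.le_xr ht, (h.xr_lt t ht).le⟩
        ⟨(h.le_xr ht).trans h2.le, hx.2.le⟩ h2) ?_
      rcases h1.eq_or_lt with rfl | h3
      · rw [h.xr_start, h.focus]
      · exact (h.xr_slope t ⟨h3, htT⟩).le

theorem isOpen_freeRegion (h : IsAbsorbing w a b x₀ t₀ T' xl xr y) :
    IsOpen (freeRegion a b t₀ T' xl xr) := by
  rw [isOpen_iff_mem_nhds]
  rintro ⟨t, x⟩ ⟨htT, hx, hfree⟩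
  simp only at htT hx hfree
  have e1 : ∀ᶠ q : ℝ × ℝ in 𝓝 (t, x), q.1 < T' :=
    continuousAt_fst.eventually (Iio_mem_nhds htT)
  have e2 : ∀ᶠ q : ℝ × ℝ in 𝓝 (t, x), q.2 ∈ Ioo a b :=
    continuousAt_snd.eventually (isOpen_Ioo.mem_nhds hx)
  rcases lt_or_ge t t₀ with h1 | h1
  · have e3 : ∀ᶠ q : ℝ × ℝ in 𝓝 (t, x), q.1 < t₀ := continuousAt_fst.eventually (Iio_mem_nhds h1)
    filter_upwards [e1, e2, e3] with q q1 q2 q3 using ⟨q1, q2, Or.inl q3⟩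
  have ht : t ∈ Ico t₀ T' := ⟨h1, htT⟩
  rcases hfree with h2 | h2 | h2
  · exact absurd h2 (not_lt.2 h1)
  · obtain ⟨m, hm1, hm2⟩ := exists_between h2
    have e3 : ∀ᶠ s in 𝓝 t, s ∈ Ico t₀ T' → m < xl s :=
      eventually_nhdsWithin_iff.1 ((h.xl_cont t ht).eventually (Ioi_mem_nhds hm2))
    have e4 : ∀ᶠ q : ℝ × ℝ in 𝓝 (t, x), q.1 ∈ Ico t₀ T' → m < xl q.1 :=
      (continuous_fst.tendsto (t, x)).eventually e3
    have e5 : ∀ᶠ q : ℝ × ℝ in 𝓝 (t, x), q.2 < m := continuousAt_snd.eventually (Iio_mem_nhds hm1)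
    filter_upwards [e1, e2, e4, e5] with q q1 q2 q4 q5
    refine ⟨q1, q2, (lt_or_ge q.1 t₀).imp id fun h3 ↦ Or.inl (q5.trans (q4 ⟨h3, q1⟩))⟩
  · obtain ⟨m, hm1, hm2⟩ := exists_between h2
    have e3 : ∀ᶠ s in 𝓝 t, s ∈ Ico t₀ T' → xr s < m :=
      eventually_nhdsWithin_iff.1 ((h.xr_cont t ht).eventually (Iio_mem_nhds hm1))
    have e4 : ∀ᶠ q : ℝ × ℝ in 𝓝 (t, x), q.1 ∈ Ico t₀ T' → xr q.1 < m :=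
      (continuous_fst.tendsto (t, x)).eventually e3
    have e5 : ∀ᶠ q : ℝ × ℝ in 𝓝 (t, x), m < q.2 := continuousAt_snd.eventually (Ioi_mem_nhds hm2)
    filter_upwards [e1, e2, e4, e5] with q q1 q2 q4 q5
    refine ⟨q1, q2, (lt_or_ge q.1 t₀).imp id fun h3 ↦ Or.inr ((q4 ⟨h3, q1⟩).trans q5)⟩

theorem continuousOn_position (h : IsAbsorbing w a b x₀ t₀ T' xl xr y) (t : ℝ) :
    ContinuousOn (fun x ↦ x + t * w x) (Icc a b) := by
  have : ContinuousOn w (Icc a b) := h.analytic.continuousOn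
  fun_prop

theorem hasDerivAt_position (h : IsAbsorbing w a b x₀ t₀ T' xl xr y) (t : ℝ) {x : ℝ}
    (hx : x ∈ Icc a b) : HasDerivAt (fun x ↦ x + t * w x) (1 + t * deriv w x) x :=
  (hasDerivAt_id x).add ((h.analytic x hx).differentiableAt.hasDerivAt.const_mul t)

theorem strictMonoOn_position (h : IsAbsorbing w a b x₀ t₀ T' xl xr y) {t c d : ℝ} (hc : a ≤ c)
    (hd : d ≤ b) (hfree : ∀ x ∈ Ioo c d, (t, x) ∈ freeRegion a b t₀ T' xl xr) :
    StrictMonoOn (fun x ↦ x + t * w x) (Icc c d) := by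
  refine strictMonoOn_of_deriv_pos (convex_Icc c d)
    ((h.continuousOn_position t).mono (Icc_subset_Icc hc hd)) fun x hx ↦ ?_
  rw [interior_Icc] at hx
  rw [(h.hasDerivAt_position t ⟨hc.trans hx.1.le, hx.2.le.trans hd⟩).deriv]
  exact h.slope_pos (hfree x hx)

theorem strictMonoOn_before (h : IsAbsorbing w a b x₀ t₀ T' xl xr y) (hT : t₀ < T') {t : ℝ}
    (ht : t < t₀) : StrictMonoOn (fun x ↦ x + t * w x) (Icc a b) :=
  h.strictMonoOn_position le_rfl le_rfl fun _ hx ↦ ⟨ht.trans hT, hx, Or.inl ht⟩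

theorem strictMonoOn_left (h : IsAbsorbing w a b x₀ t₀ T' xl xr y) {t : ℝ} (ht : t ∈ Ico t₀ T') :
    StrictMonoOn (fun x ↦ x + t * w x) (Icc a (xl t)) :=
  h.strictMonoOn_position le_rfl ((h.xl_le ht).trans h.lt_right.le) fun _ hx ↦
    ⟨ht.2, ⟨hx.1, hx.2.trans_le ((h.xl_le ht).trans h.lt_right.le)⟩, Or.inr (Or.inl hx.2)⟩

theorem strictMonoOn_right (h : IsAbsorbing w a b x₀ t₀ T' xl xr y) {t : ℝ} (ht : t ∈ Ico t₀ T') :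
    StrictMonoOn (fun x ↦ x + t * w x) (Icc (xr t) b) :=
  h.strictMonoOn_position (h.lt_left.le.trans (h.le_xr ht)) le_rfl fun _ hx ↦
    ⟨ht.2, ⟨(h.lt_left.trans_le (h.le_xr ht)).trans hx.1, hx.2⟩, Or.inr (Or.inr hx.1)⟩

theorem position_lt (h : IsAbsorbing w a b x₀ t₀ T' xl xr y) {t x : ℝ} (ht : t ∈ Ico t₀ T')
    (hx : a ≤ x) (hxl : x < xl t) : x + t * w x < y t := by
  rw [← h.xl_meet t ht]
  exact h.strictMonoOn_left ht ⟨hx, hxl.le⟩ ⟨(h.xl_gt t ht).le, le_rfl⟩ hxl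

theorem lt_position (h : IsAbsorbing w a b x₀ t₀ T' xl xr y) {t x : ℝ} (ht : t ∈ Ico t₀ T')
    (hx : x ≤ b) (hxr : xr t < x) : y t < x + t * w x := by
  rw [← h.xr_meet t ht]
  exact h.strictMonoOn_right ht ⟨le_rfl, (h.xr_lt t ht).le⟩ ⟨hxr.le, hx⟩ hxr

theorem injOn_flow (h : IsAbsorbing w a b x₀ t₀ T' xl xr y) (hT : t₀ < T') :
    InjOn (flow w) (freeRegion a b t₀ T' xl xr) := by
  rintro ⟨t, x⟩ ⟨htT, hx, hf⟩ ⟨s, z⟩ ⟨-, hz, hf'⟩ heq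
  simp only [flow, Prod.mk.injEq] at htT hx hf hz hf' heq ⊢
  obtain ⟨rfl, heq⟩ := heq
  refine ⟨rfl, ?_⟩
  rcases lt_or_ge t t₀ with h1 | h1
  · exact (h.strictMonoOn_before hT h1).injOn (Ioo_subset_Icc_self hx) (Ioo_subset_Icc_self hz) heq
  have ht : t ∈ Ico t₀ T' := ⟨h1, htT⟩
  replace hf := hf.resolve_left (not_lt.2 h1)
  replace hf' := hf'.resolve_left (not_lt.2 h1)
  rcases hf with h2 | h2 <;> rcases hf' with h3 | h3
  · exact (h.strictMonoOn_left ht).injOn ⟨hx.1.le, h2.le⟩ ⟨hz.1.le, h3.le⟩ heq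
  · have := h.position_lt ht hx.1.le h2
    have := h.lt_position ht hz.2.le h3
    linarith
  · have := h.lt_position ht hx.2.le h2
    have := h.position_lt ht hz.1.le h3
    linarith
  · exact (h.strictMonoOn_right ht).injOn ⟨h2.le, hx.2.le⟩ ⟨h3.le, hz.2.le⟩ heq

theorem y_mem (h : IsAbsorbing w a b x₀ t₀ T' xl xr y) {t : ℝ} (ht : t ∈ Ico t₀ T') :
    y t ∈ Ioo (a + t * w a) (b + t * w b) :=
  ⟨h.position_lt ht le_rfl (h.xl_gt t ht), h.lt_position ht le_rfl (h.xr_lt t ht)⟩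

theorem flow_mem (h : IsAbsorbing w a b x₀ t₀ T' xl xr y) (hT : t₀ < T') {q : ℝ × ℝ}
    (hq : q ∈ freeRegion a b t₀ T' xl xr) :
    flow w q ∈ tube w a b (Iio T') \ trajectory y (Ico t₀ T') := by
  obtain ⟨t, x⟩ := q
  obtain ⟨htT, hx, hf⟩ := hq
  simp only [flow, tube, trajectory, Set.mem_sdiff, mem_ofPred_eq, not_and] at htT hx hf ⊢
  have hab : a ≤ b := (hx.1.trans hx.2).le
  rcases lt_or_ge t t₀ with h1 | h1
  · have hm := h.strictMonoOn_before hT h1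
    exact ⟨⟨htT, hm ⟨le_rfl, hab⟩ (Ioo_subset_Icc_self hx) hx.1,
      hm (Ioo_subset_Icc_self hx) ⟨hab, le_rfl⟩ hx.2⟩, fun h2 ↦ absurd h2.1 (not_le.2 h1)⟩
  have ht : t ∈ Ico t₀ T' := ⟨h1, htT⟩
  have hy := h.y_mem ht
  rcases hf.resolve_left (not_lt.2 h1) with h2 | h2
  · have h3 := h.position_lt ht hx.1.le h2
    exact ⟨⟨htT, h.strictMonoOn_left ht ⟨le_rfl, (h.xl_gt t ht).le⟩ ⟨hx.1.le, h2.le⟩ hx.1,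
      h3.trans hy.2⟩, fun _ ↦ h3.ne⟩
  · have h3 := h.lt_position ht hx.2.le h2
    exact ⟨⟨htT, hy.1.trans h3,
      h.strictMonoOn_right ht ⟨h2.le, hx.2.le⟩ ⟨(h.xr_lt t ht).le, le_rfl⟩ hx.2⟩, fun _ ↦ h3.ne'⟩

theorem exists_flow_eq (h : IsAbsorbing w a b x₀ t₀ T' xl xr y) {p : ℝ × ℝ}
    (hp : p ∈ tube w a b (Iio T') \ trajectory y (Ico t₀ T')) :
    ∃ q ∈ freeRegion a b t₀ T' xl xr, flow w q = p := by
  obtain ⟨t, z⟩ := p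
  obtain ⟨⟨htT, hz⟩, hy⟩ := hp
  simp only [trajectory, mem_ofPred_eq, not_and, mem_Iio] at htT hz hy
  have hab : a ≤ b := (h.lt_left.trans h.lt_right).le
  rcases lt_or_ge t t₀ with h1 | h1
  · obtain ⟨x, hx, hxz⟩ := intermediate_value_Ioo hab (h.continuousOn_position t) hz
    exact ⟨(t, x), ⟨htT, hx, Or.inl h1⟩, Prod.ext rfl hxz⟩
  have ht : t ∈ Ico t₀ T' := ⟨h1, htT⟩
  have hlb : xl t ≤ b := (h.xl_le ht).trans h.lt_right.le
  have har : a ≤ xr t := h.lt_left.le.trans (h.le_xr ht)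
  rcases lt_or_gt_of_ne (hy ht) with h2 | h2
  · obtain ⟨x, hx, hxz⟩ := intermediate_value_Ioo (h.xl_gt t ht).le
      ((h.continuousOn_position t).mono (Icc_subset_Icc_right hlb))
      (show z ∈ Ioo _ _ from ⟨hz.1, by rw [h.xl_meet t ht]; exact h2⟩)
    exact ⟨(t, x), ⟨htT, ⟨hx.1, hx.2.trans_le hlb⟩, Or.inr (Or.inl hx.2)⟩, Prod.ext rfl hxz⟩
  · obtain ⟨x, hx, hxz⟩ := intermediate_value_Ioo (h.xr_lt t ht).le
      ((h.continuousOn_position t).mono (Icc_subset_Icc_left har))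
      (show z ∈ Ioo _ _ from ⟨by rw [h.xr_meet t ht]; exact h2, hz.2⟩)
    exact ⟨(t, x), ⟨htT, ⟨har.trans_lt hx.1, hx.2⟩, Or.inr (Or.inr hx.1)⟩, Prod.ext rfl hxz⟩

end IsAbsorbing

/-- The map from Eulerian back to Lagrangian coordinates. Its value is arbitrary on the trajectory of
the point mass, which no free particle reaches. -/
noncomputable def label (w : ℝ → ℝ) (a b t₀ T' : ℝ) (xl xr : ℝ → ℝ) : ℝ × ℝ → ℝ × ℝ :=
  Function.invFunOn (flow w) (freeRegion a b t₀ T' xl xr)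

/-- The velocity of the gas off the point mass: particles keep their initial velocity. -/
noncomputable def gasVelocity (w : ℝ → ℝ) (a b t₀ T' : ℝ) (xl xr : ℝ → ℝ) (p : ℝ × ℝ) : ℝ :=
  w (label w a b t₀ T' xl xr p).2

/-- The density, off the point mass, of a quantity with initial density `κ` that is carried along by
the particles: `κ` divided by the Jacobian of the flow. -/
noncomputable def gasDensity (w κ : ℝ → ℝ) (a b t₀ T' : ℝ) (xl xr : ℝ → ℝ) (p : ℝ × ℝ) : ℝ :=
  κ (label w a b t₀ T' xl xr p).2 /
    (1 + (label w a b t₀ T' xl xr p).1 * deriv w (label w a b t₀ T' xl xr p).2)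

namespace IsAbsorbing

variable {w : ℝ → ℝ} {a b x₀ t₀ T' : ℝ} {xl xr y : ℝ → ℝ}

theorem label_flow (h : IsAbsorbing w a b x₀ t₀ T' xl xr y) (hT : t₀ < T') {q : ℝ × ℝ}
    (hq : q ∈ freeRegion a b t₀ T' xl xr) : label w a b t₀ T' xl xr (flow w q) = q :=
  (h.injOn_flow hT).leftInvOn_invFunOn hq

theorem analyticAt_label (h : IsAbsorbing w a b x₀ t₀ T' xl xr y) (hT : t₀ < T') {q : ℝ × ℝ}
    (hq : q ∈ freeRegion a b t₀ T' xl xr) : AnalyticAt ℝ (label w a b t₀ T' xl xr) (flow w q) := by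
  have hwq : AnalyticAt ℝ w q.2 := h.analytic _ (Ioo_subset_Icc_self hq.2.1)
  have hflow : AnalyticAt ℝ (flow w) q := analyticAt_fst.prod (analyticAt_snd.add
    (analyticAt_fst.mul (AnalyticAt.comp (g := w) (f := Prod.snd) hwq analyticAt_snd)))
  have hs := h.slope_pos hq
  have hs0 := hs.ne'
  let L : (ℝ × ℝ) ≃ₗ[ℝ] ℝ × ℝ :=
    { toFun := fun v ↦ (v.1, w q.2 * v.1 + (1 + q.1 * deriv w q.2) * v.2)
      map_add' := fun u v ↦ by ext <;> simp; ring
      map_smul' := fun c v ↦ by ext <;> simp; ring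
      invFun := fun v ↦ (v.1, (v.2 - w q.2 * v.1) / (1 + q.1 * deriv w q.2))
      left_inv := fun v ↦ by ext <;> simp; field_simp
      right_inv := fun v ↦ by ext <;> simp; field_simp; ring }
  have hd : HasFDerivAt (flow w) (L.toContinuousLinearEquiv : (ℝ × ℝ) →L[ℝ] ℝ × ℝ) q := by
    refine (hasFDerivAt_flow hwq.differentiableAt).congr_fderiv ?_
    refine ContinuousLinearMap.ext fun v ↦ ?_
    change _ = (v.1, w q.2 * v.1 + (1 + q.1 * deriv w q.2) * v.2)
    simp [flowDeriv]
  obtain ⟨g, hg, hg0, -, -, hgr⟩ := exists_analyticAt_localInverse hflow _ hd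
  refine hg.congr ?_
  have hmem : ∀ᶠ p in 𝓝 (flow w q), g p ∈ freeRegion a b t₀ T' xl xr :=
    hg.continuousAt.eventually_mem (h.isOpen_freeRegion.mem_nhds (by rwa [hg0]))
  filter_upwards [hgr, hmem] with p hp1 hp2
  rw [← h.label_flow hT hp2, hp1]

theorem analyticAt_gasVelocity (h : IsAbsorbing w a b x₀ t₀ T' xl xr y) (hT : t₀ < T') {q : ℝ × ℝ}
    (hq : q ∈ freeRegion a b t₀ T' xl xr) :
    AnalyticAt ℝ (gasVelocity w a b t₀ T' xl xr) (flow w q) := by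
  have h1 := h.analyticAt_label hT hq
  refine AnalyticAt.comp (g := w) (f := fun p ↦ (label w a b t₀ T' xl xr p).2) ?_
    (analyticAt_snd.comp h1)
  rw [h.label_flow hT hq]
  exact h.analytic _ (Ioo_subset_Icc_self hq.2.1)

theorem analyticAt_gasDensity (h : IsAbsorbing w a b x₀ t₀ T' xl xr y) (hT : t₀ < T') {κ : ℝ → ℝ}
    (hκ : AnalyticOnNhd ℝ κ (Icc a b)) {q : ℝ × ℝ} (hq : q ∈ freeRegion a b t₀ T' xl xr) :
    AnalyticAt ℝ (gasDensity w κ a b t₀ T' xl xr) (flow w q) := by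
  have h1 := h.analyticAt_label hT hq
  have h2 : AnalyticAt ℝ (fun p ↦ (label w a b t₀ T' xl xr p).2) (flow w q) :=
    analyticAt_snd.comp h1
  have hI := Ioo_subset_Icc_self hq.2.1
  refine AnalyticAt.div ?_ (analyticAt_const.add (AnalyticAt.mul (analyticAt_fst.comp h1) ?_)) ?_
  · refine AnalyticAt.comp (g := κ) ?_ h2
    rw [h.label_flow hT hq]
    exact hκ _ hI
  · refine AnalyticAt.comp (g := deriv w) ?_ h2
    rw [h.label_flow hT hq]
    exact (h.analytic _ hI).deriv
  · rw [h.label_flow hT hq]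
    exact (h.slope_pos hq).ne'

/-- On approach to the point mass from the left, the starting points of the particles converge to
`xl t`; so the velocity of the gas has the one-sided limit `w (xl t)`. -/
theorem tendsto_label_left (h : IsAbsorbing w a b x₀ t₀ T' xl xr y) (hT : t₀ < T') {t : ℝ}
    (ht : t ∈ Ico t₀ T') :
    Tendsto (fun x ↦ (label w a b t₀ T' xl xr (t, x)).2) (𝓝[<] (y t)) (𝓝 (xl t)) := by
  have key : ∀ m ∈ Ioo a (xl t), ∀ x ∈ Ioo (m + t * w m) (y t),
      (label w a b t₀ T' xl xr (t, x)).2 ∈ Ioo m (xl t) := by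
    intro m hm x hx
    have hma : a + t * w a < m + t * w m :=
      h.strictMonoOn_left ht ⟨le_rfl, (h.xl_gt t ht).le⟩ ⟨hm.1.le, hm.2.le⟩ hm.1
    obtain ⟨⟨s, z⟩, hq, hqx⟩ := h.exists_flow_eq (p := (t, x))
      ⟨⟨ht.2, hma.trans hx.1, hx.2.trans (h.y_mem ht).2⟩, fun h1 ↦ hx.2.ne h1.2⟩
    rw [← hqx, h.label_flow hT hq]
    simp only [flow, Prod.mk.injEq] at hqx
    obtain ⟨rfl, hzx⟩ := hqx
    have hzl : z < xl s := by
      rcases hq.2.2.resolve_left (not_lt.2 ht.1) with h2 | h2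
      · exact h2
      · have := h.lt_position ht hq.2.1.2.le h2
        simp only at this
        linarith [hx.2]
    refine ⟨?_, hzl⟩
    refine ((h.strictMonoOn_left ht).lt_iff_lt ⟨hm.1.le, hm.2.le⟩ ⟨hq.2.1.1.le, hzl.le⟩).1 ?_
    linarith [hx.1]
  have ev : ∀ m ∈ Ioo a (xl t), ∀ᶠ x in 𝓝[<] (y t),
      (label w a b t₀ T' xl xr (t, x)).2 ∈ Ioo m (xl t) := fun m hm ↦ by
    filter_upwards [Ioo_mem_nhdsLT (h.position_lt ht hm.1.le hm.2)] with x hx using key m hm x hx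
  rw [tendsto_order]
  constructor
  · intro c hc
    obtain ⟨m, hm1, hm2⟩ := exists_between (max_lt hc (h.xl_gt t ht))
    filter_upwards [ev m ⟨(le_max_right _ _).trans_lt hm1, hm2⟩] with x hx
    exact ((le_max_left _ _).trans_lt hm1).trans hx.1
  · intro c hc
    obtain ⟨m, hm1, hm2⟩ := exists_between (h.xl_gt t ht)
    filter_upwards [ev m ⟨hm1, hm2⟩] with x hx using hx.2.trans hc

theorem tendsto_label_right (h : IsAbsorbing w a b x₀ t₀ T' xl xr y) (hT : t₀ < T') {t : ℝ}
    (ht : t ∈ Ico t₀ T') :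
    Tendsto (fun x ↦ (label w a b t₀ T' xl xr (t, x)).2) (𝓝[>] (y t)) (𝓝 (xr t)) := by
  have key : ∀ m ∈ Ioo (xr t) b, ∀ x ∈ Ioo (y t) (m + t * w m),
      (label w a b t₀ T' xl xr (t, x)).2 ∈ Ioo (xr t) m := by
    intro m hm x hx
    have hmb : m + t * w m < b + t * w b :=
      h.strictMonoOn_right ht ⟨hm.1.le, hm.2.le⟩ ⟨(h.xr_lt t ht).le, le_rfl⟩ hm.2
    obtain ⟨⟨s, z⟩, hq, hqx⟩ := h.exists_flow_eq (p := (t, x))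
      ⟨⟨ht.2, (h.y_mem ht).1.trans hx.1, hx.2.trans hmb⟩, fun h1 ↦ hx.1.ne' h1.2⟩
    rw [← hqx, h.label_flow hT hq]
    simp only [flow, Prod.mk.injEq] at hqx
    obtain ⟨rfl, hzx⟩ := hqx
    have hzr : xr s < z := by
      rcases hq.2.2.resolve_left (not_lt.2 ht.1) with h2 | h2
      · have := h.position_lt ht hq.2.1.1.le h2
        simp only at this
        linarith [hx.1]
      · exact h2
    refine ⟨hzr, ?_⟩
    refine ((h.strictMonoOn_right ht).lt_iff_lt ⟨hzr.le, hq.2.1.2.le⟩ ⟨hm.1.le, hm.2.le⟩).1 ?_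
    linarith [hx.2]
  have ev : ∀ m ∈ Ioo (xr t) b, ∀ᶠ x in 𝓝[>] (y t),
      (label w a b t₀ T' xl xr (t, x)).2 ∈ Ioo (xr t) m := fun m hm ↦ by
    filter_upwards [Ioo_mem_nhdsGT (h.lt_position ht hm.2.le hm.1)] with x hx using key m hm x hx
  rw [tendsto_order]
  constructor
  · intro c hc
    obtain ⟨m, hm1, hm2⟩ := exists_between (h.xr_lt t ht)
    filter_upwards [ev m ⟨hm1, hm2⟩] with x hx using hc.trans hx.1
  · intro c hc
    obtain ⟨m, hm1, hm2⟩ := exists_between (lt_min hc (h.xr_lt t ht))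
    filter_upwards [ev m ⟨hm1, hm2.trans_le (min_le_right _ _)⟩] with x hx
    exact hx.2.trans (hm2.trans_le (min_le_left _ _))

end IsAbsorbing

end PressurelessGas

/-! ### Conservation laws -/

namespace PressurelessGas

theorem isOpen_tube (w : ℝ → ℝ) (a b : ℝ) {I : Set ℝ} (hI : IsOpen I) : IsOpen (tube w a b I) := by
  have h1 : IsOpen {p : ℝ × ℝ | a + p.1 * w a < p.2} := isOpen_lt (by fun_prop) (by fun_prop)
  have h2 : IsOpen {p : ℝ × ℝ | p.2 < b + p.1 * w b} := isOpen_lt (by fun_prop) (by fun_prop)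
  exact (hI.preimage continuous_fst).inter (h1.inter h2)

namespace IsAbsorbing

variable {w : ℝ → ℝ} {a b x₀ t₀ T' T : ℝ} {xl xr y : ℝ → ℝ}

theorem image_flow (h : IsAbsorbing w a b x₀ t₀ T' xl xr y) (hT : t₀ < T') (hTT : T ≤ T') :
    flow w '' (freeRegion a b t₀ T' xl xr ∩ Ioo 0 T ×ˢ Ioo a b) =
      tube w a b (Ioo 0 T) \ trajectory y (Ico t₀ T') := by
  ext p
  constructor
  · rintro ⟨q, ⟨hq, hqT, -⟩, rfl⟩
    have := h.flow_mem hT hq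
    exact ⟨⟨hqT, this.1.2⟩, this.2⟩
  · rintro ⟨hp, hpt⟩
    obtain ⟨q, hq, rfl⟩ := h.exists_flow_eq ⟨⟨hp.1.2.trans_le hTT, hp.2⟩, hpt⟩
    exact ⟨q, ⟨hq, hp.1, hq.2.1⟩, rfl⟩

theorem isOpen_freeRegion_inter (h : IsAbsorbing w a b x₀ t₀ T' xl xr y) :
    IsOpen (freeRegion a b t₀ T' xl xr ∩ Ioo 0 T ×ˢ Ioo a b) :=
  h.isOpen_freeRegion.inter (isOpen_Ioo.prod isOpen_Ioo)

theorem hasFDerivAt_flow_of_mem (h : IsAbsorbing w a b x₀ t₀ T' xl xr y) {q : ℝ × ℝ}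
    (hq : q ∈ freeRegion a b t₀ T' xl xr) : HasFDerivAt (flow w) (flowDeriv w q) q :=
  hasFDerivAt_flow (h.analytic _ (Ioo_subset_Icc_self hq.2.1)).differentiableAt

/-- The trajectory of the point mass is a null set. -/
theorem tube_ae_eq (h : IsAbsorbing w a b x₀ t₀ T' xl xr y) (hT : t₀ < T') (hTT : T ≤ T') :
    tube w a b (Ioo 0 T) =ᵐ[volume]
      flow w '' (freeRegion a b t₀ T' xl xr ∩ Ioo 0 T ×ˢ Ioo a b) := by
  have hmeas : MeasurableSet (flow w '' (freeRegion a b t₀ T' xl xr ∩ Ioo 0 T ×ˢ Ioo a b)) := by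
    refine measurable_image_of_fderivWithin h.isOpen_freeRegion_inter.measurableSet
      (fun q hq ↦ (h.hasFDerivAt_flow_of_mem hq.1).hasFDerivWithinAt)
      ((h.injOn_flow hT).mono inter_subset_left)
  have hsub : flow w '' (freeRegion a b t₀ T' xl xr ∩ Ioo 0 T ×ˢ Ioo a b) ⊆
      tube w a b (Ioo 0 T) := by
    rw [h.image_flow hT hTT]
    exact sdiff_subset
  have hnull : volume (tube w a b (Ioo 0 T) \
      flow w '' (freeRegion a b t₀ T' xl xr ∩ Ioo 0 T ×ˢ Ioo a b)) = 0 := by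
    rw [Measure.volume_eq_prod, Measure.measure_prod_null
      ((isOpen_tube w a b isOpen_Ioo).measurableSet.diff hmeas)]
    refine Eventually.of_forall fun t ↦ ?_
    refine measure_mono_null (t := {y t}) (fun x hx ↦ ?_) (by simp)
    rw [h.image_flow hT hTT] at hx
    by_contra hne
    exact hx.2 ⟨hx.1, fun hy ↦ hne hy.2⟩
  exact ae_eq_set.2 ⟨hnull, by rw [sdiff_eq_empty.2 hsub, measure_empty]⟩

theorem integrableOn_box {f : ℝ × ℝ → ℝ} {s : ℝ} (hf : ContinuousOn f (Icc s T ×ˢ Icc a b)) :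
    IntegrableOn f (Icc s T ×ˢ Icc a b) :=
  hf.integrableOn_compact (isCompact_Icc.prod isCompact_Icc)

theorem integrableOn_gasDensity (h : IsAbsorbing w a b x₀ t₀ T' xl xr y) (hT : t₀ < T')
    (hTT : T ≤ T') {κ : ℝ → ℝ} (hκ : ContinuousOn κ (Icc a b)) :
    IntegrableOn (gasDensity w κ a b t₀ T' xl xr) (tube w a b (Ioo 0 T)) := by
  rw [integrableOn_congr_set_ae (h.tube_ae_eq hT hTT),
    integrableOn_image_iff_integrableOn_abs_det_fderiv_smul volume
      h.isOpen_freeRegion_inter.measurableSet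
      (fun q hq ↦ (h.hasFDerivAt_flow_of_mem hq.1).hasFDerivWithinAt)
      ((h.injOn_flow hT).mono inter_subset_left)]
  have hc : ContinuousOn (fun q : ℝ × ℝ ↦ κ q.2) (Icc 0 T ×ˢ Icc a b) :=
    hκ.comp continuousOn_snd fun q hq ↦ hq.2
  refine ((integrableOn_box hc).mono_set (inter_subset_right.trans
    (prod_mono Ioo_subset_Icc_self Ioo_subset_Icc_self))).congr_fun ?_
    h.isOpen_freeRegion_inter.measurableSet
  intro q hq
  have hs := h.slope_pos hq.1
  simp only [gasDensity, h.label_flow hT hq.1, det_flowDeriv, abs_of_pos hs, smul_eq_mul]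
  field_simp

theorem integral_gas_eq (h : IsAbsorbing w a b x₀ t₀ T' xl xr y) (hT : t₀ < T')
    (hTT : T ≤ T') (κ : ℝ → ℝ) (φ : ℝ × ℝ → ℝ) :
    ∫ p in tube w a b (Ioo 0 T), gasDensity w κ a b t₀ T' xl xr p *
        fderiv ℝ φ p (1, gasVelocity w a b t₀ T' xl xr p) =
      ∫ q in freeRegion a b t₀ T' xl xr ∩ Ioo 0 T ×ˢ Ioo a b,
        κ q.2 * fderiv ℝ φ (flow w q) (1, w q.2) := by
  rw [setIntegral_congr_set (h.tube_ae_eq hT hTT),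
    integral_image_eq_integral_abs_det_fderiv_smul volume
      h.isOpen_freeRegion_inter.measurableSet
      (fun q hq ↦ (h.hasFDerivAt_flow_of_mem hq.1).hasFDerivWithinAt)
      ((h.injOn_flow hT).mono inter_subset_left)]
  refine setIntegral_congr_fun h.isOpen_freeRegion_inter.measurableSet fun q hq ↦ ?_
  have hs := h.slope_pos hq.1
  simp only [gasDensity, gasVelocity, h.label_flow hT hq.1, det_flowDeriv, abs_of_pos hs,
    smul_eq_mul]
  field_simp

/-- Every particle is free until the time `τ` at which it reaches the point mass, and absorbed
from then on; `τ = T` if it is not absorbed before time `T`. -/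
theorem exists_absorptionTime (h : IsAbsorbing w a b x₀ t₀ T' xl xr y) (hT : t₀ < T) (hTT : T < T')
    {x : ℝ} (hx : x ∈ Ioo a b) : ∃ τ ∈ Icc t₀ T,
      (∀ t, t < T → ((t, x) ∈ freeRegion a b t₀ T' xl xr ↔ t < τ)) ∧
      (τ < T → x + τ * w x = y τ) := by
  have hsub : Icc t₀ T ⊆ Ico t₀ T' := fun t ht ↦ ⟨ht.1, ht.2.trans_lt hTT⟩
  have hTm : T ∈ Ico t₀ T' := hsub ⟨hT.le, le_rfl⟩
  rcases le_or_gt x (xl T) with h1 | h1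
  · refine ⟨T, ⟨hT.le, le_rfl⟩, fun t ht ↦ ⟨fun _ ↦ ht, fun _ ↦ ⟨ht.trans hTT, hx, ?_⟩⟩,
      fun h2 ↦ absurd h2 (lt_irrefl _)⟩
    refine (lt_or_ge t t₀).imp id fun h2 ↦ Or.inl ?_
    exact h1.trans_lt (h.xl_anti ⟨h2, ht.trans hTT⟩ hTm ht)
  rcases le_or_gt (xr T) x with h1' | h1'
  · refine ⟨T, ⟨hT.le, le_rfl⟩, fun t ht ↦ ⟨fun _ ↦ ht, fun _ ↦ ⟨ht.trans hTT, hx, ?_⟩⟩,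
      fun h2 ↦ absurd h2 (lt_irrefl _)⟩
    refine (lt_or_ge t t₀).imp id fun h2 ↦ Or.inr ?_
    exact (h.xr_mono ⟨h2, ht.trans hTT⟩ hTm ht).trans_le h1'
  rcases le_or_gt x x₀ with h2 | h2
  · obtain ⟨τ, hτ, hτx⟩ := intermediate_value_Icc' hT.le (h.xl_cont.mono hsub)
      ⟨h1.le, by rw [h.xl_start]; exact h2⟩
    refine ⟨τ, hτ, fun t ht ↦ ⟨fun hf ↦ ?_, fun htτ ↦ ⟨ht.trans hTT, hx, ?_⟩⟩, fun _ ↦ ?_⟩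
    · by_contra hcon
      rw [not_lt] at hcon
      have htm : t ∈ Ico t₀ T' := ⟨hτ.1.trans hcon, ht.trans hTT⟩
      rcases hf.2.2.resolve_left (not_lt.2 htm.1) with h3 | h3
      · have := h.xl_anti.antitoneOn (hsub hτ) htm hcon
        simp only at h3
        linarith
      · have := h.le_xr htm
        simp only at h3
        linarith
    · refine (lt_or_ge t t₀).imp id fun h3 ↦ Or.inl ?_
      rw [← hτx]
      exact h.xl_anti ⟨h3, ht.trans hTT⟩ (hsub hτ) htτ
    · rw [← hτx]
      exact h.xl_meet τ (hsub hτ)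
  · obtain ⟨τ, hτ, hτx⟩ := intermediate_value_Icc hT.le (h.xr_cont.mono hsub)
      ⟨by rw [h.xr_start]; exact h2.le, h1'.le⟩
    refine ⟨τ, hτ, fun t ht ↦ ⟨fun hf ↦ ?_, fun htτ ↦ ⟨ht.trans hTT, hx, ?_⟩⟩, fun _ ↦ ?_⟩
    · by_contra hcon
      rw [not_lt] at hcon
      have htm : t ∈ Ico t₀ T' := ⟨hτ.1.trans hcon, ht.trans hTT⟩
      rcases hf.2.2.resolve_left (not_lt.2 htm.1) with h3 | h3
      · have := h.xl_le htm
        simp only at h3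
        linarith
      · have := h.xr_mono.monotoneOn (hsub hτ) htm hcon
        simp only at h3
        linarith
    · refine (lt_or_ge t t₀).imp id fun h3 ↦ Or.inr ?_
      rw [← hτx]
      exact h.xr_mono ⟨h3, ht.trans hTT⟩ (hsub hτ) htτ
    · rw [← hτx]
      exact h.xr_meet τ (hsub hτ)

/-- A test function changes along the path of a particle, first free and then with the point mass,
from its initial value to zero. -/
theorem integral_along_particle (h : IsAbsorbing w a b x₀ t₀ T' xl xr y) (hT : t₀ < T)
    (hTT : T < T') (hy : AnalyticOnNhd ℝ y (Icc t₀ T)) {φ : ℝ × ℝ → ℝ} (hφ : ContDiff ℝ ∞ φ)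
    (hφT : ∀ x, φ (T, x) = 0) {x : ℝ} (hx : x ∈ Ioo a b) :
    (∫ t in Ioo 0 T, {t | (t, x) ∈ freeRegion a b t₀ T' xl xr}.indicator
        (fun t ↦ fderiv ℝ φ (flow w (t, x)) (1, w x)) t) +
      (∫ t in Ioo 0 T, {t | (t, x) ∈ freeRegion a b t₀ T' xl xr}ᶜ.indicator
        (fun t ↦ fderiv ℝ φ (t, y t) (1, deriv y t)) t) = -φ (0, x) := by
  obtain ⟨τ, hτ, hfree, hmeet⟩ := h.exists_absorptionTime hT hTT hx
  have hτ0 : 0 < τ := h.t₀_pos.trans_le hτ.1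
  have hφd : Differentiable ℝ φ := hφ.differentiable (by simp)
  have hφc : Continuous (fderiv ℝ φ) := hφ.continuous_fderiv (by simp)
  have e1 : (∫ t in Ioo 0 T, {t | (t, x) ∈ freeRegion a b t₀ T' xl xr}.indicator
        (fun t ↦ fderiv ℝ φ (flow w (t, x)) (1, w x)) t) =
      φ (τ, x + τ * w x) - φ (0, x) := by
    have : (∫ t in Ioo 0 T, {t | (t, x) ∈ freeRegion a b t₀ T' xl xr}.indicator
        (fun t ↦ fderiv ℝ φ (flow w (t, x)) (1, w x)) t) =
        ∫ t in Ioo 0 T, (Iio τ).indicator (fun t ↦ fderiv ℝ φ (flow w (t, x)) (1, w x)) t := by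
      refine setIntegral_congr_fun measurableSet_Ioo fun t ht ↦ ?_
      simp only [indicator, mem_ofPred_eq, mem_Iio, hfree t ht.2]
    rw [this, setIntegral_indicator measurableSet_Iio, Ioo_inter_Iio, min_eq_right hτ.2,
      ← integral_Ioc_eq_integral_Ioo, ← intervalIntegral.integral_of_le hτ0.le]
    have hd : ∀ t ∈ uIcc 0 τ, HasDerivAt (fun t ↦ φ (t, x + t * w x))
        (fderiv ℝ φ (flow w (t, x)) (1, w x)) t := fun t _ ↦ by
      have d1 : HasDerivAt (fun t ↦ (t, x + t * w x)) (1, w x) t := by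
        refine (hasDerivAt_id t).prodMk ?_
        simpa using ((hasDerivAt_id t).mul_const (w x)).const_add x
      exact (hφd _).hasFDerivAt.comp_hasDerivAt t d1
    rw [intervalIntegral.integral_eq_sub_of_hasDerivAt hd]
    · simp
    · refine Continuous.intervalIntegrable ?_ _ _
      have : Continuous fun t ↦ flow w (t, x) := by
        change Continuous fun t : ℝ ↦ (t, x + t * w x)
        fun_prop
      exact (hφc.comp this).clm_apply continuous_const
  have e2 : (∫ t in Ioo 0 T, {t | (t, x) ∈ freeRegion a b t₀ T' xl xr}ᶜ.indicator
        (fun t ↦ fderiv ℝ φ (t, y t) (1, deriv y t)) t) = φ (T, y T) - φ (τ, y τ) := by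
    have : (∫ t in Ioo 0 T, {t | (t, x) ∈ freeRegion a b t₀ T' xl xr}ᶜ.indicator
        (fun t ↦ fderiv ℝ φ (t, y t) (1, deriv y t)) t) =
        ∫ t in Ioo 0 T, (Ici τ).indicator (fun t ↦ fderiv ℝ φ (t, y t) (1, deriv y t)) t := by
      refine setIntegral_congr_fun measurableSet_Ioo fun t ht ↦ ?_
      simp only [indicator, mem_compl_iff, mem_ofPred_eq, mem_Ici, hfree t ht.2, not_lt]
    have hset : Ioo 0 T ∩ Ici τ = Ico τ T := by
      ext t
      simp only [mem_inter_iff, mem_Ioo, mem_Ici, mem_Ico]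
      exact ⟨fun ht ↦ ⟨ht.2, ht.1.2⟩, fun ht ↦ ⟨⟨hτ0.trans_le ht.1, ht.2⟩, ht.1⟩⟩
    rw [this, setIntegral_indicator measurableSet_Ici, hset, integral_Ico_eq_integral_Ioc,
      ← intervalIntegral.integral_of_le hτ.2]
    have hmem : ∀ t ∈ uIcc τ T, t ∈ Icc t₀ T := fun t ht ↦ by
      rw [uIcc_of_le hτ.2] at ht
      exact ⟨hτ.1.trans ht.1, ht.2⟩
    have hd : ∀ t ∈ uIcc τ T, HasDerivAt (fun t ↦ φ (t, y t))
        (fderiv ℝ φ (t, y t) (1, deriv y t)) t := fun t ht ↦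
      (hφd _).hasFDerivAt.comp_hasDerivAt t
        ((hasDerivAt_id t).prodMk (hy t (hmem t ht)).differentiableAt.hasDerivAt)
    rw [intervalIntegral.integral_eq_sub_of_hasDerivAt hd]
    refine ContinuousOn.intervalIntegrable ?_
    have c1 : ContinuousOn y (uIcc τ T) := fun t ht ↦
      (hy t (hmem t ht)).continuousAt.continuousWithinAt
    have c2 : ContinuousOn (deriv y) (uIcc τ T) := fun t ht ↦
      (hy t (hmem t ht)).deriv.continuousAt.continuousWithinAt
    exact (hφc.comp_continuousOn (continuousOn_id.prodMk c1)).clm_apply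
      (continuousOn_const.prodMk c2)
  rw [e1, e2, hφT]
  rcases hτ.2.eq_or_lt with h3 | h3
  · rw [h3, hφT, hφT]
    ring
  · rw [hmeet h3]
    ring

/-- Conservation laws for a quantity with initial density `κ` that is carried along by the
particles: the point mass holds what the absorbed particles brought in. -/
theorem weakBalance (h : IsAbsorbing w a b x₀ t₀ T' xl xr y) (hT : t₀ < T)
    (hTT : T < T') (hy : AnalyticOnNhd ℝ y (Icc t₀ T)) {κ M : ℝ → ℝ}
    (hκ : ContinuousOn κ (Icc a b)) (hM : ∀ t ∈ Ioc t₀ T, M t = ∫ x in xl t..xr t, κ x) :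
    WeakBalance w a b t₀ T (gasDensity w κ a b t₀ T' xl xr) (gasVelocity w a b t₀ T' xl xr)
      M y κ := by
  intro φ hφ hφc hφs
  have hab : a < b := h.lt_left.trans h.lt_right
  have hT0 : 0 < T := h.t₀_pos.trans hT
  have hsub : Icc t₀ T ⊆ Ico t₀ T' := fun t ht ↦ ⟨ht.1, ht.2.trans_lt hTT⟩
  have hφT : ∀ x, φ (T, x) = 0 := fun x ↦
    image_eq_zero_of_notMem_tsupport fun hx ↦ lt_irrefl T (hφs hx).1
  have hφ' : Continuous (fderiv ℝ φ) := hφ.continuous_fderiv (by simp)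
  set S := freeRegion a b t₀ T' xl xr with hS
  have hSm : MeasurableSet S := h.isOpen_freeRegion.measurableSet
  let B₁ : ℝ × ℝ → ℝ := fun q ↦ fderiv ℝ φ (flow w q) (1, w q.2)
  let B₂ : ℝ × ℝ → ℝ := fun q ↦ fderiv ℝ φ (q.1, y q.1) (1, deriv y q.1)
  let f₁ : ℝ × ℝ → ℝ := S.indicator fun q ↦ κ q.2 * B₁ q
  let f₂ : ℝ × ℝ → ℝ := Sᶜ.indicator fun q ↦ κ q.2 * B₂ q
  have hκ2 : ∀ s, ContinuousOn (fun q : ℝ × ℝ ↦ κ q.2) (Icc s T ×ˢ Icc a b) := fun s ↦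
    hκ.comp continuousOn_snd fun q hq ↦ hq.2
  have hbox : Ioo 0 T ×ˢ Ioo a b ⊆ Icc 0 T ×ˢ Icc a b :=
    prod_mono Ioo_subset_Icc_self Ioo_subset_Icc_self
  have hf₁ : IntegrableOn f₁ (Ioo 0 T ×ˢ Ioo a b) := by
    refine IntegrableOn.indicator ?_ hSm
    refine (integrableOn_box ((hκ2 0).mul ?_)).mono_set hbox
    have hw2 : ContinuousOn (fun q : ℝ × ℝ ↦ w q.2) (Icc 0 T ×ˢ Icc a b) :=
      h.analytic.continuousOn.comp continuousOn_snd fun q hq ↦ hq.2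
    have hfl : ContinuousOn (flow w) (Icc 0 T ×ˢ Icc a b) :=
      continuousOn_fst.prodMk (continuousOn_snd.add (continuousOn_fst.mul hw2))
    exact (hφ'.comp_continuousOn hfl).clm_apply (continuousOn_const.prodMk hw2)
  have hf₂ : IntegrableOn f₂ (Ioo 0 T ×ˢ Ioo a b) := by
    have c1 : ContinuousOn (fun q : ℝ × ℝ ↦ y q.1) (Icc t₀ T ×ˢ Icc a b) :=
      hy.continuousOn.comp continuousOn_fst fun q hq ↦ hq.1
    have c2 : ContinuousOn (fun q : ℝ × ℝ ↦ deriv y q.1) (Icc t₀ T ×ˢ Icc a b) :=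
      hy.deriv.continuousOn.comp continuousOn_fst fun q hq ↦ hq.1
    have c3 : IntegrableOn (fun q : ℝ × ℝ ↦ κ q.2 * B₂ q) (Icc t₀ T ×ˢ Icc a b) :=
      integrableOn_box ((hκ2 t₀).mul ((hφ'.comp_continuousOn
        (continuousOn_fst.prodMk c1)).clm_apply (continuousOn_const.prodMk c2)))
    rw [IntegrableOn, integrable_indicator_iff hSm.compl, IntegrableOn,
      Measure.restrict_restrict hSm.compl]
    refine c3.mono_set fun q hq ↦ ?_
    refine ⟨⟨?_, hq.2.1.2.le⟩, Ioo_subset_Icc_self hq.2.2⟩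
    by_contra hcon
    exact hq.1 ⟨hq.2.1.2.trans hTT, hq.2.2, Or.inl (not_le.1 hcon)⟩
  have hprod : (volume.restrict (Ioo 0 T)).prod (volume.restrict (Ioo a b)) =
      (volume : Measure (ℝ × ℝ)).restrict (Ioo 0 T ×ˢ Ioo a b) := by
    rw [Measure.prod_restrict, Measure.volume_eq_prod]
  rw [IntegrableOn, ← hprod] at hf₁ hf₂
  have I₁ : ∫ p in tube w a b (Ioo 0 T), gasDensity w κ a b t₀ T' xl xr p *
        fderiv ℝ φ p (1, gasVelocity w a b t₀ T' xl xr p) =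
      ∫ x in Ioo a b, ∫ t in Ioo 0 T, f₁ (t, x) := by
    rw [h.integral_gas_eq (hT.trans hTT) hTT.le, ← integral_prod_symm f₁ hf₁, hprod,
      setIntegral_indicator hSm, inter_comm]
  have I₂ : ∫ t in t₀..T, M t * fderiv ℝ φ (t, y t) (1, deriv y t) =
      ∫ x in Ioo a b, ∫ t in Ioo 0 T, f₂ (t, x) := by
    rw [← integral_prod_symm f₂ hf₂, integral_prod f₂ hf₂]
    have hin : ∀ t ∈ Ioo 0 T, t ≠ t₀ → ∫ x in Ioo a b, f₂ (t, x) =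
        (Ioi t₀).indicator (fun t ↦ M t * fderiv ℝ φ (t, y t) (1, deriv y t)) t := by
      intro t ht hne
      rcases lt_or_gt_of_ne hne with h1 | h1
      · rw [indicator_of_notMem (by simpa using h1.le)]
        refine setIntegral_eq_zero_of_forall_eq_zero fun x hx ↦ ?_
        exact indicator_of_notMem (show (t, x) ∉ Sᶜ from
          fun hc ↦ hc ⟨ht.2.trans hTT, hx, Or.inl h1⟩) _
      · have htm : t ∈ Ico t₀ T' := ⟨h1.le, ht.2.trans hTT⟩
        have hlr : xl t ≤ xr t := (h.xl_le htm).trans (h.le_xr htm)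
        have e : ∀ x ∈ Ioo a b, f₂ (t, x) = (Icc (xl t) (xr t)).indicator
            (fun x ↦ κ x * fderiv ℝ φ (t, y t) (1, deriv y t)) x := fun x hx ↦ by
          have hiff : (t, x) ∈ Sᶜ ↔ x ∈ Icc (xl t) (xr t) := by
            rw [mem_compl_iff, ← not_iff_not, not_not]
            constructor
            · intro hf hx'
              rcases hf.2.2.resolve_left (not_lt.2 h1.le) with h2 | h2
              · exact absurd h2 (not_lt.2 hx'.1)
              · exact absurd h2 (not_lt.2 hx'.2)
            · intro hx'
              refine ⟨htm.2, hx, Or.inr ?_⟩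
              by_contra hcon
              rw [not_or, not_lt, not_lt] at hcon
              exact hx' hcon
          by_cases hx' : x ∈ Icc (xl t) (xr t)
          · rw [indicator_of_mem hx']
            exact indicator_of_mem (hiff.2 hx') _
          · rw [indicator_of_notMem hx']
            exact indicator_of_notMem (mt hiff.1 hx') _
        rw [setIntegral_congr_fun measurableSet_Ioo e, setIntegral_indicator measurableSet_Icc,
          inter_eq_right.2 (Icc_subset_Ioo (h.xl_gt t htm) (h.xr_lt t htm)),
          integral_mul_const, integral_Icc_eq_integral_Ioc, ← intervalIntegral.integral_of_le hlr,
          indicator_of_mem (mem_Ioi.2 h1), hM t ⟨h1, ht.2.le⟩]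
    have hae : ∀ᵐ t ∂(volume.restrict (Ioo 0 T)), ∫ x in Ioo a b, f₂ (t, x) =
        (Ioi t₀).indicator (fun t ↦ M t * fderiv ℝ φ (t, y t) (1, deriv y t)) t := by
      have h0 : ∀ᵐ t ∂(volume.restrict (Ioo 0 T)), t ≠ t₀ :=
        ae_restrict_of_ae (by simp [ae_iff])
      filter_upwards [ae_restrict_mem measurableSet_Ioo, h0] with t h1 h2 using hin t h1 h2
    have hset : Ioo 0 T ∩ Ioi t₀ = Ioo t₀ T := by
      ext t
      simp only [mem_inter_iff, mem_Ioo, mem_Ioi]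
      exact ⟨fun ht ↦ ⟨ht.2, ht.1.2⟩, fun ht ↦ ⟨⟨h.t₀_pos.trans ht.1, ht.2⟩, ht.1⟩⟩
    rw [integral_congr_ae hae, setIntegral_indicator measurableSet_Ioi, hset,
      ← integral_Ioc_eq_integral_Ioo, ← intervalIntegral.integral_of_le hT.le]
  rw [I₁, I₂, ← integral_add hf₁.integral_prod_right hf₂.integral_prod_right,
    intervalIntegral.integral_of_le hab.le, integral_Ioc_eq_integral_Ioo]
  have hpart : ∀ x ∈ Ioo a b, ((∫ t in Ioo 0 T, f₁ (t, x)) + ∫ t in Ioo 0 T, f₂ (t, x)) =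
      -(κ x * φ (0, x)) := fun x hx ↦ by
    have e1 : ∀ t, f₁ (t, x) = κ x * {t | (t, x) ∈ S}.indicator
        (fun t ↦ fderiv ℝ φ (flow w (t, x)) (1, w x)) t := fun t ↦ by
      by_cases ht : (t, x) ∈ S
      · rw [indicator_of_mem (show t ∈ {t | (t, x) ∈ S} from ht)]
        exact indicator_of_mem ht _
      · rw [indicator_of_notMem (show t ∉ {t | (t, x) ∈ S} from ht), mul_zero]
        exact indicator_of_notMem ht _
    have e2 : ∀ t, f₂ (t, x) = κ x * {t | (t, x) ∈ S}ᶜ.indicator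
        (fun t ↦ fderiv ℝ φ (t, y t) (1, deriv y t)) t := fun t ↦ by
      by_cases ht : (t, x) ∈ S
      · rw [indicator_of_notMem (show t ∉ {t | (t, x) ∈ S}ᶜ from fun hc ↦ hc ht), mul_zero]
        exact indicator_of_notMem (show (t, x) ∉ Sᶜ from fun hc ↦ hc ht) _
      · rw [indicator_of_mem (show t ∈ {t | (t, x) ∈ S}ᶜ from ht)]
        exact indicator_of_mem (show (t, x) ∈ Sᶜ from ht) _
    simp only [e1, e2]
    rw [integral_const_mul, integral_const_mul, ← mul_add,
      h.integral_along_particle hT hTT hy hφ hφT hx]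
    ring
  rw [setIntegral_congr_fun measurableSet_Ioo hpart, integral_neg, neg_add_cancel]

end IsAbsorbing

end PressurelessGas

/-! ### The mean velocity of the absorbed particles -/

namespace PressurelessGas

/-- The mean velocity of the particles in an interval lies between the velocities at its ends. -/
theorem mean_velocity_mem {ρ₀ w : ℝ → ℝ} {a b x₁ x₂ : ℝ} (hρ : ContinuousOn ρ₀ (Icc a b))
    (hρ0 : ∀ x ∈ Icc a b, 0 < ρ₀ x) (hw : ContinuousOn w (Icc a b)) (hanti : StrictAntiOn w (Icc a b))
    (h₁ : a ≤ x₁) (h₁₂ : x₁ < x₂) (h₂ : x₂ ≤ b) :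
    0 < ∫ x in x₁..x₂, ρ₀ x ∧
      (∫ x in x₁..x₂, ρ₀ x * w x) / (∫ x in x₁..x₂, ρ₀ x) ∈ Ioo (w x₂) (w x₁) := by
  have hsub : Icc x₁ x₂ ⊆ Icc a b := Icc_subset_Icc h₁ h₂
  have hρi : IntervalIntegrable ρ₀ volume x₁ x₂ := by
    refine ContinuousOn.intervalIntegrable ?_
    rw [uIcc_of_le h₁₂.le]
    exact hρ.mono hsub
  have hρwi : IntervalIntegrable (fun x ↦ ρ₀ x * w x) volume x₁ x₂ := by
    refine ContinuousOn.intervalIntegrable ?_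
    rw [uIcc_of_le h₁₂.le]
    exact (hρ.mul hw).mono hsub
  have hpos : 0 < ∫ x in x₁..x₂, ρ₀ x :=
    intervalIntegral.intervalIntegral_pos_of_pos_on hρi
      (fun x hx ↦ hρ0 x (hsub (Ioo_subset_Icc_self hx))) h₁₂
  have hm₁ : x₁ ∈ Icc a b := hsub ⟨le_rfl, h₁₂.le⟩
  have hm₂ : x₂ ∈ Icc a b := hsub ⟨h₁₂.le, le_rfl⟩
  refine ⟨hpos, (lt_div_iff₀ hpos).2 ?_, (div_lt_iff₀ hpos).2 ?_⟩
  · have := intervalIntegral.intervalIntegral_pos_of_pos_on (hρwi.sub (hρi.const_mul (w x₂)))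
      (fun x hx ↦ by
        have hx' := hsub (Ioo_subset_Icc_self hx)
        have h1 := hanti hx' hm₂ hx.2
        have h2 := mul_lt_mul_of_pos_left h1 (hρ0 x hx')
        linarith) h₁₂
    rw [intervalIntegral.integral_sub hρwi (hρi.const_mul _),
      intervalIntegral.integral_const_mul] at this
    linarith
  · have := intervalIntegral.intervalIntegral_pos_of_pos_on ((hρi.const_mul (w x₁)).sub hρwi)
      (fun x hx ↦ by
        have hx' := hsub (Ioo_subset_Icc_self hx)
        have h1 := hanti hm₁ hx' hx.1
        have h2 := mul_lt_mul_of_pos_left h1 (hρ0 x hx')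
        linarith) h₁₂
    rw [intervalIntegral.integral_sub (hρi.const_mul _) hρwi,
      intervalIntegral.integral_const_mul] at this
    linarith

/-- If the characteristics from `x₁ < x < x₂` meet and the middle one has been overtaken, then the
outer ones have not. -/
theorem slope_pos_of_outer {w : ℝ → ℝ} {a b x₀ t x₁ x x₂ : ℝ}
    (hw : AnalyticOnNhd ℝ w (Icc a b)) (hanti : StrictAntiOn (deriv w) (Icc a x₀))
    (hmono : StrictMonoOn (deriv w) (Icc x₀ b)) (ht : 0 < t) (h₁ : a ≤ x₁) (h₁x : x₁ < x)
    (hx₂ : x < x₂) (h₂ : x₂ ≤ b) (hx : 1 + t * deriv w x < 0)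
    (hm₁ : x₁ + t * w x₁ = x + t * w x) (hm₂ : x₂ + t * w x₂ = x + t * w x) :
    x₁ < x₀ ∧ x₀ < x₂ ∧ 0 < 1 + t * deriv w x₁ ∧ 0 < 1 + t * deriv w x₂ := by
  have hd : ∀ z ∈ Icc a b, HasDerivAt (fun z ↦ z + t * w z) (1 + t * deriv w z) z := fun z hz ↦
    (hasDerivAt_id z).add ((hw z hz).differentiableAt.hasDerivAt.const_mul t)
  have hcmp : ∀ u v, 1 + t * deriv w u < 1 + t * deriv w v → deriv w u < deriv w v :=
    fun u v huv ↦ by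
      by_contra hcon
      have := mul_le_mul_of_nonneg_left (not_lt.1 hcon) ht.le
      linarith
  obtain ⟨c, hc, hc0⟩ := exists_hasDerivAt_eq_zero h₁x
    (fun z hz ↦ (hd z ⟨h₁.trans hz.1, hz.2.trans (hx₂.le.trans h₂)⟩).continuousAt.continuousWithinAt)
    hm₁ fun z hz ↦ hd z ⟨h₁.trans hz.1.le, hz.2.le.trans (hx₂.le.trans h₂)⟩
  obtain ⟨d, hd1, hd0⟩ := exists_hasDerivAt_eq_zero hx₂
    (fun z hz ↦ (hd z ⟨(h₁.trans h₁x.le).trans hz.1, hz.2.trans h₂⟩).continuousAt.continuousWithinAt)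
    hm₂.symm fun z hz ↦ hd z ⟨(h₁.trans h₁x.le).trans hz.1.le, hz.2.le.trans h₂⟩
  have hxc := hcmp x c (by rw [hc0]; exact hx)
  have hxd := hcmp x d (by rw [hd0]; exact hx)
  have hcx₀ : c < x₀ := by
    by_contra hcon
    exact absurd (hmono ⟨not_lt.1 hcon, hc.2.le.trans (hx₂.le.trans h₂)⟩
      ⟨(not_lt.1 hcon).trans hc.2.le, hx₂.le.trans h₂⟩ hc.2) hxc.not_gt
  have hx₀d : x₀ < d := by
    by_contra hcon
    exact absurd (hanti ⟨h₁.trans h₁x.le, hd1.1.le.trans (not_lt.1 hcon)⟩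
      ⟨(h₁.trans h₁x.le).trans hd1.1.le, not_lt.1 hcon⟩ hd1.1) hxd.not_gt
  refine ⟨hc.1.trans hcx₀, hx₀d.trans hd1.2, ?_, ?_⟩
  · have h3 := hanti ⟨h₁, (hc.1.trans hcx₀).le⟩ ⟨h₁.trans hc.1.le, hcx₀.le⟩ hc.1
    have := mul_lt_mul_of_pos_left h3 ht
    linarith
  · have h3 := hmono ⟨hx₀d.le, hd1.2.le.trans h₂⟩ ⟨(hx₀d.trans hd1.2).le, h₂⟩ hd1.2
    have := mul_lt_mul_of_pos_left h3 ht
    linarith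

/-- Particles that move freely until they are absorbed by a point mass form a local solution, if the
point mass moves with the mean velocity of the particles it has absorbed. -/
theorem IsAbsorbing.isLocalSolution {ρ₀ w : ℝ → ℝ} {a b x₀ t₀ T' T : ℝ} {xl xr y m : ℝ → ℝ}
    (h : IsAbsorbing w a b x₀ t₀ T' xl xr y) (hT : t₀ < T) (hTT : T < T')
    (hρ : AnalyticOnNhd ℝ ρ₀ (Icc a b)) (hρ0 : ∀ x ∈ Icc a b, 0 < ρ₀ x)
    (hy : AnalyticOnNhd ℝ y (Icc t₀ T)) (hm : ∀ t ∈ Icc t₀ T, m t = ∫ x in xl t..xr t, ρ₀ x)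
    (hmy : ∀ t ∈ Ioc t₀ T, m t * deriv y t = ∫ x in xl t..xr t, ρ₀ x * w x)
    (hadm : ∀ t ∈ Ioc t₀ T, deriv y t ∈ Icc (w (xr t)) (w (xl t))) :
    IsLocalSolution ρ₀ w a b t₀ T (gasDensity w ρ₀ a b t₀ T' xl xr)
      (gasVelocity w a b t₀ T' xl xr) y m := by
  have hTT' := hT.trans hTT
  have hT0 : 0 < T := h.t₀_pos.trans hT
  have hsub : ∀ t ∈ Icc t₀ T, t ∈ Ico t₀ T' := fun t ht ↦ ⟨ht.1, ht.2.trans_lt hTT⟩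
  have hoff : ∀ p ∈ tube w a b (Icc 0 T) \ trajectory y (Icc t₀ T),
      ∃ q ∈ freeRegion a b t₀ T' xl xr, flow w q = p := fun p hp ↦
    h.exists_flow_eq ⟨⟨hp.1.1.2.trans_lt hTT, hp.1.2⟩, fun hc ↦ hp.2 ⟨⟨hc.1.1, hp.1.1.2⟩, hc.2⟩⟩
  have hρw : ∀ p, gasDensity w ρ₀ a b t₀ T' xl xr p * gasVelocity w a b t₀ T' xl xr p =
      gasDensity w (fun x ↦ ρ₀ x * w x) a b t₀ T' xl xr p := fun p ↦ by
    simp only [gasDensity, gasVelocity]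
    ring
  have hρw2 : ∀ p, gasDensity w ρ₀ a b t₀ T' xl xr p * gasVelocity w a b t₀ T' xl xr p ^ 2 =
      gasDensity w (fun x ↦ ρ₀ x * w x ^ 2) a b t₀ T' xl xr p := fun p ↦ by
    simp only [gasDensity, gasVelocity]
    ring
  have hρc := hρ.continuousOn
  have hwc := h.analytic.continuousOn
  refine
    { initial := fun x hx ↦ ?_
      mem_tube := fun t ht ↦ ⟨⟨h.t₀_pos.le.trans ht.1, ht.2⟩, h.y_mem (hsub t ht)⟩
      analytic_density := fun p hp ↦ ?_
      analytic_velocity := fun p hp ↦ ?_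
      density_pos := fun p hp ↦ ?_
      mass_zero := ?_
      mass_pos := fun t ht ↦ ?_
      integrable_mass := h.integrableOn_gasDensity hTT' hTT.le hρc
      integrable_momentum := ?_
      integrable_flux := ?_
      mass_balance := h.weakBalance hT hTT hy hρc fun t ht ↦ hm t (Ioc_subset_Icc_self ht)
      momentum_balance := ?_
      admissible := fun t ht ↦ ?_ }
  · have hq : ((0:ℝ), x) ∈ freeRegion a b t₀ T' xl xr := ⟨hT0.trans hTT, hx, Or.inl h.t₀_pos⟩
    have hfl : flow w (0, x) = (0, x) := by simp [flow]
    have hl := h.label_flow hTT' hq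
    rw [hfl] at hl
    simp [gasDensity, gasVelocity, hl]
  · obtain ⟨q, hq, rfl⟩ := hoff p hp
    exact h.analyticAt_gasDensity hTT' hρ hq
  · obtain ⟨q, hq, rfl⟩ := hoff p hp
    exact h.analyticAt_gasVelocity hTT' hq
  · obtain ⟨q, hq, rfl⟩ := hoff p hp
    rw [gasDensity, h.label_flow hTT' hq]
    exact div_pos (hρ0 _ (Ioo_subset_Icc_self hq.2.1)) (h.slope_pos hq)
  · rw [hm t₀ ⟨le_rfl, hT.le⟩, h.xl_start, h.xr_start, intervalIntegral.integral_same]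
  · have htm := hsub t (Ioc_subset_Icc_self ht)
    have hlt : xl t < xr t := by
      refine lt_of_lt_of_le ?_ (h.le_xr htm)
      have := h.xl_anti ⟨le_rfl, hTT'⟩ htm ht.1
      rwa [h.xl_start] at this
    have hI : Icc (xl t) (xr t) ⊆ Icc a b := Icc_subset_Icc (h.xl_gt t htm).le (h.xr_lt t htm).le
    rw [hm t (Ioc_subset_Icc_self ht)]
    refine intervalIntegral.intervalIntegral_pos_of_pos_on ?_
      (fun x hx ↦ hρ0 x (hI (Ioo_subset_Icc_self hx))) hlt
    refine ContinuousOn.intervalIntegrable ?_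
    rw [uIcc_of_le hlt.le]
    exact hρc.mono hI
  · simp only [hρw]
    exact h.integrableOn_gasDensity hTT' hTT.le (hρc.mul hwc)
  · simp only [hρw2]
    exact h.integrableOn_gasDensity hTT' hTT.le (hρc.mul (hwc.pow 2))
  · simp only [hρw]
    exact h.weakBalance hT hTT hy (hρc.mul hwc) hmy
  · have htm := hsub t (Ioc_subset_Icc_self ht)
    have hcl : ContinuousAt w (xl t) := (h.analytic _
      ⟨(h.xl_gt t htm).le, (h.xl_le htm).trans h.lt_right.le⟩).continuousAt
    have hcr : ContinuousAt w (xr t) := (h.analytic _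
      ⟨h.lt_left.le.trans (h.le_xr htm), (h.xr_lt t htm).le⟩).continuousAt
    exact ⟨w (xl t), w (xr t), hcl.tendsto.comp (h.tendsto_label_left hTT' htm),
      hcr.tendsto.comp (h.tendsto_label_right hTT' htm), (hadm t ht).1, (hadm t ht).2⟩

/-- The velocity defect, expressed through the half sum `S` and the squared half difference `R` of
the outer two characteristics, is analytic; it grows in the unstable direction. -/
theorem exists_analyticAt_velocityDefect {ρ₀ w : ℝ → ℝ} {S R : ℝ × ℝ → ℝ} {x₀ t₀ : ℝ}
    (hρ : AnalyticAt ℝ ρ₀ x₀) (hρ0 : 0 < ρ₀ x₀) (hw : AnalyticAt ℝ w x₀)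
    (hS : AnalyticAt ℝ S (t₀, x₀)) (hR : AnalyticAt ℝ R (t₀, x₀)) (hS0 : S (t₀, x₀) = x₀)
    (hR0 : R (t₀, x₀) = 0) (hS1 : fderiv ℝ S (t₀, x₀) (0, 1) = -1 / 2)
    (hR1 : fderiv ℝ R (t₀, x₀) (0, 1) = 0) :
    ∃ Q F : ℝ × ℝ → ℝ, AnalyticAt ℝ Q (t₀, x₀) ∧ 0 < Q (t₀, x₀) ∧ AnalyticAt ℝ F (t₀, x₀) ∧
      F (t₀, x₀) = 0 ∧ fderiv ℝ F (t₀, x₀) (0, 1) = -(3 / 2) * deriv w x₀ ∧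
      ∀ᶠ p in 𝓝 (t₀, x₀), 0 ≤ R p →
        ∫ x in (S p - √(R p))..(S p + √(R p)), ρ₀ x = 2 * √(R p) * Q p ∧
        (0 < R p → F p = (∫ x in (S p - √(R p))..(S p + √(R p)), ρ₀ x * w x) /
          (∫ x in (S p - √(R p))..(S p + √(R p)), ρ₀ x) - w p.2) := by
  obtain ⟨P, hP, hPρ, hPint⟩ := exists_analyticAt_mean hρ
  obtain ⟨M, hM, hMρ, hMint⟩ := exists_analyticAt_mean (hρ.mul hw)
  have hP0 : P (x₀, 0) = ρ₀ x₀ := hPρ.self_of_nhds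
  have hne : P (x₀, 0) ≠ 0 := by rw [hP0]; exact hρ0.ne'
  let V : ℝ × ℝ → ℝ := fun z ↦ M z / P z
  have hV : AnalyticAt ℝ V (x₀, 0) := hM.div hP hne
  have hVw : ∀ᶠ s in 𝓝 x₀, V (s, 0) = w s := by
    filter_upwards [hPρ, hMρ, hρ.continuousAt.eventually (Ioi_mem_nhds hρ0)] with s h1 h2 h3
    have h4 : ρ₀ s ≠ 0 := ne_of_gt h3
    simp only [V, h1, h2, Pi.mul_apply]
    field_simp
  have hV1 : fderiv ℝ V (x₀, 0) (1, 0) = deriv w x₀ := by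
    have d1 : HasDerivAt (fun s : ℝ ↦ (s, (0:ℝ))) (1, 0) x₀ :=
      (hasDerivAt_id _).prodMk (hasDerivAt_const _ _)
    have d2 := HasFDerivAt.comp_hasDerivAt (l := V) x₀ hV.differentiableAt.hasFDerivAt d1
    exact (d2.congr_of_eventuallyEq (f₁ := w) (hVw.mono fun s hs ↦ hs.symm)).deriv.symm
  let ι : ℝ × ℝ → ℝ × ℝ := fun p ↦ (S p, R p)
  have hι : AnalyticAt ℝ ι (t₀, x₀) := hS.prod hR
  have hι0 : ι (t₀, x₀) = (x₀, 0) := by simp [ι, hS0, hR0]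
  have hw2 : AnalyticAt ℝ (fun p : ℝ × ℝ ↦ w p.2) (t₀, x₀) :=
    AnalyticAt.comp (g := w) (f := Prod.snd) hw analyticAt_snd
  have hVι : AnalyticAt ℝ (fun p ↦ V (ι p)) (t₀, x₀) :=
    AnalyticAt.comp (g := V) (f := ι) (by rwa [hι0]) hι
  refine ⟨fun p ↦ P (ι p), fun p ↦ V (ι p) - w p.2,
    AnalyticAt.comp (g := P) (f := ι) (by rwa [hι0]) hι, by simp only [hι0, hP0, hρ0],
    hVι.sub hw2, ?_, ?_, ?_⟩
  · simp only [hι0, hVw.self_of_nhds, sub_self]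
  · have d1 : HasFDerivAt ι ((fderiv ℝ S (t₀, x₀)).prod (fderiv ℝ R (t₀, x₀))) (t₀, x₀) :=
      hS.differentiableAt.hasFDerivAt.prodMk hR.differentiableAt.hasFDerivAt
    have d2 : HasFDerivAt V (fderiv ℝ V (x₀, 0)) (ι (t₀, x₀)) := by
      rw [hι0]
      exact hV.differentiableAt.hasFDerivAt
    have d3 := HasFDerivAt.comp (g := V) (f := ι) (t₀, x₀) d2 d1
    have d4 : HasFDerivAt (fun p : ℝ × ℝ ↦ w p.2) _ (t₀, x₀) :=
      hw.differentiableAt.hasDerivAt.comp_hasFDerivAt (t₀, x₀)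
        (hasFDerivAt_snd (𝕜 := ℝ) (p := (t₀, x₀)))
    have d5 := d3.sub d4
    rw [show fderiv ℝ (fun p ↦ V (ι p) - w p.2) (t₀, x₀) = _ from d5.fderiv]
    have e : ((-1 / 2, 0) : ℝ × ℝ) = (-1 / 2 : ℝ) • (1, 0) := by simp
    simp only [_root_.sub_apply, ContinuousLinearMap.comp_apply,
      ContinuousLinearMap.prod_apply, hS1, hR1, _root_.smul_apply,
      ContinuousLinearMap.coe_snd', smul_eq_mul, e, map_smul, hV1]
    ring
  · have hc : ContinuousAt (fun p ↦ (S p, √(R p))) (t₀, x₀) :=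
      hS.continuousAt.prodMk hR.continuousAt.sqrt
    have hc0 : (S (t₀, x₀), √(R (t₀, x₀))) = (x₀, (0:ℝ)) := by simp [hS0, hR0]
    have e1 := hc.eventually (p := fun z : ℝ × ℝ ↦
      ∫ ξ in (z.1 - z.2)..(z.1 + z.2), ρ₀ ξ = 2 * z.2 * P (z.1, z.2 ^ 2)) (by simp only [hc0]; exact hPint)
    have e2 := hc.eventually (p := fun z : ℝ × ℝ ↦
      ∫ ξ in (z.1 - z.2)..(z.1 + z.2), (ρ₀ * w) ξ = 2 * z.2 * M (z.1, z.2 ^ 2)) (by simp only [hc0]; exact hMint)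
    filter_upwards [e1, e2] with p h1 h2 hRp
    simp only [Real.sq_sqrt hRp, Pi.mul_apply] at h1 h2
    refine ⟨h1, fun hRp' ↦ ?_⟩
    have hsq : √(R p) ≠ 0 := (Real.sqrt_pos.2 hRp').ne'
    rw [h1, h2]
    simp only [V, ι]
    rw [mul_div_mul_left _ _ (mul_ne_zero two_ne_zero hsq)]

/-- Near a saddle, the vector field points away from the invariant curve. -/
theorem exists_repelling {w X : ℝ → ℝ} {F : ℝ × ℝ → ℝ} {x₀ t₀ : ℝ} (hw : AnalyticAt ℝ w x₀)
    (hw2 : deriv (deriv w) x₀ = 0) (hF : AnalyticAt ℝ F (t₀, x₀))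
    (hF1 : 0 < fderiv ℝ F (t₀, x₀) (0, 1)) (hX : AnalyticAt ℝ X t₀) (hX0 : X t₀ = x₀)
    (hXF : ∀ᶠ t in 𝓝 t₀, deriv X t * (1 + t * deriv w (X t)) = F (t, X t)) :
    ∃ ε > 0, ∀ᶠ t in 𝓝 t₀, ∀ x, |x - X t| < ε →
      0 ≤ (x - X t) * (F (t, x) - deriv X t * (1 + t * deriv w x)) := by
  let G : ℝ × ℝ → ℝ := fun p ↦ F p - deriv X p.1 * (1 + p.1 * deriv w p.2)
  have hX1 : AnalyticAt ℝ (fun p : ℝ × ℝ ↦ deriv X p.1) (t₀, x₀) :=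
    AnalyticAt.comp (g := deriv X) (f := Prod.fst) hX.deriv analyticAt_fst
  have hw1 : AnalyticAt ℝ (fun p : ℝ × ℝ ↦ deriv w p.2) (t₀, x₀) :=
    AnalyticAt.comp (g := deriv w) (f := Prod.snd) hw.deriv analyticAt_snd
  have hG : AnalyticAt ℝ G (t₀, x₀) :=
    hF.sub (hX1.mul (analyticAt_const.add (analyticAt_fst.mul hw1)))
  have hline : ∀ t x : ℝ, HasDerivAt (fun x : ℝ ↦ (t, x)) (0, 1) x := fun t x ↦
    (hasDerivAt_const _ _).prodMk (hasDerivAt_id _)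
  have hG1 : 0 < fderiv ℝ G (t₀, x₀) (0, 1) := by
    have d1 := HasFDerivAt.comp_hasDerivAt (l := G) x₀ hG.differentiableAt.hasFDerivAt (hline t₀ x₀)
    have d2 := HasFDerivAt.comp_hasDerivAt (l := F) x₀ hF.differentiableAt.hasFDerivAt (hline t₀ x₀)
    have d3 := d2.sub (((hw.deriv.differentiableAt.hasDerivAt.const_mul t₀).const_add 1).const_mul
      (deriv X t₀))
    rw [d1.unique d3, hw2, mul_zero, mul_zero, sub_zero]
    exact hF1
  have hcont : ContinuousAt (fun p ↦ fderiv ℝ G p (0, 1)) (t₀, x₀) :=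
    hG.fderiv.continuousAt.clm_apply continuousAt_const
  obtain ⟨r, hr, hball⟩ := Metric.eventually_nhds_iff_ball.1
    (hG.eventually_analyticAt.and (hcont.eventually (Ioi_mem_nhds hG1)))
  refine ⟨r / 2, by positivity, ?_⟩
  have hXr : ∀ᶠ t in 𝓝 t₀, X t ∈ Metric.ball x₀ (r / 2) :=
    hX.continuousAt.eventually_mem (Metric.isOpen_ball.mem_nhds (by
      rw [hX0]; exact Metric.mem_ball_self (by positivity)))
  filter_upwards [hXF, hXr, Metric.ball_mem_nhds t₀ hr] with t h1 h2 h3 x hx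
  rw [Metric.mem_ball, Real.dist_eq] at h2
  have hmem : ∀ z ∈ Metric.ball x₀ r, (t, z) ∈ Metric.ball (t₀, x₀) r := fun z hz ↦ by
    rw [← ball_prod_same]
    exact ⟨h3, hz⟩
  have hd : ∀ z ∈ Metric.ball x₀ r, HasDerivAt (fun z ↦ G (t, z)) (fderiv ℝ G (t, z) (0, 1)) z :=
    fun z hz ↦ HasFDerivAt.comp_hasDerivAt (l := G) z
      (hball _ (hmem z hz)).1.differentiableAt.hasFDerivAt (hline t z)
  have hmono : MonotoneOn (fun z ↦ G (t, z)) (Metric.ball x₀ r) := by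
    refine monotoneOn_of_deriv_nonneg (convex_ball x₀ r)
      (fun z hz ↦ (hd z hz).continuousAt.continuousWithinAt) (fun z hz ↦ ?_) fun z hz ↦ ?_
    · rw [Metric.isOpen_ball.interior_eq] at hz
      exact (hd z hz).differentiableAt.differentiableWithinAt
    · rw [Metric.isOpen_ball.interior_eq] at hz
      rw [(hd z hz).deriv]
      exact (hball _ (hmem z hz)).2.le
  have hX' : X t ∈ Metric.ball x₀ r := by
    rw [Metric.mem_ball, Real.dist_eq]
    linarith
  have hx' : x ∈ Metric.ball x₀ r := by
    rw [Metric.mem_ball, Real.dist_eq]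
    have := abs_add_le (x - X t) (X t - x₀)
    rw [sub_add_sub_cancel] at this
    linarith
  have hGX : G (t, X t) = 0 := by simp only [G, h1, sub_self]
  rcases le_total x (X t) with h4 | h4
  · have := hmono hx' hX' h4
    simp only [hGX] at this
    exact mul_nonneg_of_nonpos_of_nonpos (by linarith) this
  · have := hmono hX' hx' h4
    simp only [hGX] at this
    exact mul_nonneg (by linarith) this

/-- The linearization is triangular, as `w''` vanishes at `x₀`. -/
theorem isSaddle_planarField {w : ℝ → ℝ} {F : ℝ × ℝ → ℝ} {x₀ t₀ : ℝ} (ht₀ : 0 < t₀)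
    (hw : AnalyticAt ℝ w x₀) (hw1 : deriv w x₀ = -1 / t₀) (hw2 : deriv (deriv w) x₀ = 0)
    (hF : AnalyticAt ℝ F (t₀, x₀)) (hF0 : F (t₀, x₀) = 0)
    (hF1 : 0 < fderiv ℝ F (t₀, x₀) (0, 1)) : IsSaddle (planarField w F) (t₀, x₀) := by
  set m := fderiv ℝ F (t₀, x₀) (0, 1) with hm
  set n := fderiv ℝ F (t₀, x₀) (1, 0) with hn
  have ht0 := ht₀.ne'
  have dw : HasFDerivAt (fun p : ℝ × ℝ ↦ deriv w p.2)
      (deriv (deriv w) x₀ • ContinuousLinearMap.snd ℝ ℝ ℝ) (t₀, x₀) :=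
    HasDerivAt.comp_hasFDerivAt (h₂ := deriv w) (t₀, x₀)
      hw.deriv.differentiableAt.hasDerivAt
      (hasFDerivAt_snd (𝕜 := ℝ) (p := (t₀, x₀)))
  have d1 := ((hasFDerivAt_fst (𝕜 := ℝ) (p := (t₀, x₀))).mul dw).const_add 1
  have d2 : HasFDerivAt (planarField w F) _ (t₀, x₀) :=
    d1.prodMk hF.differentiableAt.hasFDerivAt
  have hval : ∀ v : ℝ × ℝ, fderiv ℝ (planarField w F) (t₀, x₀) v =
      (-1 / t₀ * v.1, n * v.1 + m * v.2) := fun v ↦ by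
    have hv : v = v.1 • ((1, 0) : ℝ × ℝ) + v.2 • (0, 1) := by ext <;> simp
    have hFv : fderiv ℝ F (t₀, x₀) v = n * v.1 + m * v.2 := by
      conv_lhs => rw [hv]
      rw [map_add, map_smul, map_smul, smul_eq_mul, smul_eq_mul, ← hm, ← hn]
      ring
    rw [d2.fderiv]
    ext
    · simp [hw1, hw2]
    · simp [hFv]
  refine ⟨?_, -1 / t₀, m, div_neg_of_neg_of_pos (by norm_num) ht₀, hF1, ?_, ?_⟩
  · simp only [planarField, hw1, hF0]
    ext
    · simp only [Prod.fst_zero]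
      field_simp
      norm_num
    · rfl
  · have hsum : 0 < m + 1 / t₀ := by positivity
    refine Module.End.hasEigenvalue_of_hasEigenvector (x := (1, -n / (m + 1 / t₀))) ⟨?_, ?_⟩
    · rw [Module.End.mem_eigenspace_iff, ContinuousLinearMap.coe_coe, hval]
      ext
      · simp
      · simp only [Prod.smul_snd, smul_eq_mul]
        field_simp
        ring
    · simp
  · refine Module.End.hasEigenvalue_of_hasEigenvector (x := (0, 1)) ⟨?_, ?_⟩
    · rw [Module.End.mem_eigenspace_iff, ContinuousLinearMap.coe_coe, hval]
      ext <;> simp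
    · simp

end PressurelessGas

/-! ### The local solution -/

namespace PressurelessGas

/-- The square root of an analytic function with a simple zero is a square root times an analytic
function. -/
theorem exists_sqrt_eq_sqrt_mul {r : ℝ → ℝ} {t₀ : ℝ} (hr : AnalyticAt ℝ r t₀) (hr0 : r t₀ = 0)
    (hr1 : 0 < deriv r t₀) :
    ∃ σ : ℝ → ℝ, AnalyticAt ℝ σ t₀ ∧ 0 < σ t₀ ∧
      ∀ᶠ t in 𝓝 t₀, √(r t) = √(t - t₀) * σ t := by
  obtain ⟨p, hp⟩ := hr
  have hκ : AnalyticAt ℝ (dslope r t₀) t₀ := ⟨_, hp.has_fpower_series_dslope_fslope⟩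
  have hκ0 : 0 < dslope r t₀ t₀ := by rwa [dslope_same]
  have heq : ∀ t, r t = (t - t₀) * dslope r t₀ t := fun t ↦ by
    have := sub_smul_dslope r t₀ t
    rw [hr0, sub_zero, smul_eq_mul] at this
    exact this.symm
  refine ⟨fun t ↦ √(dslope r t₀ t), ?_, Real.sqrt_pos.2 hκ0, ?_⟩
  · exact AnalyticAt.comp (g := fun x ↦ √x) (Real.contDiffAt_sqrt (n := ω) hκ0.ne').analyticAt hκ
  · filter_upwards [hκ.continuousAt.eventually (Ioi_mem_nhds hκ0)] with t ht
    rw [heq t, Real.sqrt_mul' _ (le_of_lt ht)]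

/-- The label of the particle that reaches the position `y` at time `t` moves with a speed
determined by the relative velocity. -/
theorem deriv_label_mul {w z y : ℝ → ℝ} {t : ℝ} (hz : DifferentiableAt ℝ z t)
    (hw : DifferentiableAt ℝ w (z t)) (hzy : ∀ᶠ s in 𝓝 t, z s + s * w (z s) = y s) :
    deriv z t * (1 + t * deriv w (z t)) = deriv y t - w (z t) := by
  have d1 := HasDerivAt.comp (h₂ := w) t hw.hasDerivAt hz.hasDerivAt
  have d2 := hz.hasDerivAt.add ((hasDerivAt_id t).mul d1)
  have d3 := (d2.congr_of_eventuallyEq (f₁ := y) (hzy.mono fun s hs ↦ hs.symm)).deriv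
  rw [d3]
  simp only [id, Function.comp_apply, one_mul]
  ring

end PressurelessGas

open PressurelessGas in
theorem theorem3p1 (ρ₀ w : ℝ → ℝ) (x₀ t₀ : ℝ)
    (hρ : AnalyticAt ℝ ρ₀ x₀) (hw : AnalyticAt ℝ w x₀) (ht₀ : 0 < t₀)
    (hw1 : deriv w x₀ = -1 / t₀) (hw2 : iteratedDeriv 2 w x₀ = 0)
    (hw3 : 0 < iteratedDeriv 3 w x₀) (hρ0 : 0 < ρ₀ x₀) :
    ∃ δ : ℝ, 0 < δ ∧ ∃ a b : ℝ, a < x₀ ∧ x₀ < b ∧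
      ∃ (ρ v : ℝ × ℝ → ℝ) (y m Υ : ℝ → ℝ),
        -- a local solution with a point mass of size `m` along the curve `y`
        PressurelessGas.IsLocalSolution ρ₀ w a b t₀ (t₀ + δ) ρ v y m ∧
        -- the curve is analytic and starts where the singularity forms
        AnalyticOnNhd ℝ y (Set.Icc t₀ (t₀ + δ)) ∧ y t₀ = x₀ + t₀ * w x₀ ∧
        -- the size of the mass
        AnalyticOnNhd ℝ Υ (Set.Icc t₀ (t₀ + δ)) ∧ 0 < Υ t₀ ∧
        (∀ t ∈ Set.Icc t₀ (t₀ + δ), m t = Real.sqrt (t - t₀) * Υ t) ∧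
        -- the curve comes from the analytic stable manifold of a saddle
        ∃ (U : Set (ℝ × ℝ)) (F : ℝ × ℝ → ℝ) (X : ℝ → ℝ),
          IsOpen U ∧ (t₀, x₀) ∈ U ∧
          PressurelessGas.IsVelocityDefect ρ₀ w a b U F ∧
          AnalyticOnNhd ℝ (PressurelessGas.planarField w F) U ∧
          PressurelessGas.IsSaddle (PressurelessGas.planarField w F) (t₀, x₀) ∧
          AnalyticOnNhd ℝ X (Prod.fst '' U) ∧
          PressurelessGas.localStableManifold (PressurelessGas.planarField w F) (t₀, x₀) U
            = {p | p ∈ U ∧ p.2 = X p.1} ∧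
          ∀ t ∈ Set.Icc t₀ (t₀ + δ), (t, X t) ∈ U ∧ y t = X t + t * w (X t) := by
  have hdw2 : deriv (deriv w) x₀ = 0 := by
    rwa [iteratedDeriv_succ, iteratedDeriv_one] at hw2
  obtain ⟨g, hg, hg3, hwg⟩ := exists_eq_cubic hw hw2
  simp only [hw1] at hwg
  have hg0 : 0 < g x₀ := by rw [hg3]; positivity
  obtain ⟨k, hk, hk3, hwk⟩ := exists_deriv_eq_quadratic hg hwg
  obtain ⟨h₁, hh₁, hanti₁, hmono₁⟩ :=
    exists_deriv_strictAnti_strictMono hk (by rw [hk3]; positivity) hwk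
  -- the interval of initial positions
  have hneg : deriv w x₀ < 0 := by rw [hw1]; exact div_neg_of_neg_of_pos (by norm_num) ht₀
  obtain ⟨h₂, hh₂, hbox⟩ := Metric.nhds_basis_closedBall.eventually_iff.1
    (hw.eventually_analyticAt.and (hρ.eventually_analyticAt.and
      ((hρ.continuousAt.eventually (Ioi_mem_nhds hρ0)).and
        (hw.deriv.continuousAt.eventually (Iio_mem_nhds hneg)))))
  set h := min h₁ h₂
  have hh : 0 < h := lt_min hh₁ hh₂
  obtain ⟨a, ha⟩ : ∃ a, a = x₀ - h := ⟨_, rfl⟩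
  obtain ⟨b, hb⟩ : ∃ b, b = x₀ + h := ⟨_, rfl⟩
  have hax : a < x₀ := by linarith
  have hxb : x₀ < b := by linarith
  have hsub : Icc a b ⊆ Metric.closedBall x₀ h₂ := by
    rw [Real.closedBall_eq_Icc]
    exact Icc_subset_Icc (by linarith [min_le_right h₁ h₂]) (by linarith [min_le_right h₁ h₂])
  have hwa : AnalyticOnNhd ℝ w (Icc a b) := fun x hx ↦ (hbox (hsub hx)).1
  have hρa : AnalyticOnNhd ℝ ρ₀ (Icc a b) := fun x hx ↦ (hbox (hsub hx)).2.1
  have hρpos : ∀ x ∈ Icc a b, 0 < ρ₀ x := fun x hx ↦ (hbox (hsub hx)).2.2.1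
  have hwneg : ∀ x ∈ Icc a b, deriv w x < 0 := fun x hx ↦ (hbox (hsub hx)).2.2.2
  have hanti : StrictAntiOn (deriv w) (Icc a x₀) :=
    hanti₁.mono (Icc_subset_Icc_left (by linarith [min_le_left h₁ h₂]))
  have hmono : StrictMonoOn (deriv w) (Icc x₀ b) :=
    hmono₁.mono (Icc_subset_Icc_right (by linarith [min_le_left h₁ h₂]))
  have hwanti : StrictAntiOn w (Icc a b) :=
    strictAntiOn_of_deriv_neg (convex_Icc a b) hwa.continuousOn
      fun x hx ↦ hwneg x (interior_subset hx)
  -- the vector field and its invariant curve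
  obtain ⟨S, R, hS, hR, hS0, hR0, hS1, hR1, hR2, hSR⟩ :=
    exists_analyticAt_root_pair hg hg0 ht₀ hwg
  have hpair := eventually_root_pair hw hg hg0 ht₀ hwg hSR
  obtain ⟨Q, F, hQ, hQ0, hF, hF0, hF1, hQF⟩ :=
    exists_analyticAt_velocityDefect hρ hρ0 hw hS hR hS0 hR0 hS1 hR1
  have hF1' : 0 < fderiv ℝ F (t₀, x₀) (0, 1) := by
    rw [hF1]
    linarith
  obtain ⟨X, c, hX, hX0, hc, hc0, hXc, hXF⟩ :=
    exists_analyticAt_invariant_curve ht₀ hk hwk hF hF0 hF1'.le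
  obtain ⟨ε₁, hε₁, hrep⟩ := exists_repelling hw hdw2 hF hF1' hX hX0 hXF
  have hι : AnalyticAt ℝ (fun t ↦ (t, X t)) t₀ := analyticAt_id.prod hX
  have hιd : ∀ t, AnalyticAt ℝ X t → HasDerivAt (fun t ↦ (t, X t)) (1, deriv X t) t := fun t ht ↦
    (hasDerivAt_id t).prodMk ht.differentiableAt.hasDerivAt
  -- the half width of the interval of absorbed particles has a square root singularity
  obtain ⟨σ, hσ, hσ0, hRσ⟩ := exists_sqrt_eq_sqrt_mul (r := fun t ↦ R (t, X t)) (t₀ := t₀)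
    (AnalyticAt.comp (g := R) (by rwa [hX0]) hι) (by rw [hX0, hR0]) (by
      have d := HasFDerivAt.comp_hasDerivAt (l := R) t₀
        (by rw [hX0]; exact hR.differentiableAt.hasFDerivAt) (hιd t₀ hX)
      rw [show deriv (fun t ↦ R (t, X t)) t₀ = _ from d.deriv,
        show ((1, deriv X t₀) : ℝ × ℝ) = (1, 0) + deriv X t₀ • (0, 1) by simp, map_add, map_smul,
        hR1, smul_zero, add_zero]
      exact hR2)
  obtain ⟨Υ, hΥ⟩ : ∃ Υ : ℝ → ℝ, Υ = fun t ↦ 2 * σ t * Q (t, X t) := ⟨_, rfl⟩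
  have hΥa : AnalyticAt ℝ Υ t₀ := by
    rw [hΥ]
    exact (analyticAt_const.mul hσ).mul (AnalyticAt.comp (g := Q) (by rwa [hX0]) hι)
  -- a neighbourhood of the saddle
  have hSl : ContinuousAt (fun p ↦ S p - √(R p)) (t₀, x₀) :=
    hS.continuousAt.sub hR.continuousAt.sqrt
  have hSr : ContinuousAt (fun p ↦ S p + √(R p)) (t₀, x₀) :=
    hS.continuousAt.add hR.continuousAt.sqrt
  have hsnd : ContinuousAt (Prod.snd : ℝ × ℝ → ℝ) (t₀, x₀) := continuousAt_snd
  have hSl0 : a < S (t₀, x₀) - √(R (t₀, x₀)) := by simpa [hS0, hR0] using hax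
  have hSr0 : S (t₀, x₀) + √(R (t₀, x₀)) < b := by simpa [hS0, hR0] using hxb
  obtain ⟨r, hr, hball⟩ := Metric.eventually_nhds_iff_ball.1
    (hS.eventually_analyticAt.and (hR.eventually_analyticAt.and (hF.eventually_analyticAt.and
      (hpair.and (hQF.and ((hSl.eventually (Ioi_mem_nhds hSl0)).and
        ((hSr.eventually (Iio_mem_nhds hSr0)).and
          (hsnd.eventually (Ioo_mem_nhds hax hxb)))))))))
  obtain ⟨d, hd, hcurve⟩ := Metric.eventually_nhds_iff_ball.1
    (hX.eventually_analyticAt.and (hc.continuousAt.eventually (Ioi_mem_nhds hc0) |>.and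
      (hc.eventually_analyticAt.and (hXc.and (hXF.and (hrep.and (hΥa.eventually_analyticAt.and
        (hRσ.and ((hX.continuousAt.eventually (Metric.ball_mem_nhds (X t₀)
          (half_pos hr))).and (Ioi_mem_nhds ht₀))))))))))
  set e := min d r
  have he : 0 < e := lt_min hd hr
  have hIoo : ∀ t ∈ Ioo (t₀ - e) (t₀ + e), t ∈ Metric.ball t₀ d ∧ t ∈ Metric.ball t₀ r :=
    fun t ht ↦ by
      rw [← Real.ball_eq_Ioo] at ht
      exact ⟨Metric.ball_subset_ball (min_le_left _ _) ht,
        Metric.ball_subset_ball (min_le_right _ _) ht⟩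
  set ε := min ε₁ (r / 2)
  have hε : 0 < ε := lt_min hε₁ (half_pos hr)
  obtain ⟨U, hU⟩ : ∃ U : Set (ℝ × ℝ),
      U = {p | p.1 ∈ Ioo (t₀ - e) (t₀ + e) ∧ |p.2 - X p.1| < ε} := ⟨_, rfl⟩
  have hUball : U ⊆ Metric.ball (t₀, x₀) r := fun p hp ↦ by
    rw [hU] at hp
    have h1 := (hcurve p.1 (hIoo _ hp.1).1).2.2.2.2.2.2.2.2.1
    rw [hX0, Real.dist_eq] at h1
    rw [← ball_prod_same]
    refine ⟨(hIoo _ hp.1).2, ?_⟩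
    rw [Metric.mem_ball, Real.dist_eq]
    have h2 := abs_add_le (p.2 - X p.1) (X p.1 - x₀)
    rw [sub_add_sub_cancel] at h2
    linarith [hp.2, min_le_right ε₁ (r / 2)]
  have hUt : ∀ t ∈ Ioo (t₀ - e) (t₀ + e), (t, X t) ∈ U := fun t ht ↦ by
    rw [hU]
    exact ⟨ht, by simpa using hε⟩
  have hUopen : IsOpen U := by
    have hX' : ContinuousOn (fun p : ℝ × ℝ ↦ |p.2 - X p.1|) {p | p.1 ∈ Ioo (t₀ - e) (t₀ + e)} :=
      fun p hp ↦ ((continuousAt_snd.sub (ContinuousAt.comp (f := Prod.fst) (g := X)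
        (hcurve p.1 (hIoo _ hp).1).1.continuousAt continuousAt_fst)).abs).continuousWithinAt
    rw [hU]
    exact hX'.isOpen_inter_preimage (isOpen_Ioo.preimage continuous_fst) isOpen_Iio
  have ht₀I : t₀ ∈ Ioo (t₀ - e) (t₀ + e) := ⟨by linarith, by linarith⟩
  have hIco : ∀ t ∈ Ico t₀ (t₀ + e), t ∈ Ioo (t₀ - e) (t₀ + e) := fun t ht ↦
    ⟨by linarith [ht.1], ht.2⟩
  -- the curve and the interval of absorbed particles
  obtain ⟨y, hy⟩ : ∃ y : ℝ → ℝ, y = fun t ↦ X t + t * w (X t) := ⟨_, rfl⟩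
  obtain ⟨xl, hxl⟩ : ∃ xl : ℝ → ℝ, xl = fun t ↦ S (t, X t) - √(R (t, X t)) := ⟨_, rfl⟩
  obtain ⟨xr, hxr⟩ : ∃ xr : ℝ → ℝ, xr = fun t ↦ S (t, X t) + √(R (t, X t)) := ⟨_, rfl⟩
  have hwX : ∀ t ∈ Ioo (t₀ - e) (t₀ + e), AnalyticAt ℝ w (X t) := fun t ht ↦
    hwa _ (Ioo_subset_Icc_self (hball _ (hUball (hUt t ht))).2.2.2.2.2.2.2)
  have hya : ∀ t ∈ Ioo (t₀ - e) (t₀ + e), AnalyticAt ℝ y t := fun t ht ↦ by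
    rw [hy]
    have hXt := (hcurve t (hIoo t ht).1).1
    exact hXt.add (analyticAt_id.mul (AnalyticAt.comp (g := w) (hwX t ht) hXt))
  have hxlc : ∀ t ∈ Ioo (t₀ - e) (t₀ + e), a < xl t ∧ ContinuousAt xl t := fun t ht ↦ by
    have hp := hball _ (hUball (hUt t ht))
    have hc := (hιd t (hcurve t (hIoo t ht).1).1).continuousAt
    rw [hxl]
    exact ⟨hp.2.2.2.2.2.1, (ContinuousAt.comp (g := S) (f := fun t ↦ (t, X t))
      hp.1.continuousAt hc).sub
      (ContinuousAt.comp (g := R) (f := fun t ↦ (t, X t)) hp.2.1.continuousAt hc).sqrt⟩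
  have hxrc : ∀ t ∈ Ioo (t₀ - e) (t₀ + e), xr t < b ∧ ContinuousAt xr t := fun t ht ↦ by
    have hp := hball _ (hUball (hUt t ht))
    have hc := (hιd t (hcurve t (hIoo t ht).1).1).continuousAt
    rw [hxr]
    exact ⟨hp.2.2.2.2.2.2.1, (ContinuousAt.comp (g := S) (f := fun t ↦ (t, X t))
      hp.1.continuousAt hc).add
      (ContinuousAt.comp (g := R) (f := fun t ↦ (t, X t)) hp.2.1.continuousAt hc).sqrt⟩
  have hxl0 : xl t₀ = x₀ := by simp [hxl, hX0, hS0, hR0]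
  have hxr0 : xr t₀ = x₀ := by simp [hxr, hX0, hS0, hR0]
  have hneg' : ∀ t ∈ Ioo t₀ (t₀ + e), 1 + t * deriv w (X t) < 0 := fun t ht ↦ by
    have hp := hcurve t (hIoo t (hIco t ⟨ht.1.le, ht.2⟩)).1
    rw [hp.2.2.2.1]
    nlinarith [hp.2.1, ht.1]
  have hpos : ∀ t ∈ Ioo t₀ (t₀ + e), 0 < R (t, X t) ∧ xl t < X t ∧ X t < xr t ∧
      xl t + t * w (xl t) = y t ∧ xr t + t * w (xr t) = y t := fun t ht ↦ by
    rw [hxl, hxr, hy]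
    exact (hball _ (hUball (hUt t (hIco t ⟨ht.1.le, ht.2⟩)))).2.2.2.1 (hneg' t ht)
  have hslope : ∀ t ∈ Ioo t₀ (t₀ + e), xl t < x₀ ∧ x₀ < xr t ∧
      0 < 1 + t * deriv w (xl t) ∧ 0 < 1 + t * deriv w (xr t) := fun t ht ↦ by
    have htI := hIco t ⟨ht.1.le, ht.2⟩
    obtain ⟨-, h1, h2, h3, h4⟩ := hpos t ht
    rw [hy] at h3 h4
    exact slope_pos_of_outer hwa hanti hmono (ht₀.trans ht.1) (hxlc t htI).1.le h1 h2
      (hxrc t htI).1.le (hneg' t ht) h3 h4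
  have hyd : ∀ t ∈ Ioo (t₀ - e) (t₀ + e), deriv y t = F (t, X t) + w (X t) := fun t ht ↦ by
    have hp := hcurve t (hIoo t ht).1
    have d1 := hp.1.differentiableAt.hasDerivAt
    have d2 := d1.add ((hasDerivAt_id t).mul
      (HasDerivAt.comp (h₂ := w) t (hwX t ht).differentiableAt.hasDerivAt d1))
    rw [hy, show deriv (fun t ↦ X t + t * w (X t)) t = _ from d2.deriv, ← hp.2.2.2.2.1]
    simp only [id, Function.comp_apply, one_mul]
    ring
  -- the point mass moves with the mean velocity of the absorbed particles
  have hmean : ∀ t ∈ Ioo t₀ (t₀ + e), 0 < ∫ x in xl t..xr t, ρ₀ x ∧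
      deriv y t = (∫ x in xl t..xr t, ρ₀ x * w x) / (∫ x in xl t..xr t, ρ₀ x) ∧
      deriv y t ∈ Ioo (w (xr t)) (w (xl t)) := fun t ht ↦ by
    have htI := hIco t ⟨ht.1.le, ht.2⟩
    obtain ⟨h0, h1, h2, -, -⟩ := hpos t ht
    obtain ⟨h3, h4⟩ := mean_velocity_mem hρa.continuousOn hρpos hwa.continuousOn hwanti
      (hxlc t htI).1.le (h1.trans h2) (hxrc t htI).1.le
    have h5 : deriv y t = (∫ x in xl t..xr t, ρ₀ x * w x) / (∫ x in xl t..xr t, ρ₀ x) := by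
      rw [hyd t htI, ((hball _ (hUball (hUt t htI))).2.2.2.2.1 h0.le).2 h0, hxl, hxr]
      ring
    exact ⟨h3, h5, h5 ▸ h4⟩
  have hxld : ∀ t ∈ Ioo t₀ (t₀ + e), deriv xl t < 0 ∧ 0 < deriv xr t := fun t ht ↦ by
    have htI := hIco t ⟨ht.1.le, ht.2⟩
    obtain ⟨h0, h1, h2, -, -⟩ := hpos t ht
    obtain ⟨h3, h4, h5, h6⟩ := hslope t ht
    have hp := hball _ (hUball (hUt t htI))
    have hd := (hιd t (hcurve t (hIoo t htI).1).1).differentiableAt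
    have hSd := DifferentiableAt.comp (g := S) t hp.1.differentiableAt hd
    have hRd := (DifferentiableAt.comp (g := R) t hp.2.1.differentiableAt hd).sqrt h0.ne'
    have hl : DifferentiableAt ℝ xl t := by rw [hxl]; exact hSd.sub hRd
    have hr : DifferentiableAt ℝ xr t := by rw [hxr]; exact hSd.add hRd
    have e1 := deriv_label_mul hl
      (hwa _ ⟨(hxlc t htI).1.le, h3.le.trans hxb.le⟩).differentiableAt
      (by filter_upwards [Ioo_mem_nhds ht.1 ht.2] with s hs using (hpos s hs).2.2.2.1)
    have e2 := deriv_label_mul hr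
      (hwa _ ⟨hax.le.trans h4.le, (hxrc t htI).1.le⟩).differentiableAt
      (by filter_upwards [Ioo_mem_nhds ht.1 ht.2] with s hs using (hpos s hs).2.2.2.2)
    obtain ⟨-, -, h7, h8⟩ := hmean t ht
    constructor
    · exact neg_of_mul_neg_left (by linarith) h5.le
    · exact pos_of_mul_pos_left (by linarith) h6.le
  have hxlco : ContinuousOn xl (Ico t₀ (t₀ + e)) := fun t ht ↦
    (hxlc t (hIco t ht)).2.continuousWithinAt
  have hxrco : ContinuousOn xr (Ico t₀ (t₀ + e)) := fun t ht ↦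
    (hxrc t (hIco t ht)).2.continuousWithinAt
  have hy0 : y t₀ = x₀ + t₀ * w x₀ := by simp only [hy, hX0]
  have habs : IsAbsorbing w a b x₀ t₀ (t₀ + e) xl xr y :=
    { lt_left := hax
      lt_right := hxb
      t₀_pos := ht₀
      analytic := hwa
      focus := by rw [hw1]; field_simp; norm_num
      deriv_neg := hwneg
      anti := hanti
      mono := hmono
      xl_start := hxl0
      xr_start := hxr0
      xl_cont := hxlco
      xr_cont := hxrco
      xl_gt := fun t ht ↦ (hxlc t (hIco t ht)).1
      xr_lt := fun t ht ↦ (hxrc t (hIco t ht)).1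
      xl_slope := fun t ht ↦ (hslope t ht).2.2.1
      xr_slope := fun t ht ↦ (hslope t ht).2.2.2
      xl_meet := fun t ht ↦ by
        rcases ht.1.eq_or_lt with rfl | h
        · rw [hxl0, hy0]
        · exact (hpos t ⟨h, ht.2⟩).2.2.2.1
      xr_meet := fun t ht ↦ by
        rcases ht.1.eq_or_lt with rfl | h
        · rw [hxr0, hy0]
        · exact (hpos t ⟨h, ht.2⟩).2.2.2.2
      xl_anti := strictAntiOn_of_deriv_neg (convex_Ico _ _) hxlco fun t ht ↦ by
        rw [interior_Ico] at ht
        exact (hxld t ht).1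
      xr_mono := strictMonoOn_of_deriv_pos (convex_Ico _ _) hxrco fun t ht ↦ by
        rw [interior_Ico] at ht
        exact (hxld t ht).2 }
  have hIcc : ∀ t ∈ Icc t₀ (t₀ + e / 2), t ∈ Ioo (t₀ - e) (t₀ + e) := fun t ht ↦
    hIco t ⟨ht.1, by linarith [ht.2]⟩
  have hIoc : ∀ t ∈ Ioc t₀ (t₀ + e / 2), t ∈ Ioo t₀ (t₀ + e) := fun t ht ↦
    ⟨ht.1, by linarith [ht.2]⟩
  have hyIcc : AnalyticOnNhd ℝ y (Icc t₀ (t₀ + e / 2)) := fun t ht ↦ hya t (hIcc t ht)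
  have hfst : ∀ t ∈ Prod.fst '' U, t ∈ Ioo (t₀ - e) (t₀ + e) := by
    rintro _ ⟨p, hp, rfl⟩
    rw [hU] at hp
    exact hp.1
  refine ⟨e / 2, half_pos he, a, b, hax, hxb, gasDensity w ρ₀ a b t₀ (t₀ + e) xl xr,
    gasVelocity w a b t₀ (t₀ + e) xl xr, y, fun t ↦ ∫ x in xl t..xr t, ρ₀ x, Υ,
    habs.isLocalSolution (by linarith) (by linarith) hρa hρpos hyIcc (fun _ _ ↦ rfl)
      (fun t ht ↦ ?_) (fun t ht ↦ Ioo_subset_Icc_self (hmean t (hIoc t ht)).2.2),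
    hyIcc, hy0, fun t ht ↦ (hcurve t (hIoo t (hIcc t ht)).1).2.2.2.2.2.2.1, ?_, fun t ht ↦ ?_,
    U, F, X, hUopen, ?_, fun t x htx hx ↦ ?_, fun p hp ↦ ?_,
    isSaddle_planarField ht₀ hw hw1 hdw2 hF hF0 hF1',
    fun t ht ↦ (hcurve t (hIoo t (hfst t ht)).1).1, ?_,
    fun t ht ↦ ⟨hUt t (hIcc t ht), by rw [hy]⟩⟩
  · obtain ⟨h1, h2, -⟩ := hmean t (hIoc t ht)
    rw [h2, mul_div_cancel₀ _ h1.ne']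
  · simp only [hΥ, hX0]
    positivity
  · have htI := hIcc t ht
    have hR' : 0 ≤ R (t, X t) := by
      rcases ht.1.eq_or_lt with rfl | h
      · rw [hX0, hR0]
      · exact (hpos t (hIoc t ⟨h, ht.2⟩)).1.le
    have h1 := ((hball _ (hUball (hUt t htI))).2.2.2.2.1 hR').1
    rw [(hcurve t (hIoo t htI).1).2.2.2.2.2.2.2.1] at h1
    simp only [hxl, hxr, hΥ]
    rw [(hcurve t (hIoo t htI).1).2.2.2.2.2.2.2.1, h1]
    ring
  · have := hUt t₀ ht₀I
    rwa [hX0] at this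
  · have hp := hball _ (hUball htx)
    have ht : 0 < t := (hcurve t (hIoo t (hfst t ⟨_, htx, rfl⟩)).1).2.2.2.2.2.2.2.2.2
    obtain ⟨h0, h1, h2, h3, h4⟩ := hp.2.2.2.1 hx
    obtain ⟨-, -, h5, h6⟩ := slope_pos_of_outer hwa hanti hmono ht hp.2.2.2.2.2.1.le h1 h2
      hp.2.2.2.2.2.2.1.le hx h3 h4
    exact ⟨_, ⟨hp.2.2.2.2.2.1, h1.trans hp.2.2.2.2.2.2.2.2⟩, _,
      ⟨hp.2.2.2.2.2.2.2.1.trans h2, hp.2.2.2.2.2.2.1⟩, h1, h2, h5, h6, h3, h4,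
      (hp.2.2.2.2.1 h0.le).2 h0⟩
  · have hp' := hball _ (hUball hp)
    have hwp : AnalyticAt ℝ (deriv w) p.2 := (hwa _ (Ioo_subset_Icc_self hp'.2.2.2.2.2.2.2)).deriv
    exact (analyticAt_const.add (analyticAt_fst.mul
      (AnalyticAt.comp (g := deriv w) (f := Prod.snd) hwp analyticAt_snd))).prod hp'.2.2.1
  · rw [hU]
    exact localStableManifold_eq_graph he hε
      (fun t ht ↦ (hcurve t (hIoo t ht).1).1.differentiableAt) hX0
      (fun t ht ↦ (hcurve t (hIoo t ht).1).2.2.1.continuousAt.continuousWithinAt)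
      (fun t ht ↦ (hcurve t (hIoo t ht).1).2.1)
      (fun t ht ↦ (hcurve t (hIoo t ht).1).2.2.2.1)
      (fun t ht ↦ (hcurve t (hIoo t ht).1).2.2.2.2.1)
      (fun t ht x hx ↦ (hcurve t (hIoo t ht).1).2.2.2.2.2.1 x (hx.trans_le (min_le_left _ _)))
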